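/- Let $k$ be a $\sigma$-field, i.e. a field with a ring endomorphism $\sigma\colon k\to k$. A $k$-$\sigma$-algebra is a commutative $k$-algebra $R$ with a ring endomorphism $\sigma\colon R\to R$ extending $\sigma\colon k\to k$ along the structure map. A $\sigma$-algebraic group $G$ over $k$ is a group functor on $k$-$\sigma$-algebras represented by a $k$-$\sigma$-algebra $k\{G\}$ which is finitely $\sigma$-generated; equivalently $k\{G\}$ is a finitely $\sigma$-generated $k$-$\sigma$-Hopf algebra (a commutative Hopf algebra and $k$-$\sigma$-algebra whose comultiplication, counit and antipode commute with $\sigma$). An algebraic group over $k$ is an affine group scheme $\mathcal G$ of finite type over $k$; it defines the $\sigma$-algebraic group $R\mapsto\mathcal G(R)$, with coordinate ring $k\{\mathcal G\}=\bigcup_i k[\mathcal G[i]]$, where $\mathcal G[i]=\mathcal G\times{}^{\sigma}\mathcal G\times\dots\times{}^{\sigma^i}\mathcal G$ and ${}^{\sigma^i}$ is base change along $\sigma^i\colon k\to k$. A $\sigma$-closed embedding $G\hookrightarrow\mathcal G$ is a morphism of $\sigma$-algebraic groups whose dual $k\{\mathcal G\}\to k\{G\}$ is surjective. Given such an embedding,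 with $\mathbb I(G)=\ker(k\{\mathcal G\}\to k\{G\})$, let $G[i]\le\mathcal G[i]$ be the closed subgroup defined by $\mathbb I(G)\cap k[\mathcal G[i]]$, let $\mathcal G_0=G[0]$ and let $\mathcal G_i=\ker(\pi_i\colon G[i]\to G[i-1])$ for $i\ge1$, where $\pi_i$ omits the last coordinate. Omitting the first coordinate induces morphisms $\sigma_i\colon\mathcal G_i\to{}^{\sigma}(\mathcal G_{i-1})$ for $i\geq 1$. Let $m\ge0$ be the smallest integer such that $\sigma_i$ is an isomorphism for all $i>m$. The growth group of $G$ with respect to the embedding is $\mathcal G_m$; its size is $\dim_k k[\mathcal G_m]\in\mathbb N\cup\{\infty\}$. **Proposition.** Let $G$ be a $\sigma$-algebraic group over $k$. Then $G$ has a $\sigma$-closed embedding into some algebraic group; for every such embedding the integer $m$, hence the growth group, exists; and the size of the growth group does not depend on the choice of $\mathcal G$ and of the $\sigma$-closed embedding $G\hookrightarrow\mathcal G$. The common value is called the limit degree $\operatorname{ld}(G)\in\mathbb N\cup\{\infty\}$. Moreover, the limit degree is multiplicative: if $N\trianglelefteq G$ is a normal $\sigma$-closed subgroup (i.e. $N(R)$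 is normal in $G(R)$ for every $k$-$\sigma$-algebra $R$) and $G\to G/N$ is a quotient of $G$ mod $N$ (a morphism of $\sigma$-algebraic groups that is trivial on $N$ and through which every morphism of $\sigma$-algebraic groups $G\to H$ trivial on $N$ factors uniquely), then $$\operatorname{ld}(G)=\operatorname{ld}(G/N)\cdot\operatorname{ld}(N).$$ -/

import Mathlib

open scoped TensorProduct

universe u

noncomputable section

/-! ## Difference rings and difference algebras -/

/-- A difference ring (`σ`-ring): a commutative ring with a ring endomorphism `σ`
(not assumed to be injective). -/
class DifferenceRing (R : Type*) [CommRing R] where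
  /-- The distinguished endomorphism. -/
  sigma : R →+* R

/-- The distinguished endomorphism `σ : R → R` of a difference ring. -/
def dsigma {R : Type*} [CommRing R] [DifferenceRing R] : R →+* R := DifferenceRing.sigma

/-- A `k`-`σ`-algebra: a `k`-algebra and `σ`-ring whose structure map `k → A` commutes
with `σ`. -/
class DifferenceAlgebra (k A : Type*) [CommRing k] [DifferenceRing k] [CommRing A]
    [DifferenceRing A] [Algebra k A] : Prop where
  sigma_algebraMap : ∀ c : k, dsigma (algebraMap k A c) = algebraMap k A (dsigma c)

namespace DifferenceAlgebra

variable {k A A' : Type*} [CommRing k] [DifferenceRing k]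
  [CommRing A] [DifferenceRing A] [Algebra k A] [DifferenceAlgebra k A]
  [CommRing A'] [DifferenceRing A'] [Algebra k A'] [DifferenceAlgebra k A']

instance self : DifferenceAlgebra k k := ⟨fun _ => rfl⟩

theorem iterate_algebraMap (n : ℕ) (c : k) :
    dsigma^[n] (algebraMap k A c) = algebraMap k A (dsigma^[n] c) := by
  induction n with
  | zero => rfl
  | succ n ih => rw [Function.iterate_succ_apply', ih, sigma_algebraMap,
      Function.iterate_succ_apply']

/-- `σ` on a `k`-`σ`-algebra, as a `σ`-semilinear map. -/
def semilinear (k A : Type*) [CommRing k] [DifferenceRing k]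
    [CommRing A] [DifferenceRing A] [Algebra k A] [DifferenceAlgebra k A] :
    A →ₛₗ[(dsigma : k →+* k)] A where
  toFun := dsigma
  map_add' := map_add _
  map_smul' c a := by
    rw [Algebra.smul_def, map_mul, sigma_algebraMap, ← Algebra.smul_def]

/-- The additive map `σ ⊗ σ` on `A ⊗ A'`. -/
def tensorMap : A ⊗[k] A' →ₛₗ[(dsigma : k →+* k)] A ⊗[k] A' :=
  TensorProduct.map (semilinear k A) (semilinear k A')

theorem tensorMap_tmul (a : A) (b : A') :
    tensorMap (k := k) (a ⊗ₜ[k] b) = dsigma a ⊗ₜ[k] dsigma b := rfl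

/-- The `σ`-ring `A ⊗[k] A'` with `σ (a ⊗ b) = σ a ⊗ σ b`. -/
instance tensor : DifferenceRing (A ⊗[k] A') where
  sigma :=
    { toFun := tensorMap
      map_zero' := map_zero _
      map_add' := map_add _
      map_one' := by
        rw [Algebra.TensorProduct.one_def, tensorMap_tmul, map_one, map_one]
      map_mul' := by
        intro x y
        induction x using TensorProduct.induction_on with
        | zero => simp
        | add x₁ x₂ h₁ h₂ => rw [add_mul, map_add, map_add, add_mul, h₁, h₂]
        | tmul a b =>
          induction y using TensorProduct.induction_on with
          | zero => simp
          | add y₁ y₂ h₁ h₂ => rw [mul_add, map_add, map_add, mul_add, h₁, h₂]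
          | tmul a' b' =>
            rw [Algebra.TensorProduct.tmul_mul_tmul, tensorMap_tmul, tensorMap_tmul,
              tensorMap_tmul, Algebra.TensorProduct.tmul_mul_tmul, map_mul, map_mul] }

theorem dsigma_tmul (a : A) (b : A') :
    dsigma (a ⊗ₜ[k] b) = dsigma a ⊗ₜ[k] dsigma b := rfl

instance tensorAlgebra : DifferenceAlgebra k (A ⊗[k] A') where
  sigma_algebraMap c := by
    rw [Algebra.TensorProduct.algebraMap_apply, dsigma_tmul, sigma_algebraMap, map_one,
      Algebra.TensorProduct.algebraMap_apply]

end DifferenceAlgebra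

/-- `A` is finitely `σ`-generated over `k`: there is a finite set whose transforms under all
powers of `σ` generate `A` as a `k`-algebra. -/
def FinitelySigmaGenerated (k A : Type*) [CommRing k] [CommRing A] [DifferenceRing A]
    [Algebra k A] : Prop :=
  ∃ s : Finset A, Algebra.adjoin k {x : A | ∃ n : ℕ, ∃ a ∈ s, x = dsigma^[n] a} = ⊤

/-- A `k`-`σ`-Hopf algebra: a commutative Hopf algebra over `k` and a `k`-`σ`-algebra such that
comultiplication, counit and antipode commute with `σ`. Those which are finitely `σ`-generated
are the coordinate rings `k{G}` of the `σ`-algebraic groups `G` over `k`. -/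
class DifferenceHopfAlgebra (k A : Type*) [CommRing k] [DifferenceRing k] [CommRing A]
    [DifferenceRing A] [HopfAlgebra k A] : Prop extends DifferenceAlgebra k A where
  sigma_comul : ∀ a : A, Coalgebra.comul (R := k) (dsigma a) =
    (dsigma (Coalgebra.comul (R := k) a) : A ⊗[k] A)
  sigma_counit : ∀ a : A, Coalgebra.counit (R := k) (dsigma a) =
    dsigma (Coalgebra.counit (R := k) a)
  sigma_antipode : ∀ a : A, HopfAlgebra.antipode k (dsigma a) =
    dsigma (HopfAlgebra.antipode k a)

/-- Morphisms of `k`-`σ`-algebras. -/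
structure SigmaAlgHom (k A A' : Type*) [CommRing k]
    [CommRing A] [DifferenceRing A] [Algebra k A]
    [CommRing A'] [DifferenceRing A'] [Algebra k A'] extends A →ₐ[k] A' where
  map_sigma : ∀ a : A, toFun (dsigma a) = dsigma (toFun a)

/-- Morphisms of `k`-`σ`-Hopf algebras (dual to morphisms of `σ`-algebraic groups). -/
structure SigmaHopfHom (k A A' : Type*) [CommRing k]
    [CommRing A] [DifferenceRing A] [HopfAlgebra k A]
    [CommRing A'] [DifferenceRing A'] [HopfAlgebra k A'] extends A →ₐc[k] A' where
  map_sigma : ∀ a : A, toFun (dsigma a) = dsigma (toFun a)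

/-! ## The `σ`-algebraic group attached to an algebraic group -/

/-- Defining relations of `[σ]_k B` among the symbols `σ^n(b)`: each `b ↦ σ^n(b)` is a ring
homomorphism which restricts to `σ^n` on `k`. -/
inductive SigmaExtRel (k B : Type*) [CommRing k] [DifferenceRing k] [CommRing B] [Algebra k B] :
    MvPolynomial (ℕ × B) k → MvPolynomial (ℕ × B) k → Prop
  | add (n : ℕ) (b c : B) : SigmaExtRel k B (MvPolynomial.X (n, b + c))
      (MvPolynomial.X (n, b) + MvPolynomial.X (n, c))
  | mul (n : ℕ) (b c : B) : SigmaExtRel k B (MvPolynomial.X (n, b * c))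
      (MvPolynomial.X (n, b) * MvPolynomial.X (n, c))
  | algebraMap (n : ℕ) (r : k) : SigmaExtRel k B (MvPolynomial.X (n, algebraMap k B r))
      (MvPolynomial.C (dsigma^[n] r))

/-- The ideal generated by the defining relations. -/
def sigmaExtIdeal (k B : Type*) [CommRing k] [DifferenceRing k] [CommRing B] [Algebra k B] :
    Ideal (MvPolynomial (ℕ × B) k) :=
  Ideal.span {p | ∃ x y, SigmaExtRel k B x y ∧ p = x - y}

/-- The free `k`-`σ`-algebra `[σ]_k B = B ⊗ ^σB ⊗ ^{σ²}B ⊗ ⋯` on a `k`-algebra `B`, presented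
by the generators `σ^n(b)`. For `B = k[𝒢]` it is the coordinate ring `k{𝒢}`. -/
def SigmaExt (k B : Type*) [CommRing k] [DifferenceRing k] [CommRing B] [Algebra k B] :=
  MvPolynomial (ℕ × B) k ⧸ sigmaExtIdeal k B

namespace SigmaExt

section Algebra

variable (k B : Type*) [CommRing k] [DifferenceRing k] [CommRing B] [Algebra k B]

instance : CommRing (SigmaExt k B) :=
  inferInstanceAs (CommRing (MvPolynomial (ℕ × B) k ⧸ sigmaExtIdeal k B))

instance : Algebra k (SigmaExt k B) :=
  inferInstanceAs (Algebra k (MvPolynomial (ℕ × B) k ⧸ sigmaExtIdeal k B))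

/-- The quotient map from the polynomial ring. -/
def mk : MvPolynomial (ℕ × B) k →ₐ[k] SigmaExt k B :=
  Ideal.Quotient.mkₐ k (sigmaExtIdeal k B)

variable {k B}

theorem mk_surjective : Function.Surjective (mk k B) :=
  Ideal.Quotient.mkₐ_surjective k (sigmaExtIdeal k B)

theorem mk_eq {x y : MvPolynomial (ℕ × B) k} (h : SigmaExtRel k B x y) :
    mk k B x = mk k B y :=
  Ideal.Quotient.eq.2 (Ideal.subset_span ⟨x, y, h, rfl⟩)

/-- Ring homomorphisms out of `[σ]_k B`. -/
def liftRing {R : Type*} [CommRing R] (f : MvPolynomial (ℕ × B) k →+* R)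
    (hf : ∀ x y, SigmaExtRel k B x y → f x = f y) : SigmaExt k B →+* R :=
  Ideal.Quotient.lift (sigmaExtIdeal k B) f (by
    have h : sigmaExtIdeal k B ≤ RingHom.ker f := by
      refine Ideal.span_le.2 ?_
      rintro _ ⟨x, y, hxy, rfl⟩
      simp [hf x y hxy]
    exact fun a ha => h ha)

theorem liftRing_mk {R : Type*} [CommRing R] (f : MvPolynomial (ℕ × B) k →+* R)
    (hf : ∀ x y, SigmaExtRel k B x y → f x = f y) (p : MvPolynomial (ℕ × B) k) :
    liftRing f hf (mk k B p) = f p :=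
  rfl

variable (k B) in
/-- The element `σ^n(b)` of `[σ]_k B`; for fixed `n` a ring homomorphism in `b`. -/
def gen (n : ℕ) : B →+* SigmaExt k B where
  toFun b := mk k B (MvPolynomial.X (n, b))
  map_add' b c := by rw [mk_eq (.add n b c), map_add]
  map_mul' b c := by rw [mk_eq (.mul n b c), map_mul]
  map_zero' := by
    have h := mk_eq (.algebraMap (B := B) n (0 : k))
    rwa [map_zero, iterate_map_zero, map_zero, map_zero] at h
  map_one' := by
    have h := mk_eq (.algebraMap (B := B) n (1 : k))
    rwa [map_one, iterate_map_one, map_one, map_one] at h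

theorem mk_X (n : ℕ) (b : B) : mk k B (MvPolynomial.X (n, b)) = gen k B n b := rfl

theorem gen_algebraMap (n : ℕ) (r : k) :
    gen k B n (algebraMap k B r) = algebraMap k (SigmaExt k B) (dsigma^[n] r) := by
  change mk k B _ = _
  rw [mk_eq (.algebraMap n r), ← MvPolynomial.algebraMap_eq, AlgHom.commutes]

/-- `σ` on the polynomial ring: `σ^n(b) ↦ σ^(n+1)(b)` and `σ` on the coefficients. -/
def polySigma (k B : Type*) [CommRing k] [DifferenceRing k] :
    MvPolynomial (ℕ × B) k →+* MvPolynomial (ℕ × B) k :=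
  MvPolynomial.eval₂Hom ((MvPolynomial.C).comp dsigma)
    (fun p => MvPolynomial.X (p.1 + 1, p.2))

instance : DifferenceRing (SigmaExt k B) where
  sigma := liftRing ((mk k B : _ →+* SigmaExt k B).comp (polySigma k B)) (by
    rintro _ _ (⟨n, b, c⟩ | ⟨n, b, c⟩ | ⟨n, r⟩)
    · simp [polySigma, mk_X]
    · simp [polySigma, mk_X]
    · have h := mk_eq (.algebraMap (B := B) (n + 1) r)
      rw [Function.iterate_succ_apply'] at h
      simpa [polySigma] using h)

theorem dsigma_mk (p : MvPolynomial (ℕ × B) k) :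
    dsigma (mk k B p) = mk k B (polySigma k B p) := rfl

theorem dsigma_gen (n : ℕ) (b : B) : dsigma (gen k B n b) = gen k B (n + 1) b := by
  rw [← mk_X, dsigma_mk]
  simp [polySigma, mk_X]

instance : DifferenceAlgebra k (SigmaExt k B) where
  sigma_algebraMap c := by
    rw [← AlgHom.commutes (mk k B), dsigma_mk, MvPolynomial.algebraMap_eq]
    simp only [polySigma, MvPolynomial.coe_eval₂Hom, MvPolynomial.eval₂_C, RingHom.comp_apply]
    rw [← MvPolynomial.algebraMap_eq, AlgHom.commutes]

theorem iterate_dsigma_gen (n : ℕ) (b : B) : dsigma^[n] (gen k B 0 b) = gen k B n b := by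
  induction n with
  | zero => rfl
  | succ n ih => rw [Function.iterate_succ_apply', ih, dsigma_gen]

variable (k B) in
/-- The canonical morphism `B → [σ]_k B` of `k`-algebras. -/
def incl : B →ₐ[k] SigmaExt k B :=
  { gen k B 0 with commutes' := fun r => gen_algebraMap 0 r }

theorem incl_apply (b : B) : incl k B b = gen k B 0 b := rfl

section Lift

variable {R : Type*} [CommRing R] [DifferenceRing R] [Algebra k R] [DifferenceAlgebra k R]

/-- Existence part of the universal property of `[σ]_k B`: a morphism of `k`-algebras from `B`
to a `k`-`σ`-algebra extends to `[σ]_k B` by `σ^n(b) ↦ σ^n(ψ(b))`. -/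
def lift (ψ : B →ₐ[k] R) : SigmaExt k B →ₐ[k] R :=
  { liftRing (MvPolynomial.aeval (R := k)
      (fun p : ℕ × B => dsigma^[p.1] (ψ p.2))).toRingHom (by
        rintro _ _ (⟨n, b, c⟩ | ⟨n, b, c⟩ | ⟨n, r⟩)
        · simp
        · simp
        · simp [DifferenceAlgebra.iterate_algebraMap]) with
    commutes' := fun r => by
      change liftRing _ _ (algebraMap k (SigmaExt k B) r) = _
      rw [← AlgHom.commutes (mk k B), liftRing_mk]
      simp }

@[simp]
theorem lift_gen (ψ : B →ₐ[k] R) (n : ℕ) (b : B) :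
    lift ψ (gen k B n b) = dsigma^[n] (ψ b) := by
  change MvPolynomial.aeval (R := k) (fun p : ℕ × B => dsigma^[p.1] (ψ p.2))
    (MvPolynomial.X (n, b)) = _
  simp

end Lift

/-- Two ring homomorphisms out of `[σ]_k B` agree if they agree on `k` and on the `σ^n(b)`. -/
theorem ringHom_ext {R : Type*} [CommRing R] {f g : SigmaExt k B →+* R}
    (hk : ∀ c : k, f (algebraMap k _ c) = g (algebraMap k _ c))
    (hg : ∀ n b, f (gen k B n b) = g (gen k B n b)) : f = g := by
  have h : f.comp (mk k B : MvPolynomial (ℕ × B) k →+* SigmaExt k B) =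
      g.comp (mk k B : MvPolynomial (ℕ × B) k →+* SigmaExt k B) := by
    apply MvPolynomial.ringHom_ext
    · intro c
      simpa [← MvPolynomial.algebraMap_eq] using hk c
    · rintro ⟨n, b⟩
      exact hg n b
  ext x
  obtain ⟨p, rfl⟩ := mk_surjective x
  exact RingHom.congr_fun h p

theorem commutes_of_gen {R : Type*} [CommRing R] [DifferenceRing R] [Algebra k R]
    [DifferenceAlgebra k R] (f : SigmaExt k B →ₐ[k] R)
    (hf : ∀ n b, f (gen k B (n + 1) b) = dsigma (f (gen k B n b))) (x : SigmaExt k B) :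
    f (dsigma x) = dsigma (f x) := by
  have h : (f : SigmaExt k B →+* R).comp dsigma = dsigma.comp (f : SigmaExt k B →+* R) := by
    apply ringHom_ext
    · intro c
      simp [DifferenceAlgebra.sigma_algebraMap]
    · intro n b
      simpa [dsigma_gen] using hf n b
  exact RingHom.congr_fun h x

theorem lift_sigma {R : Type*} [CommRing R] [DifferenceRing R] [Algebra k R]
    [DifferenceAlgebra k R] (ψ : B →ₐ[k] R) (x : SigmaExt k B) :
    lift ψ (dsigma x) = dsigma (lift ψ x) :=
  commutes_of_gen _ (fun n b => by
    rw [lift_gen, lift_gen, Function.iterate_succ_apply']) x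

/-- Morphisms out of `[σ]_k B` which commute with `σ` on generators are determined on `B`. -/
theorem algHom_ext {R : Type*} [CommRing R] [DifferenceRing R] [Algebra k R]
    {f g : SigmaExt k B →ₐ[k] R}
    (hf : ∀ x, f (dsigma x) = dsigma (f x)) (hg : ∀ x, g (dsigma x) = dsigma (g x))
    (h : ∀ b, f (incl k B b) = g (incl k B b)) : f = g := by
  have key : (f : SigmaExt k B →+* R) = g := by
    apply ringHom_ext
    · intro c
      simp
    · intro n b
      induction n with
      | zero => exact h b
      | succ n ih =>
        rw [← dsigma_gen]
        simp only [RingHom.coe_coe] at ih ⊢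
        rw [hf, hg, ih]
  ext x
  exact RingHom.congr_fun key x

end Algebra

section Hopf

variable {k B : Type*} [CommRing k] [DifferenceRing k] [CommRing B] [HopfAlgebra k B]

variable (k B) in
/-- Comultiplication of `[σ]_k B`, extending that of `B`. -/
def comulHom : SigmaExt k B →ₐ[k] SigmaExt k B ⊗[k] SigmaExt k B :=
  lift ((Algebra.TensorProduct.map (incl k B) (incl k B)).comp (Bialgebra.comulAlgHom k B))

variable (k B) in
/-- Counit of `[σ]_k B`, extending that of `B`. -/
def counitHom : SigmaExt k B →ₐ[k] k := lift (Bialgebra.counitAlgHom k B)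

variable (k B) in
/-- Antipode of `[σ]_k B`, extending that of `B`. -/
def antipodeHom : SigmaExt k B →ₐ[k] SigmaExt k B :=
  lift ((incl k B).comp (HopfAlgebra.antipodeAlgHom k B))

theorem comulHom_incl (b : B) : comulHom k B (incl k B b) =
    Algebra.TensorProduct.map (incl k B) (incl k B) (Coalgebra.comul (R := k) b) :=
  lift_gen _ 0 b

theorem counitHom_incl (b : B) : counitHom k B (incl k B b) = Coalgebra.counit (R := k) b :=
  lift_gen _ 0 b

theorem antipodeHom_incl (b : B) : antipodeHom k B (incl k B b) =
    incl k B (HopfAlgebra.antipode k b) :=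
  lift_gen _ 0 b

theorem map_sigma {A A' C C' : Type*} [CommRing A] [DifferenceRing A] [Algebra k A]
    [DifferenceAlgebra k A] [CommRing A'] [DifferenceRing A'] [Algebra k A']
    [DifferenceAlgebra k A'] [CommRing C] [DifferenceRing C] [Algebra k C]
    [DifferenceAlgebra k C] [CommRing C'] [DifferenceRing C'] [Algebra k C']
    [DifferenceAlgebra k C'] {f : A →ₐ[k] C} {g : A' →ₐ[k] C'}
    (hf : ∀ x, f (dsigma x) = dsigma (f x)) (hg : ∀ x, g (dsigma x) = dsigma (g x))
    (t : A ⊗[k] A') : Algebra.TensorProduct.map f g (dsigma t) =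
      dsigma (Algebra.TensorProduct.map f g t) := by
  induction t using TensorProduct.induction_on with
  | zero => simp
  | add x y hx hy => simp only [map_add, hx, hy]
  | tmul a b => simp only [DifferenceAlgebra.dsigma_tmul, Algebra.TensorProduct.map_tmul, hf, hg]

theorem lift_tensor_sigma {A A' C : Type*} [CommRing A] [DifferenceRing A] [Algebra k A]
    [DifferenceAlgebra k A] [CommRing A'] [DifferenceRing A'] [Algebra k A']
    [DifferenceAlgebra k A'] [CommRing C] [DifferenceRing C] [Algebra k C]
    {f : A →ₐ[k] C} {g : A' →ₐ[k] C}
    (hf : ∀ x, f (dsigma x) = dsigma (f x)) (hg : ∀ x, g (dsigma x) = dsigma (g x))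
    (t : A ⊗[k] A') :
    Algebra.TensorProduct.lift f g (fun _ _ => Commute.all _ _) (dsigma t) =
      dsigma (Algebra.TensorProduct.lift f g (fun _ _ => Commute.all _ _) t) := by
  induction t using TensorProduct.induction_on with
  | zero => simp
  | add x y hx hy => simp only [map_add, hx, hy]
  | tmul a b =>
    simp only [DifferenceAlgebra.dsigma_tmul, Algebra.TensorProduct.lift_tmul, hf, hg, map_mul]

theorem assoc_sigma {A : Type*} [CommRing A] [DifferenceRing A] [Algebra k A]
    [DifferenceAlgebra k A] (t : (A ⊗[k] A) ⊗[k] A) :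
    Algebra.TensorProduct.assoc k k k A A A (dsigma t) =
      dsigma (Algebra.TensorProduct.assoc k k k A A A t) := by
  induction t using TensorProduct.induction_on with
  | zero => simp
  | add x y hx hy => simp only [map_add, hx, hy]
  | tmul x c =>
    induction x using TensorProduct.induction_on with
    | zero => simp
    | add x y hx hy => simp only [TensorProduct.add_tmul, map_add, hx, hy]
    | tmul a b => simp only [DifferenceAlgebra.dsigma_tmul, Algebra.TensorProduct.assoc_tmul]

theorem comulHom_sigma (x : SigmaExt k B) :
    comulHom k B (dsigma x) = dsigma (comulHom k B x) := lift_sigma _ x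

theorem counitHom_sigma (x : SigmaExt k B) :
    counitHom k B (dsigma x) = dsigma (counitHom k B x) := lift_sigma _ x

theorem antipodeHom_sigma (x : SigmaExt k B) :
    antipodeHom k B (dsigma x) = dsigma (antipodeHom k B x) := lift_sigma _ x

theorem assoc_map_incl (t : (B ⊗[k] B) ⊗[k] B) :
    Algebra.TensorProduct.assoc k k k _ _ _
      (Algebra.TensorProduct.map
        (Algebra.TensorProduct.map (incl k B) (incl k B)) (incl k B) t) =
    Algebra.TensorProduct.map (incl k B) (Algebra.TensorProduct.map (incl k B) (incl k B))
      (Algebra.TensorProduct.assoc k k k B B B t) := by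
  induction t using TensorProduct.induction_on with
  | zero => simp
  | add x y hx hy => simp only [map_add, hx, hy]
  | tmul x c =>
    induction x using TensorProduct.induction_on with
    | zero => simp
    | add x y hx hy => simp only [TensorProduct.add_tmul, map_add, hx, hy]
    | tmul a b => simp

theorem comulHom_map_left (t : B ⊗[k] B) :
    Algebra.TensorProduct.map (comulHom k B) (.id k _)
      (Algebra.TensorProduct.map (incl k B) (incl k B) t) =
    Algebra.TensorProduct.map (Algebra.TensorProduct.map (incl k B) (incl k B)) (incl k B)
      (Coalgebra.comul.rTensor B t) := by
  induction t using TensorProduct.induction_on with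
  | zero => simp
  | add x y hx hy => simp only [map_add, hx, hy]
  | tmul a b => simp [comulHom_incl]

theorem comulHom_map_right (t : B ⊗[k] B) :
    Algebra.TensorProduct.map (.id k _) (comulHom k B)
      (Algebra.TensorProduct.map (incl k B) (incl k B) t) =
    Algebra.TensorProduct.map (incl k B) (Algebra.TensorProduct.map (incl k B) (incl k B))
      (Coalgebra.comul.lTensor B t) := by
  induction t using TensorProduct.induction_on with
  | zero => simp
  | add x y hx hy => simp only [map_add, hx, hy]
  | tmul a b => simp [comulHom_incl]

theorem counitHom_map_left (t : B ⊗[k] B) :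
    Algebra.TensorProduct.map (counitHom k B) (.id k _)
      (Algebra.TensorProduct.map (incl k B) (incl k B) t) =
    Algebra.TensorProduct.map (.id k k) (incl k B) (Coalgebra.counit.rTensor B t) := by
  induction t using TensorProduct.induction_on with
  | zero => simp
  | add x y hx hy => simp only [map_add, hx, hy]
  | tmul a b => simp [counitHom_incl]

theorem counitHom_map_right (t : B ⊗[k] B) :
    Algebra.TensorProduct.map (.id k _) (counitHom k B)
      (Algebra.TensorProduct.map (incl k B) (incl k B) t) =
    Algebra.TensorProduct.map (incl k B) (.id k k) (Coalgebra.counit.lTensor B t) := by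
  induction t using TensorProduct.induction_on with
  | zero => simp
  | add x y hx hy => simp only [map_add, hx, hy]
  | tmul a b => simp [counitHom_incl]

instance : Bialgebra k (SigmaExt k B) :=
  Bialgebra.ofAlgHom (comulHom k B) (counitHom k B)
    (by
      apply algHom_ext
      · intro x
        change Algebra.TensorProduct.assoc k k k _ _ _
            (Algebra.TensorProduct.map (comulHom k B) (.id k _) (comulHom k B (dsigma x))) =
          dsigma (Algebra.TensorProduct.assoc k k k _ _ _
            (Algebra.TensorProduct.map (comulHom k B) (.id k _) (comulHom k B x)))
        rw [comulHom_sigma, map_sigma comulHom_sigma (fun _ => rfl), assoc_sigma]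
      · intro x
        change Algebra.TensorProduct.map (.id k _) (comulHom k B) (comulHom k B (dsigma x)) =
          dsigma (Algebra.TensorProduct.map (.id k _) (comulHom k B) (comulHom k B x))
        rw [comulHom_sigma, map_sigma (fun _ => rfl) comulHom_sigma]
      · intro b
        change Algebra.TensorProduct.assoc k k k _ _ _
            (Algebra.TensorProduct.map (comulHom k B) (.id k _) (comulHom k B (incl k B b))) =
          Algebra.TensorProduct.map (.id k _) (comulHom k B) (comulHom k B (incl k B b))
        rw [comulHom_incl, comulHom_map_left, comulHom_map_right, assoc_map_incl,
          ← Coalgebra.coassoc_apply]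
        rfl)
    (by
      apply algHom_ext
      · intro x
        change Algebra.TensorProduct.map (counitHom k B) (.id k _) (comulHom k B (dsigma x)) =
          dsigma (Algebra.TensorProduct.map (counitHom k B) (.id k _) (comulHom k B x))
        rw [comulHom_sigma, map_sigma counitHom_sigma (fun _ => rfl)]
      · intro x
        change (1 : k) ⊗ₜ[k] dsigma x = dsigma ((1 : k) ⊗ₜ[k] x)
        rw [DifferenceAlgebra.dsigma_tmul, map_one]
      · intro b
        change Algebra.TensorProduct.map (counitHom k B) (.id k _) (comulHom k B (incl k B b)) =
          (1 : k) ⊗ₜ[k] incl k B b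
        rw [comulHom_incl, counitHom_map_left, Coalgebra.rTensor_counit_comul]
        simp)
    (by
      apply algHom_ext
      · intro x
        change Algebra.TensorProduct.map (.id k _) (counitHom k B) (comulHom k B (dsigma x)) =
          dsigma (Algebra.TensorProduct.map (.id k _) (counitHom k B) (comulHom k B x))
        rw [comulHom_sigma, map_sigma (fun _ => rfl) counitHom_sigma]
      · intro x
        change dsigma x ⊗ₜ[k] (1 : k) = dsigma (x ⊗ₜ[k] (1 : k))
        rw [DifferenceAlgebra.dsigma_tmul, map_one]
      · intro b
        change Algebra.TensorProduct.map (.id k _) (counitHom k B) (comulHom k B (incl k B b)) =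
          incl k B b ⊗ₜ[k] (1 : k)
        rw [comulHom_incl, counitHom_map_right, Coalgebra.lTensor_counit_comul]
        simp)

theorem comul_eq (x : SigmaExt k B) : Coalgebra.comul (R := k) x = comulHom k B x := rfl

theorem counit_eq (x : SigmaExt k B) : Coalgebra.counit (R := k) x = counitHom k B x := rfl

theorem antipodeHom_left (t : B ⊗[k] B) :
    Algebra.TensorProduct.lift (antipodeHom k B) (.id k _) (fun _ _ => Commute.all _ _)
      (Algebra.TensorProduct.map (incl k B) (incl k B) t) =
    incl k B (LinearMap.mul' k B ((HopfAlgebra.antipode k).rTensor B t)) := by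
  induction t using TensorProduct.induction_on with
  | zero => simp
  | add x y hx hy => simp only [map_add, hx, hy]
  | tmul a b => simp [antipodeHom_incl]

theorem antipodeHom_right (t : B ⊗[k] B) :
    Algebra.TensorProduct.lift (.id k _) (antipodeHom k B) (fun _ _ => Commute.all _ _)
      (Algebra.TensorProduct.map (incl k B) (incl k B) t) =
    incl k B (LinearMap.mul' k B ((HopfAlgebra.antipode k).lTensor B t)) := by
  induction t using TensorProduct.induction_on with
  | zero => simp
  | add x y hx hy => simp only [map_add, hx, hy]
  | tmul a b => simp [antipodeHom_incl]

theorem unit_counit_sigma (x : SigmaExt k B) :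
    algebraMap k (SigmaExt k B) (counitHom k B (dsigma x)) =
      dsigma (algebraMap k (SigmaExt k B) (counitHom k B x)) := by
  rw [counitHom_sigma, DifferenceAlgebra.sigma_algebraMap]

/-- The Hopf algebra structure on `[σ]_k B` extending that of `B`: for `B = k[𝒢]` it is the one
of the `σ`-algebraic group `R ↦ 𝒢(R)` on `k`-`σ`-algebras `R`. -/
instance : HopfAlgebra k (SigmaExt k B) :=
  HopfAlgebra.ofAlgHom (antipodeHom k B)
    (by
      apply algHom_ext
      · intro x
        change Algebra.TensorProduct.lift (antipodeHom k B) (.id k _) (fun _ _ => Commute.all _ _)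
          (comulHom k B (dsigma x)) = dsigma (Algebra.TensorProduct.lift (antipodeHom k B)
            (.id k _) (fun _ _ => Commute.all _ _) (comulHom k B x))
        rw [comulHom_sigma, lift_tensor_sigma antipodeHom_sigma (fun _ => rfl)]
      · exact unit_counit_sigma
      · intro b
        change Algebra.TensorProduct.lift (antipodeHom k B) (.id k _) (fun _ _ => Commute.all _ _)
          (comulHom k B (incl k B b)) =
            algebraMap k (SigmaExt k B) (counitHom k B (incl k B b))
        rw [comulHom_incl, antipodeHom_left, HopfAlgebra.mul_antipode_rTensor_comul_apply,
          counitHom_incl, AlgHom.commutes])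
    (by
      apply algHom_ext
      · intro x
        change Algebra.TensorProduct.lift (.id k _) (antipodeHom k B) (fun _ _ => Commute.all _ _)
          (comulHom k B (dsigma x)) = dsigma (Algebra.TensorProduct.lift (.id k _)
            (antipodeHom k B) (fun _ _ => Commute.all _ _) (comulHom k B x))
        rw [comulHom_sigma, lift_tensor_sigma (fun _ => rfl) antipodeHom_sigma]
      · exact unit_counit_sigma
      · intro b
        change Algebra.TensorProduct.lift (.id k _) (antipodeHom k B) (fun _ _ => Commute.all _ _)
          (comulHom k B (incl k B b)) =
            algebraMap k (SigmaExt k B) (counitHom k B (incl k B b))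
        rw [comulHom_incl, antipodeHom_right, HopfAlgebra.mul_antipode_lTensor_comul_apply,
          counitHom_incl, AlgHom.commutes])

theorem antipode_eq (x : SigmaExt k B) :
    HopfAlgebra.antipode k x = antipodeHom k B x := rfl

instance : DifferenceHopfAlgebra k (SigmaExt k B) where
  sigma_algebraMap := DifferenceAlgebra.sigma_algebraMap
  sigma_comul := comulHom_sigma
  sigma_counit := counitHom_sigma
  sigma_antipode := antipodeHom_sigma

end Hopf

end SigmaExt

/-! ## Zariski closures and the growth group -/

/-- A type synonym: `SigmaTwist R` is the ring `R`, viewed as a `k`-algebra through `σ : k → k`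
followed by the structure map `k → R`. -/
def SigmaTwist (R : Type*) := R

namespace SigmaTwist

variable (k R : Type*) [CommRing k] [DifferenceRing k] [CommRing R] [Algebra k R]

instance : CommRing (SigmaTwist R) := inferInstanceAs (CommRing R)

instance : Algebra k (SigmaTwist R) :=
  RingHom.toAlgebra (S := SigmaTwist R) ((algebraMap k R).comp dsigma)

end SigmaTwist

section Kernels

variable {k A : Type*} [Field k] [DifferenceRing k]
  [CommRing A] [DifferenceRing A] [HopfAlgebra k A]

/-- Let `S i = k[G[i]] ⊆ k{G}` be the coordinate rings of a sequence of groups with projections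
`π_i : G[i] → G[i-1]` dual to the inclusions. This is the defining ideal in `k[G[i]]` of `𝒢_i`,
where `𝒢_0 = G[0]` and `𝒢_i = ker (π_i)` for `i ≥ 1`, in which case it is the ideal
generated by the augmentation ideal of `k[G[i-1]]`. -/
def kernelIdeal (S : ℕ → Subalgebra k A) : (i : ℕ) → Ideal (S i)
  | 0 => ⊥
  | i + 1 => Ideal.span {x | (x : A) ∈ S i ∧ Coalgebra.counit (R := k) (x : A) = 0}

/-- The coordinate ring `k[𝒢_i]`. -/
def KernelRing (S : ℕ → Subalgebra k A) (i : ℕ) : Type _ := S i ⧸ kernelIdeal S i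

namespace KernelRing

instance (S : ℕ → Subalgebra k A) (i : ℕ) : CommRing (KernelRing S i) :=
  inferInstanceAs (CommRing (S i ⧸ kernelIdeal S i))

instance (S : ℕ → Subalgebra k A) (i : ℕ) : Algebra k (KernelRing S i) :=
  inferInstanceAs (Algebra k (S i ⧸ kernelIdeal S i))

/-- Restriction of functions from `G[i]` to `𝒢_i`. -/
def mk (S : ℕ → Subalgebra k A) (i : ℕ) : S i →ₐ[k] KernelRing S i :=
  Ideal.Quotient.mkₐ k (kernelIdeal S i)

variable [DifferenceHopfAlgebra k A] {S : ℕ → Subalgebra k A}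
  (hS : ∀ i, ∀ x ∈ S i, dsigma x ∈ S (i + 1))

/-- The map `σ : k[G[i]] → k[G[i+1]]`. -/
def stageSigma (i : ℕ) : S i →+* S (i + 1) :=
  ((dsigma : A →+* A).comp (S i).val.toRingHom).codRestrict (S (i + 1))
    (fun x => hS i x x.2)

theorem kernelIdeal_le_comap (i : ℕ) :
    kernelIdeal S i ≤ (kernelIdeal S (i + 1)).comap (stageSigma hS i) := by
  cases i with
  | zero => exact bot_le
  | succ i =>
    refine Ideal.span_le.2 ?_
    rintro x ⟨hx, hε⟩
    refine Ideal.subset_span ⟨hS i x hx, ?_⟩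
    change Coalgebra.counit (R := k) (dsigma (x : A)) = 0
    rw [DifferenceHopfAlgebra.sigma_counit, hε, map_zero]

/-- The map `k[𝒢_i] → k[𝒢_{i+1}]` induced by `σ`. -/
def sigmaMap (i : ℕ) : KernelRing S i →+* KernelRing S (i + 1) :=
  Ideal.quotientMap _ (stageSigma hS i) (kernelIdeal_le_comap hS i)

theorem sigmaMap_mk (i : ℕ) (x : S i) :
    sigmaMap hS i (mk S i x) = mk S (i + 1) (stageSigma hS i x) := rfl

theorem sigmaMap_algebraMap (i : ℕ) (c : k) :
    sigmaMap hS i (algebraMap k _ c) = algebraMap k _ (dsigma c) := by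
  rw [← AlgHom.commutes (mk S i), sigmaMap_mk, ← AlgHom.commutes (mk S (i + 1))]
  exact congrArg _ (Subtype.ext (DifferenceAlgebra.sigma_algebraMap c))

/-- The dual `^σ(k[𝒢_i]) = k ⊗_{σ,k} k[𝒢_i] → k[𝒢_{i+1}]`, `c ⊗ f ↦ c σ(f)`, of the morphism
`σ_{i+1} : 𝒢_{i+1} → ^σ(𝒢_i)`. -/
def sigmaDual (i : ℕ) :
    SigmaTwist k ⊗[k] KernelRing S i →ₐ[k] SigmaTwist (KernelRing S (i + 1)) :=
  Algebra.TensorProduct.lift (R := k) (S := k) (A := SigmaTwist k)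
    (C := SigmaTwist (KernelRing S (i + 1)))
    { toFun := algebraMap k (KernelRing S (i + 1))
      map_one' := map_one (algebraMap k (KernelRing S (i + 1)))
      map_mul' := map_mul (algebraMap k (KernelRing S (i + 1)))
      map_zero' := map_zero (algebraMap k (KernelRing S (i + 1)))
      map_add' := map_add (algebraMap k (KernelRing S (i + 1)))
      commutes' := fun _ => rfl }
    { toFun := sigmaMap hS i
      map_one' := map_one (sigmaMap hS i)
      map_mul' := map_mul (sigmaMap hS i)
      map_zero' := map_zero (sigmaMap hS i)
      map_add' := map_add (sigmaMap hS i)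
      commutes' := sigmaMap_algebraMap hS i }
    (fun _ _ => Commute.all _ _)

theorem sigmaDual_tmul (i : ℕ) (c : k) (f : KernelRing S i) :
    sigmaDual hS i (TensorProduct.tmul k (c : SigmaTwist k) f) =
      (c • sigmaMap hS i f : KernelRing S (i + 1)) := by
  rw [Algebra.smul_def]
  exact Algebra.TensorProduct.lift_tmul _ _ _ _ f

end KernelRing

end Kernels

section Growth

variable {k A B : Type*} [Field k] [DifferenceRing k]
  [CommRing A] [DifferenceRing A] [HopfAlgebra k A] [CommRing B] [HopfAlgebra k B]

/-- The coordinate ring `k[𝒢[i]] = B ⊗ ^σB ⊗ ⋯ ⊗ ^{σ^i}B`, as a subalgebra of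
`k{𝒢} = [σ]_k B` for `B = k[𝒢]`. -/
def SigmaExt.stage (k B : Type*) [Field k] [DifferenceRing k] [CommRing B] [HopfAlgebra k B]
    (i : ℕ) : Subalgebra k (SigmaExt k B) :=
  Algebra.adjoin k {x | ∃ j ≤ i, ∃ b : B, x = SigmaExt.gen k B j b}

theorem SigmaExt.dsigma_mem_stage {i : ℕ} {y : SigmaExt k B} (hy : y ∈ SigmaExt.stage k B i) :
    dsigma y ∈ SigmaExt.stage k B (i + 1) := by
  unfold SigmaExt.stage at hy
  induction hy using Algebra.adjoin_induction with
  | mem x hx =>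
    obtain ⟨j, hj, b, rfl⟩ := hx
    exact Algebra.subset_adjoin ⟨j + 1, by omega, b, SigmaExt.dsigma_gen j b⟩
  | algebraMap c =>
    rw [DifferenceAlgebra.sigma_algebraMap]
    exact Subalgebra.algebraMap_mem _ _
  | add x y _ _ hx hy => rw [map_add]; exact add_mem hx hy
  | mul x y _ _ hx hy => rw [map_mul]; exact mul_mem hx hy

/-- A `σ`-closed embedding of the `σ`-algebraic group `G` (with `k{G} = A`) into the algebraic
group `𝒢` (with `k[𝒢] = B`): a morphism `G → [σ]_k 𝒢` of `σ`-algebraic groups which is a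
`σ`-closed embedding, i.e. whose dual `k{𝒢} → k{G}` is surjective. -/
structure SigmaClosedEmbedding (k A B : Type*) [Field k] [DifferenceRing k]
    [CommRing A] [DifferenceRing A] [HopfAlgebra k A]
    [CommRing B] [HopfAlgebra k B] where
  /-- The dual morphism `k{𝒢} → k{G}`. -/
  hom : SigmaHopfHom k (SigmaExt k B) A
  surjective : Function.Surjective hom.toBialgHom

namespace SigmaClosedEmbedding

/-- The coordinate ring `k[G[i]]` of the `i`-th order Zariski closure of `G` in `𝒢`. The latter is
the closed subscheme of `𝒢[i]` defined by `𝕀(G) ∩ k[𝒢[i]]`, where `𝕀(G)` is the kernel of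
`k{𝒢} → k{G}`; so its coordinate ring is the image of `k[𝒢[i]]` in `k{G}`. -/
def closure (φ : SigmaClosedEmbedding k A B) (i : ℕ) : Subalgebra k A :=
  (SigmaExt.stage k B i).map (φ.hom.toBialgHom : SigmaExt k B →ₐ[k] A)

theorem sigma_mem_closure (φ : SigmaClosedEmbedding k A B) (i : ℕ) :
    ∀ x ∈ φ.closure i, dsigma x ∈ φ.closure (i + 1) := by
  rintro _ ⟨y, hy, rfl⟩
  exact ⟨dsigma y, SigmaExt.dsigma_mem_stage hy, φ.hom.map_sigma y⟩

variable [DifferenceHopfAlgebra k A]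

/-- `m` is such that `σ_i : 𝒢_i → ^σ(𝒢_{i-1})` is an isomorphism for every `i > m`
(here `i = j + 1`). -/
def StableFrom (φ : SigmaClosedEmbedding k A B) (m : ℕ) : Prop :=
  ∀ j, m < j + 1 → Function.Bijective (KernelRing.sigmaDual φ.sigma_mem_closure j)

/-- The smallest `m` such that `σ_i : 𝒢_i → ^σ(𝒢_{i-1})` is an isomorphism for every `i > m`. -/
def growthIndex (φ : SigmaClosedEmbedding k A B) : ℕ := sInf {m | φ.StableFrom m}

/-- The size of the growth group `𝒢_m`, `m` the growth index: the dimension of its coordinate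
ring over `k`, a natural number or `∞`. -/
def growthSize (φ : SigmaClosedEmbedding k A B) : ℕ∞ :=
  Cardinal.toENat (Module.rank k (KernelRing φ.closure φ.growthIndex))

end SigmaClosedEmbedding

end Growth

/-! ## The limit degree -/

/-- `d` is the size of the growth group of `G` (with `k{G} = A`) for some `σ`-closed embedding of
`G` into an algebraic group, i.e. an affine group scheme of finite type over `k`. -/
def IsGrowthSize (k A : Type u) [Field k] [DifferenceRing k] [CommRing A] [DifferenceRing A]
    [HopfAlgebra k A] [DifferenceHopfAlgebra k A] (d : ℕ∞) : Prop :=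
  ∃ (B : Type u) (_ : CommRing B) (_ : HopfAlgebra k B) (_ : Algebra.FiniteType k B)
    (φ : SigmaClosedEmbedding k A B), φ.growthSize = d

/-- The limit degree `ld(G)` (with `k{G} = A`): the size of the growth group with respect to a
chosen `σ`-closed embedding of `G` into an algebraic group. -/
def limitDegree (k A : Type u) [Field k] [DifferenceRing k] [CommRing A] [DifferenceRing A]
    [HopfAlgebra k A] [DifferenceHopfAlgebra k A] : ℕ∞ :=
  Classical.epsilon (IsGrowthSize k A)

/-! ## Normal subgroups and quotients -/

/-- The composite of a point `n : A' → R` of a `σ`-algebraic group `N` with the morphism `N → G`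
dual to `ρ : A → A'`, a point of `G`. -/
def pointMap {k A A' R : Type*} [CommRing k]
    [CommRing A] [DifferenceRing A] [HopfAlgebra k A]
    [CommRing A'] [DifferenceRing A'] [HopfAlgebra k A']
    [CommRing R] [DifferenceRing R] [Algebra k R]
    (ρ : SigmaHopfHom k A A') (n : SigmaAlgHom k A' R) : WithConv (A →ₐ[k] R) :=
  WithConv.toConv (n.toAlgHom.comp (ρ.toBialgHom : A →ₐ[k] A'))

/-- A `σ`-closed subgroup `N` of `G` (with `k{G} = A`, `k{N} = A'` and `ρ : k{G} → k{N}` the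
surjection dual to the inclusion) is normal: for every `k`-`σ`-algebra `R`, the image of `N(R)` in
`G(R)` is stable under conjugation by `G(R)`. The group law on points is convolution and
the inverse of a point `g` is `g ∘ S` with the antipode `S`. -/
def IsNormalSubgroup {k A A' : Type u} [Field k] [DifferenceRing k]
    [CommRing A] [DifferenceRing A] [HopfAlgebra k A]
    [CommRing A'] [DifferenceRing A'] [HopfAlgebra k A']
    (ρ : SigmaHopfHom k A A') : Prop :=
  Function.Surjective ρ.toBialgHom ∧
  ∀ (R : Type u) [CommRing R] [DifferenceRing R] [Algebra k R] [DifferenceAlgebra k R]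
    (g : SigmaAlgHom k A R) (n : SigmaAlgHom k A' R),
    ∃ n' : SigmaAlgHom k A' R,
      WithConv.toConv g.toAlgHom * pointMap ρ n *
        WithConv.toConv (g.toAlgHom.comp (HopfAlgebra.antipodeAlgHom k A)) = pointMap ρ n'

/-- For `ρ : k{G} → k{N}` dual to `N → G` and `θ : k{H} → k{G}` dual to `G → H`: the image of `N`
is contained in the kernel of `G → H`, i.e. `N → G → H` is trivial. -/
def KillsSubgroup {k A A' C : Type*} [CommRing k]
    [CommRing A] [DifferenceRing A] [HopfAlgebra k A]
    [CommRing A'] [DifferenceRing A'] [HopfAlgebra k A']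
    [CommRing C] [DifferenceRing C] [HopfAlgebra k C]
    (ρ : SigmaHopfHom k A A') (θ : SigmaHopfHom k C A) : Prop :=
  ∀ c : C, ρ.toBialgHom (θ.toBialgHom c) = algebraMap k A' (Coalgebra.counit (R := k) c)

/-- `π : k{Q} → k{G}` is dual to a quotient `G → Q = G/N` of `G` mod `N`: it is trivial on `N`, and
every morphism `G → H` of `σ`-algebraic groups which is trivial on `N` factors uniquely
through it. -/
def IsQuotientMod {k A A' Q : Type u} [Field k] [DifferenceRing k]
    [CommRing A] [DifferenceRing A] [HopfAlgebra k A]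
    [CommRing A'] [DifferenceRing A'] [HopfAlgebra k A']
    [CommRing Q] [DifferenceRing Q] [HopfAlgebra k Q]
    (ρ : SigmaHopfHom k A A') (π : SigmaHopfHom k Q A) : Prop :=
  KillsSubgroup ρ π ∧
  ∀ (C : Type u) [CommRing C] [DifferenceRing C] [HopfAlgebra k C] [DifferenceHopfAlgebra k C],
    FinitelySigmaGenerated k C → ∀ θ : SigmaHopfHom k C A, KillsSubgroup ρ θ →
      ∃! θ' : SigmaHopfHom k C Q, ∀ c : C, π.toBialgHom (θ'.toBialgHom c) = θ.toBialgHom c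

end

/-!
Let `A = k{G}` be a difference Hopf algebra. A `σ`-closed embedding of `G` into an algebraic group
gives an increasing sequence of finitely generated Hopf subalgebras `S i ⊆ A`, the coordinate rings
of the Zariski closures `G[i]`, with union `A` and with `S (i + 1)` generated by `S i` and `σ(S i)`
(`IsTower`, `isTower_closure`). For Hopf subalgebras `C ⊆ E` of `A` the kernel of the dual morphism
`Spec E → Spec C` has coordinate ring `E / C⁺ E`, where `C⁺` is the augmentation ideal. The
dimension of this ring is the index `[E : C]` (`hopfIndex`), and
`dim k[𝒢_{i+1}] = [S (i + 1) : S i]`. All claims are about the behaviour of this index.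

*Purity.* If `M ⊆ M'` are left coideals stable under a Hopf subalgebra `C`, then the Fitting ideals
of the `C`-module `M' / M` are translation invariant, so each is zero or does not vanish at the
unit. Working with minors of matrices of relations, this gives `M ∩ C⁺ M' = C⁺ M`
(`mem_augPart_mul_of_mem`) without any appeal to the faithful flatness of Hopf algebras over Hopf
subalgebras. Two consequences carry the rest: a Nakayama lemma without finiteness hypotheses
(`IsHopfSubalgebra.le_of_le_sup_augPart_mul`), by which a Hopf subalgebra is determined by the
ideal `C⁺ A`, and the multiplicativity `[E : C] = [E : D] [D : C]` (`hopfIndex_mul`), because when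
`[E : D]` is finite the `D`-module `E` is projective of constant rank.

*Existence and independence.* The powers `σ^i` of generators of `k[𝒢_0]` generate `k[𝒢_i]`.
Applying `σ` to the coefficients of a relation gives a relation one stage later, so the sets of
leading exponents of the ideals of relations increase, and they stabilise by Dickson's lemma; from
then on `^σ(k[𝒢_i]) → k[𝒢_{i+1}]` is an isomorphism (`IsTower.exists_sigmaDual_bijective`). Hence
the index `[S (i + 1) : S i]` is eventually a constant `d`. For another tower, with eventual index
`d'`, each tower is contained in a shift of the other, so `d' ^ n ≤ d ^ (n + c)` for all `n` by
multiplicativity, whence `d' ≤ d`, and `d = d'` by symmetry (`IsTower.le_of_eventually`). An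
embedding exists because Hopf subalgebras are directed unions of finitely generated ones
(`exists_sigmaClosedEmbedding`).

*Multiplicativity.* Let `N` be a normal `σ`-closed subgroup and `K ⊆ A` the Hopf subalgebra of left
`N`-invariants. For a Hopf subalgebra `E`, the ideal of `N` in `E` is generated by `(K ∩ E)⁺`
(`IsNormalHom.mem_augPart_mul`): the minors of a suitable comatrix are semi-invariants of one and
the same weight, and there is a semi-invariant of the inverse weight, because the conjugates of a
weight span a finite-dimensional algebra (`exists_inverse_weight`). This yields
`[E : C] = [K ∩ E : K ∩ C] [E|_N : C|_N]` (`IsNormalHom.hopfIndex_eq_mul`). The restrictions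
`S i|_N` form a tower on `k{N}`. Once the maps `^σ(k[𝒩_i]) → k[𝒩_{i+1}]` attached to it are
injective, the algebras `K ∩ S i` satisfy the recursion of a tower too
(`IsNormalHom.leftInvariants_inf_succ`). Finally `k{G/N} → k{G}` is injective with image `K`
(`injective_of_isQuotientMod`, `range_eq_leftInvariants`), so that comparing the three towers at a
large stage gives the product formula (`limitDegree_eq_mul`).
-/

noncomputable section

namespace LimitDegree

open Coalgebra WithConv

/-! ### Slices of tensors -/

section Slices

variable {k M N P : Type*} [Field k] [AddCommGroup M] [Module k M] [AddCommGroup N] [Module k N]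
  [AddCommGroup P] [Module k P]

/-- The slice map `f ⊗ id : M ⊗ N → N` of a functional `f` on `M`. -/
def sliceLeft (f : Module.Dual k M) : M ⊗[k] N →ₗ[k] N :=
  (TensorProduct.lid k N).toLinearMap ∘ₗ LinearMap.rTensor N f

/-- The slice map `id ⊗ g : M ⊗ N → M` of a functional `g` on `N`. -/
def sliceRight (g : Module.Dual k N) : M ⊗[k] N →ₗ[k] M :=
  (TensorProduct.rid k M).toLinearMap ∘ₗ LinearMap.lTensor M g

@[simp]
theorem sliceLeft_tmul (f : Module.Dual k M) (m : M) (n : N) :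
    sliceLeft f (m ⊗ₜ[k] n) = f m • n := by
  simp [sliceLeft]

@[simp]
theorem sliceRight_tmul (g : Module.Dual k N) (m : M) (n : N) :
    sliceRight g (m ⊗ₜ[k] n) = g n • m := by
  simp [sliceRight]

/-- Expansion along a basis of the left factor, simultaneous for a finite family of tensors. -/
theorem exists_sum_sliceLeft {ι : Type*} [Finite ι] (x : ι → M ⊗[k] N) :
    ∃ (n : ℕ) (e : Fin n → M) (e' : Fin n → Module.Dual k M),
      ∀ i, x i = ∑ β, e β ⊗ₜ[k] sliceLeft (e' β) (x i) := by
  classical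
  cases nonempty_fintype ι
  let b := Module.Basis.ofVectorSpace k M
  let s := Finset.univ.biUnion fun i => (TensorProduct.equivFinsuppOfBasisLeft b (x i)).support
  refine ⟨s.card, fun β => b (s.equivFin.symm β), fun β => b.coord (s.equivFin.symm β),
    fun i => ?_⟩
  have h : x i = ∑ β ∈ s, b β ⊗ₜ[k] sliceLeft (b.coord β) (x i) := by
    conv_lhs =>
      rw [← (TensorProduct.equivFinsuppOfBasisLeft b).symm_apply_apply (x i),
        TensorProduct.equivFinsuppOfBasisLeft_symm_apply]
    rw [Finsupp.sum_of_support_subset (s := s)]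
    · refine Finset.sum_congr rfl fun β _ => ?_
      rw [TensorProduct.equivFinsuppOfBasisLeft_apply]
      rfl
    · exact Finset.subset_biUnion_of_mem
        (fun i => (TensorProduct.equivFinsuppOfBasisLeft b (x i)).support) (Finset.mem_univ i)
    · simp
  conv_lhs => rw [h, ← Finset.sum_coe_sort s]
  rw [← Equiv.sum_comp s.equivFin.symm]

theorem eq_zero_of_sliceLeft {x : M ⊗[k] N} (h : ∀ f, sliceLeft f x = 0) : x = 0 := by
  obtain ⟨n, e, e', he⟩ := exists_sum_sliceLeft (fun _ : Unit => x)
  rw [he ()]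
  simp [h]

theorem sliceLeft_lTensor (f : Module.Dual k M) (g : N →ₗ[k] P) (x : M ⊗[k] N) :
    sliceLeft f (LinearMap.lTensor M g x) = g (sliceLeft f x) := by
  induction x using TensorProduct.induction_on with
  | zero => simp
  | add x y hx hy => simp only [map_add, hx, hy]
  | tmul a b => simp

theorem sliceLeft_rTensor (f : Module.Dual k P) (g : M →ₗ[k] P) (x : M ⊗[k] N) :
    sliceLeft f (LinearMap.rTensor N g x) = sliceLeft (f ∘ₗ g) x := by
  induction x using TensorProduct.induction_on with
  | zero => simp
  | add x y hx hy => simp only [map_add, hx, hy]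
  | tmul a b => simp

theorem sliceRight_rTensor (f : Module.Dual k N) (g : M →ₗ[k] P) (x : M ⊗[k] N) :
    sliceRight f (LinearMap.rTensor N g x) = g (sliceRight f x) := by
  induction x using TensorProduct.induction_on with
  | zero => simp
  | add x y hx hy => simp only [map_add, hx, hy]
  | tmul a b => simp

theorem sliceLeft_comm (f : Module.Dual k N) (x : M ⊗[k] N) :
    sliceLeft f (TensorProduct.comm k M N x) = sliceRight f x := by
  induction x using TensorProduct.induction_on with
  | zero => simp
  | add x y hx hy => simp only [map_add, hx, hy]
  | tmul a b => simp

theorem eq_zero_of_sliceRight {x : M ⊗[k] N} (h : ∀ f, sliceRight f x = 0) : x = 0 := by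
  have : TensorProduct.comm k M N x = 0 :=
    eq_zero_of_sliceLeft fun f => by rw [sliceLeft_comm, h f]
  simpa using this

theorem eq_of_sliceRight {x y : M ⊗[k] N} (h : ∀ f, sliceRight f x = sliceRight f y) : x = y :=
  sub_eq_zero.1 (eq_zero_of_sliceRight fun f => by rw [map_sub, h f, sub_self])

/-- The tensors in `M ⊗ U`, for a subspace `U` of `N`, described by their slices. -/
theorem mem_range_lTensor_iff {U : Submodule k N} {x : M ⊗[k] N} :
    x ∈ LinearMap.range (LinearMap.lTensor M U.subtype) ↔ ∀ f, sliceLeft f x ∈ U := by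
  constructor
  · rintro ⟨y, rfl⟩ f
    rw [sliceLeft_lTensor]
    exact (sliceLeft f y).2
  · intro h
    have hex : Function.Exact (LinearMap.lTensor M U.subtype) (LinearMap.lTensor M U.mkQ) :=
      lTensor_exact M (LinearMap.exact_subtype_mkQ U) U.mkQ_surjective
    refine (hex x).1 (eq_zero_of_sliceLeft fun f => ?_)
    rw [sliceLeft_lTensor]
    simpa using h f

theorem mem_range_rTensor_iff {U : Submodule k M} {x : M ⊗[k] N} :
    x ∈ LinearMap.range (LinearMap.rTensor N U.subtype) ↔ ∀ f, sliceRight f x ∈ U := by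
  constructor
  · rintro ⟨y, rfl⟩ f
    rw [sliceRight_rTensor]
    exact (sliceRight f y).2
  · intro h
    have hex : Function.Exact (LinearMap.rTensor N U.subtype) (LinearMap.rTensor N U.mkQ) :=
      rTensor_exact N (LinearMap.exact_subtype_mkQ U) U.mkQ_surjective
    refine (hex x).1 (eq_zero_of_sliceRight fun f => ?_)
    rw [sliceRight_rTensor]
    simpa using h f

/-- `(U ⊗ N) ∩ (M ⊗ W) = U ⊗ W`. -/
theorem mem_range_map_of_slices {U : Submodule k M} {W : Submodule k N} {x : M ⊗[k] N}
    (hU : ∀ f, sliceRight f x ∈ U) (hW : ∀ f, sliceLeft f x ∈ W) :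
    x ∈ LinearMap.range (TensorProduct.map U.subtype W.subtype) := by
  obtain ⟨y, rfl⟩ := mem_range_rTensor_iff.2 hU
  have hy : y ∈ LinearMap.range (LinearMap.lTensor U W.subtype) := by
    refine mem_range_lTensor_iff.2 fun f => ?_
    obtain ⟨g, hg⟩ := LinearMap.exists_extend f
    have : sliceLeft g (LinearMap.rTensor N U.subtype y) = sliceLeft f y := by
      rw [sliceLeft_rTensor, hg]
    exact this ▸ hW g
  obtain ⟨z, rfl⟩ := hy
  refine ⟨z, ?_⟩
  rw [← LinearMap.comp_apply, LinearMap.rTensor_comp_lTensor]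

theorem exists_sum_tmul_of_mem_range_map {U : Submodule k M} {W : Submodule k N} {x : M ⊗[k] N}
    (hx : x ∈ LinearMap.range (TensorProduct.map U.subtype W.subtype)) :
    ∃ (n : ℕ) (a : Fin n → M) (b : Fin n → N), (∀ i, a i ∈ U) ∧ (∀ i, b i ∈ W) ∧
      x = ∑ i, a i ⊗ₜ[k] b i := by
  obtain ⟨y, rfl⟩ := hx
  obtain ⟨n, e, e', he⟩ := exists_sum_sliceLeft (fun _ : Unit => y)
  refine ⟨n, fun i => e i, fun i => (sliceLeft (e' i) y : W), fun i => (e i).2,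
    fun i => (sliceLeft (e' i) y).2, ?_⟩
  conv_lhs => rw [he ()]
  simp

theorem sliceLeft_mem_of_sum {n : ℕ} {a : Fin n → M} {b : Fin n → N} {W : Submodule k N}
    (hb : ∀ i, b i ∈ W) (f : Module.Dual k M) : sliceLeft f (∑ i, a i ⊗ₜ[k] b i) ∈ W := by
  rw [map_sum]
  exact Submodule.sum_mem _ fun i _ => by
    rw [sliceLeft_tmul]
    exact W.smul_mem _ (hb i)

end Slices

/-! ### Left coideals and their comatrices -/

section Coideals

variable {k A : Type*} [Field k] [CommRing A] [HopfAlgebra k A]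

/-- The action `x ↦ (f ⊗ id) (Δ x)` of a functional `f`. -/
def lact (f : Module.Dual k A) : A →ₗ[k] A := sliceLeft f ∘ₗ comul

theorem lact_apply (f : Module.Dual k A) (x : A) : lact f x = sliceLeft f (comul x) := rfl

/-- A left coideal: a subspace `M` with `Δ M ⊆ A ⊗ M`, expressed through slices. -/
def IsLeftCoideal (M : Submodule k A) : Prop := ∀ x ∈ M, ∀ f : Module.Dual k A, lact f x ∈ M

theorem lact_counit (x : A) : lact (counit : A →ₗ[k] k) x = x := by
  rw [lact_apply, sliceLeft, LinearMap.comp_apply, Coalgebra.rTensor_counit_comul]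
  simp

theorem counit_sliceLeft_comul (f : Module.Dual k A) (x : A) :
    counit (R := k) (lact f x) = f x := by
  have h : ∀ t : A ⊗[k] A, counit (R := k) (sliceLeft f t) =
      f (TensorProduct.rid k A (LinearMap.lTensor A counit t)) := by
    intro t
    induction t using TensorProduct.induction_on with
    | zero => simp
    | add x y hx hy => simp only [map_add, hx, hy]
    | tmul a b => simp [mul_comm]
  rw [lact_apply, h, Coalgebra.lTensor_counit_comul]
  simp

/-- A left coideal on which the counit vanishes is zero. -/
theorem IsLeftCoideal.eq_zero {M : Submodule k A} (hM : IsLeftCoideal M)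
    (h : ∀ x ∈ M, counit (R := k) x = 0) {x : A} (hx : x ∈ M) : x = 0 := by
  refine (Module.forall_dual_apply_eq_zero_iff k x).1 fun f => ?_
  rw [← counit_sliceLeft_comul]
  exact h _ (hM x hx f)

theorem lact_lact (f g : Module.Dual k A) (x : A) :
    lact f (lact g x) =
      lact (LinearMap.mul' k k ∘ₗ TensorProduct.map g f ∘ₗ comul) x := by
  have h1 : ∀ t : A ⊗[k] A, lact f (sliceLeft g t) =
      sliceLeft g (LinearMap.lTensor A (sliceLeft f) (LinearMap.lTensor A comul t)) := by
    intro t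
    induction t using TensorProduct.induction_on with
    | zero => simp
    | add x y hx hy => simp only [map_add, hx, hy]
    | tmul a b => simp [lact]
  have h2 : ∀ (s : A ⊗[k] A) (b : A),
      sliceLeft g (LinearMap.lTensor A (sliceLeft f) (TensorProduct.assoc k A A A (s ⊗ₜ b))) =
        (LinearMap.mul' k k (TensorProduct.map g f s)) • b := by
    intro s b
    induction s using TensorProduct.induction_on with
    | zero => simp
    | add x y hx hy => simp only [TensorProduct.add_tmul, map_add, hx, hy, add_smul]
    | tmul a c => simp [mul_smul, smul_comm (f c)]
  have h3 : ∀ t : A ⊗[k] A, sliceLeft g (LinearMap.lTensor A (sliceLeft f)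
      (TensorProduct.assoc k A A A (LinearMap.rTensor A comul t))) =
      sliceLeft (LinearMap.mul' k k ∘ₗ TensorProduct.map g f ∘ₗ comul) t := by
    intro t
    induction t using TensorProduct.induction_on with
    | zero => simp
    | add x y hx hy => simp only [map_add, hx, hy]
    | tmul a b => simp [h2]
  rw [lact_apply g, h1, ← Coalgebra.coassoc_apply, h3, lact_apply]

/-- The left coideal `{(f ⊗ id) (Δ x)}` generated by an element `x`. -/
def coidealSpan (x : A) : Submodule k A :=
  LinearMap.range ((TensorProduct.lid k A).toLinearMap ∘ₗ
    LinearMap.applyₗ (comul (R := k) x) ∘ₗ LinearMap.rTensorHom A)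

theorem mem_coidealSpan {x y : A} :
    y ∈ coidealSpan (k := k) x ↔ ∃ f : Module.Dual k A, lact f x = y := Iff.rfl

theorem self_mem_coidealSpan (x : A) : x ∈ coidealSpan (k := k) x :=
  mem_coidealSpan.2 ⟨counit, lact_counit x⟩

theorem isLeftCoideal_coidealSpan (x : A) : IsLeftCoideal (coidealSpan (k := k) x) := by
  intro y hy f
  obtain ⟨g, rfl⟩ := mem_coidealSpan.1 hy
  exact mem_coidealSpan.2 ⟨_, (lact_lact f g x).symm⟩

theorem coidealSpan_le {x : A} {M : Submodule k A} (hM : IsLeftCoideal M) (hx : x ∈ M) :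
    coidealSpan x ≤ M := by
  intro y hy
  obtain ⟨g, rfl⟩ := mem_coidealSpan.1 hy
  exact hM x hx g

instance finite_coidealSpan (x : A) : FiniteDimensional k (coidealSpan (k := k) x) := by
  obtain ⟨n, e, e', he⟩ := exists_sum_sliceLeft (fun _ : Unit => comul (R := k) x)
  have hle : coidealSpan (k := k) x ≤
      Submodule.span k (Set.range fun i => sliceLeft (e' i) (comul (R := k) x)) := by
    intro y hy
    obtain ⟨g, rfl⟩ := mem_coidealSpan.1 hy
    have h := sliceLeft_mem_of_sum (a := e) (W := Submodule.span k
      (Set.range fun i => sliceLeft (e' i) (comul (R := k) x)))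
      (fun i => Submodule.subset_span (Set.mem_range_self i)) g
    rwa [← he ()] at h
  have : FiniteDimensional k
      (Submodule.span k (Set.range fun i => sliceLeft (e' i) (comul (R := k) x))) :=
    FiniteDimensional.span_of_finite k (Set.finite_range _)
  exact Submodule.finiteDimensional_of_le hle

theorem IsLeftCoideal.iSup {ι : Sort*} {M : ι → Submodule k A} (h : ∀ i, IsLeftCoideal (M i)) :
    IsLeftCoideal (⨆ i, M i) := by
  intro x hx f
  have hle : (⨆ i, M i) ≤ (⨆ i, M i).comap (lact f) :=
    iSup_le fun i y hy => Submodule.mem_iSup_of_mem i (h i y hy f)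
  exact hle hx

theorem IsLeftCoideal.sup {M N : Submodule k A} (hM : IsLeftCoideal M) (hN : IsLeftCoideal N) :
    IsLeftCoideal (M ⊔ N) := by
  intro x hx f
  have hle : M ⊔ N ≤ (M ⊔ N).comap (lact f) :=
    sup_le (fun y hy => Submodule.mem_sup_left (hM y hy f))
      (fun y hy => Submodule.mem_sup_right (hN y hy f))
  exact hle hx

theorem IsLeftCoideal.comul_mem {M : Submodule k A} (hM : IsLeftCoideal M) {x : A} (hx : x ∈ M) :
    comul x ∈ LinearMap.range (LinearMap.lTensor A M.subtype) :=
  mem_range_lTensor_iff.2 (hM x hx)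

/-- Products of tensors in `A ⊗ U` and `A ⊗ W` lie in `A ⊗ U W`. -/
theorem mul_mem_range_lTensor {U W : Submodule k A} {x y : A ⊗[k] A}
    (hx : x ∈ LinearMap.range (LinearMap.lTensor A U.subtype))
    (hy : y ∈ LinearMap.range (LinearMap.lTensor A W.subtype)) :
    x * y ∈ LinearMap.range (LinearMap.lTensor A (U * W).subtype) := by
  obtain ⟨x, rfl⟩ := hx
  obtain ⟨y, rfl⟩ := hy
  induction x using TensorProduct.induction_on with
  | zero => rw [map_zero, zero_mul]; exact zero_mem _
  | add x₁ x₂ h₁ h₂ => rw [map_add, add_mul]; exact add_mem h₁ h₂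
  | tmul a b =>
    induction y using TensorProduct.induction_on with
    | zero => rw [map_zero, mul_zero]; exact zero_mem _
    | add y₁ y₂ h₁ h₂ => rw [map_add, mul_add]; exact add_mem h₁ h₂
    | tmul a' b' =>
      refine ⟨(a * a') ⊗ₜ ⟨b * b', Submodule.mul_mem_mul b.2 b'.2⟩, ?_⟩
      simp only [LinearMap.lTensor_tmul, Submodule.subtype_apply,
        Algebra.TensorProduct.tmul_mul_tmul]

theorem IsLeftCoideal.mul {U W : Submodule k A} (hU : IsLeftCoideal U) (hW : IsLeftCoideal W) :
    IsLeftCoideal (U * W) := by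
  intro x hx f
  induction hx using Submodule.mul_induction_on' with
  | mem_mul_mem m hm n hn =>
    have h := mul_mem_range_lTensor (hU.comul_mem hm) (hW.comul_mem hn)
    rw [← Bialgebra.comul_mul] at h
    exact mem_range_lTensor_iff.1 h f
  | add x _ y _ hx hy => rw [map_add]; exact add_mem hx hy

/-- Every finite subset of a left coideal lies in a finite-dimensional left coideal. -/
theorem IsLeftCoideal.exists_finite {M : Submodule k A} (hM : IsLeftCoideal M) {ι : Type*}
    [Finite ι] (x : ι → A) (hx : ∀ i, x i ∈ M) :
    ∃ V : Submodule k A, FiniteDimensional k V ∧ IsLeftCoideal V ∧ V ≤ M ∧ ∀ i, x i ∈ V :=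
  ⟨⨆ i, coidealSpan (x i), inferInstance, .iSup fun i => isLeftCoideal_coidealSpan (x i),
    iSup_le fun i => coidealSpan_le hM (hx i),
    fun i => Submodule.mem_iSup_of_mem i (self_mem_coidealSpan (x i))⟩

/-- `a` is the comatrix of the family `p`: `Δ p_j = ∑_i a_{ji} ⊗ p_i`, and `a` satisfies the
identities of a matrix of coordinate functions. -/
structure IsComatrix {ι : Type*} [Fintype ι] [DecidableEq ι] (p : ι → A) (a : Matrix ι ι A) :
    Prop where
  comul_family : ∀ j, comul (R := k) (p j) = ∑ i, a j i ⊗ₜ[k] p i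
  comul_entry : ∀ j i, comul (R := k) (a j i) = ∑ l, a j l ⊗ₜ[k] a l i
  counit_entry : ∀ j i, counit (R := k) (a j i) = if j = i then 1 else 0

theorem IsComatrix.sum_mul_antipode {ι : Type*} [Fintype ι] [DecidableEq ι] {p : ι → A}
    {a : Matrix ι ι A} (h : IsComatrix (k := k) p a) (j i : ι) :
    ∑ l, a j l * HopfAlgebra.antipode k (a l i) = if j = i then 1 else 0 := by
  have := HopfAlgebra.mul_antipode_lTensor_comul_apply (R := k) (a j i)
  rw [h.comul_entry, h.counit_entry] at this
  simpa [apply_ite] using this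

theorem IsComatrix.sum_counit {ι : Type*} [Fintype ι] [DecidableEq ι] {p : ι → A}
    {a : Matrix ι ι A} (h : IsComatrix (k := k) p a) (j : ι) :
    p j = ∑ i, counit (R := k) (p i) • a j i := by
  have := Coalgebra.lTensor_counit_comul (R := k) (p j)
  rw [h.comul_family] at this
  have := congrArg (TensorProduct.rid k A) this
  simpa using this.symm

/-- Coefficients with respect to linearly independent right tensor factors are unique. -/
theorem eq_of_sum_tmul_basis {ι M : Type*} [Fintype ι] [AddCommGroup M] [Module k M]
    {V : Submodule k A} (b : Module.Basis ι k V) {x y : ι → M}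
    (h : ∑ i, x i ⊗ₜ[k] (b i : A) = ∑ i, y i ⊗ₜ[k] (b i : A)) : x = y := by
  classical
  have hinj : Function.Injective (LinearMap.lTensor M V.subtype) :=
    Module.Flat.lTensor_preserves_injective_linearMap _ V.injective_subtype
  have h' : ∑ i, x i ⊗ₜ[k] b i = ∑ i, y i ⊗ₜ[k] b i := hinj (by simpa using h)
  funext i
  have := congrArg (fun t => TensorProduct.equivFinsuppOfBasisRight b t i) h'
  simpa [Finsupp.finsetSum_apply, Finsupp.single_apply, ite_smul] using this

theorem exists_isComatrix {ι : Type*} [Fintype ι] [DecidableEq ι] {V : Submodule k A}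
    (hV : IsLeftCoideal V) (b : Module.Basis ι k V) :
    ∃ a : Matrix ι ι A, IsComatrix (k := k) (fun i => (b i : A)) a := by
  have hex : ∀ j, ∃ a : ι → A, comul (R := k) (b j : A) = ∑ i, a i ⊗ₜ[k] (b i : A) := by
    intro j
    obtain ⟨y, hy⟩ := hV.comul_mem (b j).2
    refine ⟨fun i => TensorProduct.equivFinsuppOfBasisRight b y i, ?_⟩
    rw [← hy]
    conv_lhs =>
      rw [← (TensorProduct.equivFinsuppOfBasisRight b).symm_apply_apply y,
        TensorProduct.equivFinsuppOfBasisRight_symm_apply, Finsupp.sum_fintype _ _ (by simp)]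
    simp
  choose a ha using hex
  refine ⟨a, ha, fun j => ?_, fun j => ?_⟩
  · have h1 := Coalgebra.coassoc_apply (R := k) (b j : A)
    rw [ha j] at h1
    simp only [map_sum, LinearMap.rTensor_tmul, LinearMap.lTensor_tmul, ha] at h1
    have h2 : ∑ i, comul (R := k) (a j i) ⊗ₜ[k] (b i : A) =
        ∑ i, (∑ l, a j l ⊗ₜ[k] a l i) ⊗ₜ[k] (b i : A) := by
      apply (TensorProduct.assoc k A A A).injective
      rw [map_sum, h1]
      simp only [TensorProduct.sum_tmul, TensorProduct.tmul_sum, map_sum,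
        TensorProduct.assoc_tmul]
      rw [Finset.sum_comm]
    exact fun i => congrFun (eq_of_sum_tmul_basis b h2) i
  · have h1 := Coalgebra.rTensor_counit_comul (R := k) (b j : A)
    rw [ha j] at h1
    have h2 : ∑ i, counit (R := k) (a j i) ⊗ₜ[k] (b i : A) =
        ∑ i, (if j = i then (1 : k) else 0) ⊗ₜ[k] (b i : A) := by
      simpa [TensorProduct.ite_tmul] using h1
    exact fun i => congrFun (eq_of_sum_tmul_basis b h2) i

/-- A finite-dimensional left coideal has a basis with a comatrix. -/
theorem IsLeftCoideal.exists_basis {V : Submodule k A} [FiniteDimensional k V]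
    (hV : IsLeftCoideal V) :
    ∃ (n : ℕ) (p : Fin n → A) (a : Matrix (Fin n) (Fin n) A),
      Submodule.span k (Set.range p) = V ∧ IsComatrix (k := k) p a := by
  let b := Module.finBasis k V
  obtain ⟨a, ha⟩ := exists_isComatrix hV b
  refine ⟨_, _, a, ?_, ha⟩
  have : (Set.range fun i => (b i : A)) = V.subtype '' Set.range b := by
    rw [← Set.range_comp]; rfl
  rw [this, Submodule.span_image, b.span_eq, Submodule.map_top, Submodule.range_subtype]

end Coideals

/-! ### Minors of relation matrices -/

section Minors

/-- Multilinear expansion of a determinant whose entries are sums. -/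
theorem det_expand {R ι κ : Type*} [CommRing R] [Fintype ι] [Fintype κ] [DecidableEq ι]
    [DecidableEq κ] {s : ℕ} (e : κ → R) (x : Fin s → κ → ι → R) (B : ι → Fin s → R) :
    Matrix.det (Matrix.of fun a b => ∑ i, (∑ β, e β * x a β i) * B i b) =
      ∑ I : Fin s → ι, ∑ J : Fin s → κ, ((∏ b, B (I b) b) * ∏ a, e (J a)) *
        Matrix.det (Matrix.of fun a b => x a (J a) (I b)) := by
  rw [← Matrix.det_transpose]
  have h1 : (Matrix.of fun a b => ∑ i, (∑ β, e β * x a β i) * B i b).transpose =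
      Matrix.of fun b => ∑ i, B i b • fun a => ∑ β, e β * x a β i := by
    ext b a
    simp [mul_comm]
  rw [h1]
  change Matrix.detRowAlternating.toMultilinearMap
    (fun b => ∑ i, B i b • fun a => ∑ β, e β * x a β i) = _
  rw [MultilinearMap.map_sum]
  refine Finset.sum_congr rfl fun I _ => ?_
  rw [MultilinearMap.map_smul_univ Matrix.detRowAlternating.toMultilinearMap
    (fun b => B (I b) b) (fun b a => ∑ β, e β * x a β (I b))]
  change _ • Matrix.det (Matrix.of fun b a => ∑ β, e β * x a β (I b)) = _
  rw [← Matrix.det_transpose]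
  have h2 : (Matrix.of fun b a => ∑ β, e β * x a β (I b)).transpose =
      Matrix.of fun a => ∑ β, e β • fun b => x a β (I b) := by
    ext a b
    simp
  rw [h2]
  change _ • Matrix.detRowAlternating.toMultilinearMap
    (fun a => ∑ β, e β • fun b => x a β (I b)) = _
  rw [MultilinearMap.map_sum, Finset.smul_sum]
  refine Finset.sum_congr rfl fun J _ => ?_
  rw [MultilinearMap.map_smul_univ Matrix.detRowAlternating.toMultilinearMap
    (fun a => e (J a)) (fun a b => x a (J a) (I b)), smul_smul, smul_eq_mul]
  rfl

/-- Laplace expansion of a bordered minor along its first column: the coefficients of the other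
rows do not depend on the bordering column. -/
theorem det_border {R : Type*} [CommRing R] {s n : ℕ} (r : Fin s → Fin n → R)
    (T : Fin s → Fin n) (c : Fin n → R) (j : Fin n) :
    Matrix.det (Matrix.of fun (a b : Fin (s + 1)) =>
        (Fin.cons c r : Fin (s + 1) → Fin n → R) a ((Fin.cons j T : Fin (s + 1) → Fin n) b)) =
      c j * Matrix.det (Matrix.of fun a b => r a (T b)) +
      ∑ i : Fin s, r i j * ((-1) ^ (i.1 + 1) * Matrix.det (Matrix.of fun (a b : Fin s) =>
        (Fin.cons c r : Fin (s + 1) → Fin n → R) (i.succ.succAbove a) (T b))) := by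
  rw [Matrix.det_succ_column_zero, Fin.sum_univ_succ]
  congr 1
  · simp only [Fin.val_zero, pow_zero, one_mul, Matrix.of_apply, Fin.cons_zero,
      Fin.succAbove_zero]
    rfl
  · refine Finset.sum_congr rfl fun i _ => ?_
    simp only [Matrix.of_apply, Fin.cons_succ, Fin.cons_zero, Fin.val_succ]
    rw [mul_comm _ (r i j), mul_assoc]
    rfl

variable {k A : Type*} [Field k] [CommRing A] [HopfAlgebra k A]

/-- `r` is a relation with coefficients in `C` among the classes of the `p_j` modulo `M`. -/
def IsRelation (C M : Submodule k A) {n : ℕ} (p : Fin n → A) (r : Fin n → A) : Prop :=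
  (∀ j, r j ∈ C) ∧ ∑ j, r j * p j ∈ M

/-- The span of the `s × s`-minors of relations: up to multiplication by `C`, a Fitting ideal of the
`C`-module generated by the classes of the `p_j` modulo `M`. -/
def minorSpan (C M : Submodule k A) {n : ℕ} (p : Fin n → A) (s : ℕ) : Submodule k A :=
  Submodule.span k {x | ∃ (r : Fin s → Fin n → A) (T : Fin s → Fin n),
    (∀ a, IsRelation C M p (r a)) ∧ x = Matrix.det (Matrix.of fun a b => r a (T b))}

theorem sliceLeft_mul_tmul_one (f : Module.Dual k A) (t : A ⊗[k] A) (c : A) :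
    sliceLeft f (t * (c ⊗ₜ 1)) = sliceLeft (f ∘ₗ LinearMap.mulRight k c) t := by
  induction t using TensorProduct.induction_on with
  | zero => simp
  | add x y hx hy => simp only [map_add, add_mul, hx, hy]
  | tmul a b => simp

theorem sliceLeft_mul_one_tmul (f : Module.Dual k A) (t : A ⊗[k] A) (c : A) :
    sliceLeft f (t * (1 ⊗ₜ c)) = sliceLeft f t * c := by
  induction t using TensorProduct.induction_on with
  | zero => simp
  | add x y hx hy => simp only [map_add, add_mul, hx, hy]
  | tmul a b => simp

variable {C M : Submodule k A} {n : ℕ} {p : Fin n → A} {a : Matrix (Fin n) (Fin n) A}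

theorem isRelation_slice (hC : IsLeftCoideal C) (hM : IsLeftCoideal M)
    (ha : IsComatrix (k := k) p a) {r : Fin n → A} (hr : IsRelation C M p r)
    (f : Module.Dual k A) :
    IsRelation C M p fun i => sliceLeft f (∑ j, comul (R := k) (r j) * (a j i ⊗ₜ 1)) := by
  constructor
  · intro i
    change sliceLeft f (∑ j, comul (R := k) (r j) * (a j i ⊗ₜ 1)) ∈ C
    rw [map_sum]
    refine Submodule.sum_mem _ fun j _ => ?_
    rw [sliceLeft_mul_tmul_one]
    exact hC _ (hr.1 j) _
  · have h : ∑ i, sliceLeft f (∑ j, comul (R := k) (r j) * (a j i ⊗ₜ 1)) * p i =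
        lact f (∑ j, r j * p j) := by
      rw [lact_apply, map_sum]
      simp only [Bialgebra.comul_mul, ha.comul_family]
      simp only [← sliceLeft_mul_one_tmul]
      rw [← map_sum]
      congr 1
      simp only [Finset.sum_mul, Finset.mul_sum, mul_assoc, Algebra.TensorProduct.tmul_mul_tmul,
        mul_one, one_mul]
      rw [Finset.sum_comm]
    rw [h]
    exact hM _ hr.2 f

theorem comul_eq_sum_comatrix (ha : IsComatrix (k := k) p a) (r : Fin n → A) (l : Fin n) :
    comul (R := k) (r l) = ∑ i, (∑ j, comul (R := k) (r j) * (a j i ⊗ₜ 1)) *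
      (HopfAlgebra.antipode k (a i l) ⊗ₜ 1) := by
  simp only [Finset.sum_mul]
  rw [Finset.sum_comm]
  simp only [mul_assoc, Algebra.TensorProduct.tmul_mul_tmul, mul_one]
  simp only [← Finset.mul_sum, ← TensorProduct.sum_tmul, ha.sum_mul_antipode]
  simp [TensorProduct.ite_tmul, ← Algebra.TensorProduct.one_def]

/-- The minors of relations between left coideals span a left coideal: this is the translation
invariance of the Fitting ideals of a Hopf module. -/
theorem isLeftCoideal_minorSpan (hC : IsLeftCoideal C) (hM : IsLeftCoideal M)
    (ha : IsComatrix (k := k) p a) (s : ℕ) : IsLeftCoideal (minorSpan C M p s) := by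
  intro x hx f
  have key : minorSpan C M p s ≤ (minorSpan C M p s).comap (lact f) := by
    refine Submodule.span_le.2 ?_
    rintro _ ⟨r, T, hr, rfl⟩
    change lact f _ ∈ minorSpan C M p s
    obtain ⟨m, e, e', he⟩ := exists_sum_sliceLeft (k := k) (fun q : Fin s × Fin n =>
      ∑ j, comul (R := k) (r q.1 j) * (a j q.2 ⊗ₜ[k] (1 : A)))
    have hdet : comul (R := k) (Matrix.det (Matrix.of fun a b => r a (T b))) =
        Matrix.det (Matrix.of fun c b => ∑ i, (∑ β, (e β ⊗ₜ[k] (1 : A)) *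
          ((1 : A) ⊗ₜ[k] sliceLeft (e' β) (∑ j, comul (R := k) (r c j) * (a j i ⊗ₜ[k] (1 : A))))) *
          (HopfAlgebra.antipode k (a i (T b)) ⊗ₜ[k] (1 : A))) := by
      rw [← Bialgebra.comulAlgHom_apply, AlgHom.map_det]
      congr 1
      ext c b
      simp only [AlgHom.mapMatrix_apply, Matrix.map_apply, Matrix.of_apply,
        Bialgebra.comulAlgHom_apply, Algebra.TensorProduct.tmul_mul_tmul, mul_one, one_mul]
      rw [comul_eq_sum_comatrix ha]
      refine Finset.sum_congr rfl fun i _ => ?_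
      congr 1
      exact he (c, i)
    rw [lact_apply, hdet, det_expand, map_sum]
    refine Submodule.sum_mem _ fun I _ => ?_
    rw [map_sum]
    refine Submodule.sum_mem _ fun J _ => ?_
    have h1 : Matrix.det (Matrix.of fun c b => (1 : A) ⊗ₜ[k] sliceLeft (e' (J c))
        (∑ j, comul (R := k) (r c j) * (a j (I b) ⊗ₜ[k] (1 : A)))) =
        (1 : A) ⊗ₜ[k] Matrix.det (Matrix.of fun c b => sliceLeft (e' (J c))
          (∑ j, comul (R := k) (r c j) * (a j (I b) ⊗ₜ[k] (1 : A)))) := by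
      rw [← Algebra.TensorProduct.includeRight_apply, AlgHom.map_det]
      rfl
    have h2 : ∀ {κ : Type} [Fintype κ] (g : κ → A), ∏ b, g b ⊗ₜ[k] (1 : A) =
        (∏ b, g b) ⊗ₜ[k] (1 : A) := by
      intro κ _ g
      exact (map_prod (Algebra.TensorProduct.includeLeft (R := k) (S := k) (A := A) (B := A))
        g Finset.univ).symm
    rw [h1, h2, h2, Algebra.TensorProduct.tmul_mul_tmul, Algebra.TensorProduct.tmul_mul_tmul,
      sliceLeft_tmul]
    refine Submodule.smul_mem _ _ ?_
    rw [mul_one, one_mul]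
    exact Submodule.subset_span ⟨_, I, fun c => isRelation_slice hC hM ha (hr c) (e' (J c)), rfl⟩
  exact key hx

theorem minorSpan_eq_bot_of_lt {s : ℕ} (hs : n < s) : minorSpan C M p s = ⊥ := by
  refine (Submodule.span_eq_bot).2 ?_
  rintro _ ⟨r, T, -, rfl⟩
  obtain ⟨i, j, hij, hT⟩ := Fintype.exists_ne_map_eq_of_card_lt T (by simpa using hs)
  exact Matrix.det_zero_of_column_eq hij fun a => by simp [hT]

theorem one_mem_minorSpan_zero : (1 : A) ∈ minorSpan C M p 0 :=
  Submodule.subset_span ⟨fun i => i.elim0, fun i => i.elim0, fun i => i.elim0, by simp⟩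

end Minors

/-! ### Purity over left coideal subalgebras -/

section Purity

variable {k A : Type*} [Field k] [CommRing A] [HopfAlgebra k A]

/-- The augmentation ideal `C⁺ = C ∩ ker ε`, as a subspace of the ambient Hopf algebra. -/
def augPart (C : Subalgebra k A) : Submodule k A :=
  Subalgebra.toSubmodule C ⊓ LinearMap.ker (counit : A →ₗ[k] k)

theorem augPart_mono {C D : Subalgebra k A} (h : C ≤ D) : augPart C ≤ augPart D :=
  fun _ hx => ⟨h hx.1, hx.2⟩

theorem sub_counit_mem_augPart {C : Subalgebra k A} {x : A} (hx : x ∈ C) :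
    x - algebraMap k A (counit (R := k) x) ∈ augPart C :=
  ⟨C.sub_mem hx (C.algebraMap_mem _), by simp⟩

theorem mul_mem_augPart {C : Subalgebra k A} {x y : A} (hx : x ∈ C) (hy : y ∈ augPart C) :
    x * y ∈ augPart C :=
  ⟨C.mul_mem hx hy.1, by
    have : counit (R := k) y = 0 := hy.2
    simp [this]⟩

theorem mul_augPart_le (C : Subalgebra k A) : Subalgebra.toSubmodule C * augPart C ≤ augPart C :=
  Submodule.mul_le.2 fun _ hx _ hy => mul_mem_augPart hx hy

theorem augPart_mul_le {C : Subalgebra k A} {M : Submodule k A}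
    (hM : Subalgebra.toSubmodule C * M ≤ M) : augPart C * M ≤ M :=
  (mul_le_mul' inf_le_left le_rfl).trans hM

theorem det_mem {C : Subalgebra k A} {s : ℕ} {X : Matrix (Fin s) (Fin s) A}
    (h : ∀ i j, X i j ∈ C) : X.det ∈ C := by
  rw [Matrix.det_apply]
  exact Subalgebra.sum_mem _ fun σ _ => by
    rw [Units.smul_def]
    exact Subalgebra.zsmul_mem _ (Subalgebra.prod_mem _ fun i _ => h _ _) _

theorem minorSpan_le {C : Subalgebra k A} {M : Submodule k A} {n : ℕ} {p : Fin n → A} {s : ℕ} :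
    minorSpan (Subalgebra.toSubmodule C) M p s ≤ Subalgebra.toSubmodule C := by
  refine Submodule.span_le.2 ?_
  rintro _ ⟨r, T, hr, rfl⟩
  exact det_mem fun i j => (hr i).1 _

theorem exists_finite_of_mem_mul {U M : Submodule k A} (hM : IsLeftCoideal M) {x : A}
    (hx : x ∈ U * M) :
    ∃ V : Submodule k A, FiniteDimensional k V ∧ IsLeftCoideal V ∧ V ≤ M ∧ x ∈ U * V := by
  induction hx using Submodule.mul_induction_on' with
  | mem_mul_mem m hm n hn =>
    exact ⟨coidealSpan n, inferInstance, isLeftCoideal_coidealSpan n, coidealSpan_le hM hn,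
      Submodule.mul_mem_mul hm (self_mem_coidealSpan n)⟩
  | add x _ y _ hx hy =>
    obtain ⟨V, h1, h2, h3, h4⟩ := hx
    obtain ⟨W, g1, g2, g3, g4⟩ := hy
    exact ⟨V ⊔ W, inferInstance, h2.sup g2, sup_le h3 g3,
      add_mem ((mul_le_mul' le_rfl le_sup_left : U * V ≤ U * (V ⊔ W)) h4)
        ((mul_le_mul' le_rfl le_sup_right : U * W ≤ U * (V ⊔ W)) g4)⟩

theorem mem_mul_span_range {U : Submodule k A} {n : ℕ} {p : Fin n → A} {x : A}
    (hx : x ∈ U * Submodule.span k (Set.range p)) :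
    ∃ c : Fin n → A, (∀ j, c j ∈ U) ∧ x = ∑ j, c j * p j := by
  induction hx using Submodule.mul_induction_on' with
  | mem_mul_mem m hm y hy =>
    obtain ⟨t, rfl⟩ := (Submodule.mem_span_range_iff_exists_fun k).1 hy
    exact ⟨fun j => t j • m, fun j => U.smul_mem _ hm, by simp [Finset.mul_sum]⟩
  | add x _ y _ hx hy =>
    obtain ⟨c, hc, rfl⟩ := hx
    obtain ⟨d, hd, rfl⟩ := hy
    exact ⟨fun j => c j + d j, fun j => add_mem (hc j) (hd j), by
      simp [add_mul, Finset.sum_add_distrib]⟩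

/-- The negated coefficients in the expression of `μ c` through the rows `r` that results from the
vanishing of bordered minors; here `μ` is the minor of `r` on the columns `T`. -/
def borderCoeff {s n : ℕ} (r : Fin s → Fin n → A) (T : Fin s → Fin n) (c : Fin n → A)
    (i : Fin s) : A :=
  (-1) ^ (i.1 + 1) * Matrix.det (Matrix.of fun (a b : Fin s) =>
    (Fin.cons c r : Fin (s + 1) → Fin n → A) (i.succ.succAbove a) (T b))

theorem mul_minor_of_relation {C M : Submodule k A} {s n : ℕ} {p : Fin n → A}
    (hs : minorSpan C M p (s + 1) = ⊥) {r : Fin s → Fin n → A}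
    (hr : ∀ a, IsRelation C M p (r a)) (T : Fin s → Fin n) {c : Fin n → A}
    (hc : IsRelation C M p c) (j : Fin n) :
    c j * Matrix.det (Matrix.of fun a b => r a (T b)) + ∑ i, r i j * borderCoeff r T c i = 0 := by
  have h := det_border r T c j
  have h0 : Matrix.det (Matrix.of fun (a b : Fin (s + 1)) =>
      (Fin.cons c r : Fin (s + 1) → Fin n → A) a ((Fin.cons j T : Fin (s + 1) → Fin n) b)) ∈
      minorSpan C M p (s + 1) :=
    Submodule.subset_span ⟨Fin.cons c r, Fin.cons j T, fun a => by
      refine Fin.cases ?_ (fun i => ?_) a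
      · simpa using hc
      · simpa using hr i, rfl⟩
  rw [hs, Submodule.mem_bot, h] at h0
  exact h0

theorem borderCoeff_mem {C : Subalgebra k A} {s n : ℕ} {r : Fin s → Fin n → A}
    (T : Fin s → Fin n) {c : Fin n → A} (hr : ∀ a j, r a j ∈ C) (hc : ∀ j, c j ∈ C) (i : Fin s) :
    borderCoeff r T c i ∈ C := by
  refine C.mul_mem (C.pow_mem (C.neg_mem C.one_mem) _) (det_mem fun a b => ?_)
  simp only [Matrix.of_apply]
  refine Fin.cases (motive := fun q => (Fin.cons c r : Fin (s + 1) → Fin n → A) q (T b) ∈ C)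
    ?_ (fun i => ?_) (i.succ.succAbove a)
  · simpa using hc _
  · simpa using hr _ _

theorem borderCoeff_mem_augPart {C : Subalgebra k A} {s n : ℕ} {r : Fin s → Fin n → A}
    (T : Fin s → Fin n) {c : Fin n → A} (hr : ∀ a j, r a j ∈ C) (hc : ∀ j, c j ∈ augPart C)
    (i : Fin s) : borderCoeff r T c i ∈ augPart C := by
  refine ⟨borderCoeff_mem T hr (fun j => (hc j).1) i, ?_⟩
  obtain ⟨s, rfl⟩ : ∃ s', s = s' + 1 := ⟨s - 1, by have := i.2; omega⟩
  change counit (R := k) (borderCoeff r T c i) = 0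
  rw [borderCoeff, Bialgebra.counit_mul, ← Bialgebra.counitAlgHom_apply (R := k)
    (A := A) (Matrix.det _), AlgHom.map_det, Matrix.det_eq_zero_of_row_eq_zero 0, mul_zero]
  intro b
  have : counit (R := k) (c (T b)) = 0 := (hc _).2
  simpa using this

/-- For some `s` there is an `s × s`-minor of relations not vanishing at the augmentation, while all
`(s + 1) × (s + 1)`-minors are zero. -/
theorem exists_minor_counit_ne_zero {C M : Submodule k A} (hC : IsLeftCoideal C)
    (hM : IsLeftCoideal M) {n : ℕ} {p : Fin n → A} {a : Matrix (Fin n) (Fin n) A}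
    (ha : IsComatrix (k := k) p a) :
    ∃ s : ℕ, minorSpan C M p (s + 1) = ⊥ ∧
      ∃ (r : Fin s → Fin n → A) (T : Fin s → Fin n), (∀ a, IsRelation C M p (r a)) ∧
        counit (R := k) (Matrix.det (Matrix.of fun a b => r a (T b))) ≠ 0 := by
  let P : ℕ → Prop := fun s =>
    ∀ y ∈ minorSpan C M p s, counit (R := k) y = 0
  have hP : ∃ s, P s := ⟨n + 1, fun y hy => by
    rw [minorSpan_eq_bot_of_lt (Nat.lt_succ_self n), Submodule.mem_bot] at hy
    rw [hy, map_zero]⟩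
  classical
  obtain ⟨s, hs⟩ : ∃ s, Nat.find hP = s + 1 := by
    refine Nat.exists_eq_succ_of_ne_zero fun h0 => ?_
    have := Nat.find_spec hP
    rw [h0] at this
    exact one_ne_zero ((Bialgebra.counit_one (R := k) (A := A)).symm.trans
      (this 1 one_mem_minorSpan_zero))
  have hbot : minorSpan C M p (s + 1) = ⊥ := by
    have := Nat.find_spec hP
    rw [hs] at this
    exact (Submodule.eq_bot_iff _).2 fun y hy =>
      (isLeftCoideal_minorSpan hC hM ha (s + 1)).eq_zero this hy
  refine ⟨s, hbot, ?_⟩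
  by_contra hcon
  push Not at hcon
  refine Nat.find_min hP (m := s) (by omega) fun y hy => ?_
  have hle : minorSpan C M p s ≤ LinearMap.ker (counit : A →ₗ[k] k) := by
    refine Submodule.span_le.2 ?_
    rintro _ ⟨r, T, hr, rfl⟩
    exact hcon r T hr
  exact hle hy

/-- Purity at the augmentation ideal: for a left coideal subalgebra `C` and left coideals `M`, `M'`,
an element of `M ∩ C⁺ M'` lies in `C⁺ M`. If `M ⊆ M'` are `C`-stable, this is the vanishing of
`Tor₁(M'/M, k)` over `C`. The quotient is locally free near the augmentation, since its Fitting
ideals are translation invariant: one of them does not vanish there, and the next one is zero. -/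
theorem mem_augPart_mul_of_mem {C : Subalgebra k A} {M M' : Submodule k A}
    (hC : IsLeftCoideal (Subalgebra.toSubmodule C)) (hM : IsLeftCoideal M)
    (hM' : IsLeftCoideal M') {x : A} (hxM : x ∈ M)
    (hx : x ∈ augPart C * M') : x ∈ augPart C * M := by
  obtain ⟨V, hVf, hV, hVM, hxV⟩ := exists_finite_of_mem_mul hM' hx
  obtain ⟨n, p, a, hspan, ha⟩ := hV.exists_basis
  rw [← hspan] at hxV
  obtain ⟨c, hc, hcx⟩ := mem_mul_span_range hxV
  have hcr : IsRelation (Subalgebra.toSubmodule C) M p c := ⟨fun j => (hc j).1, hcx ▸ hxM⟩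
  obtain ⟨s, hbot, r, T, hr, hμ⟩ := exists_minor_counit_ne_zero hC hM ha
  have hμC : Matrix.det (Matrix.of fun a b => r a (T b)) ∈ C := det_mem fun i j => (hr i).1 _
  have hrel := mul_minor_of_relation hbot hr T hcr
  have hcoef := borderCoeff_mem_augPart (C := C) T (fun a j => (hr a).1 j) hc
  generalize hdef : Matrix.det (Matrix.of fun a b => r a (T b)) = μ at *
  have hμx : μ * x ∈ augPart C * M := by
    have : μ * x = -∑ i, borderCoeff r T c i * ∑ j, r i j * p j := by
      rw [hcx, Finset.mul_sum, ← sub_eq_zero, sub_neg_eq_add]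
      simp only [Finset.mul_sum]
      rw [Finset.sum_comm, ← Finset.sum_add_distrib]
      refine Finset.sum_eq_zero fun j _ => ?_
      have := congrArg (· * p j) (hrel j)
      simp only [add_mul, Finset.sum_mul, zero_mul] at this
      rw [← this]
      congr 1
      · ring
      · exact Finset.sum_congr rfl fun i _ => by ring
    rw [this]
    exact neg_mem (Submodule.sum_mem _ fun i _ => Submodule.mul_mem_mul (hcoef i) (hr i).2)
  have h2 : (μ - algebraMap k A (counit (R := k) μ)) * x ∈ augPart C * M :=
    Submodule.mul_mem_mul (sub_counit_mem_augPart hμC) hxM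
  have h3 : counit (R := k) μ • x ∈ augPart C * M := by
    have := sub_mem hμx h2
    rwa [sub_mul, sub_sub_cancel, ← Algebra.smul_def] at this
  exact (Submodule.smul_mem_iff _ hμ).1 h3

/-- A Hopf subalgebra, as a subalgebra of the ambient Hopf algebra. -/
structure IsHopfSubalgebra (C : Subalgebra k A) : Prop where
  comul_mem : ∀ x ∈ C, comul (R := k) x ∈
    LinearMap.range (TensorProduct.map (Subalgebra.toSubmodule C).subtype
      (Subalgebra.toSubmodule C).subtype)
  antipode_mem : ∀ x ∈ C, HopfAlgebra.antipode k x ∈ C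

theorem IsHopfSubalgebra.isLeftCoideal {C : Subalgebra k A} (hC : IsHopfSubalgebra C) :
    IsLeftCoideal (Subalgebra.toSubmodule C) := by
  intro x hx f
  obtain ⟨n, a, b, -, hb, h⟩ := exists_sum_tmul_of_mem_range_map (hC.comul_mem x hx)
  rw [lact_apply, h]
  exact sliceLeft_mem_of_sum hb f

theorem IsHopfSubalgebra.sliceRight_mem {C : Subalgebra k A} (hC : IsHopfSubalgebra C) {x : A}
    (hx : x ∈ C) (f : Module.Dual k A) : sliceRight f (comul (R := k) x) ∈ C := by
  obtain ⟨n, a, b, ha, -, h⟩ := exists_sum_tmul_of_mem_range_map (hC.comul_mem x hx)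
  rw [h, map_sum]
  exact Subalgebra.sum_mem _ fun i _ => by
    rw [sliceRight_tmul]
    exact C.smul_mem (ha i) _

theorem IsComatrix.entry_mem {ι : Type*} [Fintype ι] [DecidableEq ι] {V : Submodule k A}
    {b : Module.Basis ι k V} {a : Matrix ι ι A} (ha : IsComatrix (k := k) (fun i => (b i : A)) a)
    {E : Subalgebra k A} (hE : IsHopfSubalgebra E) (hVE : V ≤ Subalgebra.toSubmodule E)
    (j i : ι) : a j i ∈ E := by
  obtain ⟨φ, hφ⟩ := LinearMap.exists_extend (b.coord i)
  have : a j i = sliceRight φ (comul (R := k) (b j : A)) := by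
    rw [ha.comul_family, map_sum]
    have h1 : ∀ l, φ (b l) = if l = i then 1 else 0 := fun l => by
      have := LinearMap.congr_fun hφ (b l)
      simpa [Finsupp.single_apply] using this
    simp [h1]
  rw [this]
  exact hE.sliceRight_mem (hVE (b j).2) φ

/-- An ideal of a Hopf subalgebra `C` which is a left coideal and does not lie in the kernel of the
counit is the unit ideal. -/
theorem IsHopfSubalgebra.one_mem_of_isLeftCoideal {C : Subalgebra k A} (hC : IsHopfSubalgebra C)
    {U : Submodule k A} (hU : IsLeftCoideal U) (hUC : U ≤ Subalgebra.toSubmodule C)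
    (hCU : Subalgebra.toSubmodule C * U ≤ U) {u : A} (hu : u ∈ U)
    (hε : counit (R := k) u ≠ 0) : 1 ∈ U := by
  have h : comul (R := k) u ∈ LinearMap.range
      (TensorProduct.map (Subalgebra.toSubmodule C).subtype U.subtype) :=
    mem_range_map_of_slices (fun f => hC.sliceRight_mem (hUC hu) f) (fun f => hU u hu f)
  obtain ⟨n, a, b, ha, hb, h⟩ := exists_sum_tmul_of_mem_range_map h
  have h1 := HopfAlgebra.mul_antipode_rTensor_comul_apply (R := k) u
  rw [h] at h1
  simp only [map_sum, LinearMap.rTensor_tmul, LinearMap.mul'_apply] at h1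
  have h2 : algebraMap k A (counit (R := k) u) ∈ U := by
    rw [← h1]
    exact Submodule.sum_mem _ fun i _ =>
      hCU (Submodule.mul_mem_mul (hC.antipode_mem _ (ha i)) (hb i))
  rw [Algebra.algebraMap_eq_smul_one] at h2
  exact (Submodule.smul_mem_iff _ hε).1 h2

/-- The minors of maximal size annihilate the quotient module. -/
theorem minorSpan_mul_mem {C : Subalgebra k A} {M : Submodule k A}
    (hCM : Subalgebra.toSubmodule C * M ≤ M) {n : ℕ} {p : Fin n → A} {y : A}
    (hy : y ∈ minorSpan (Subalgebra.toSubmodule C) M p n) (j : Fin n) : y * p j ∈ M := by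
  have hle : minorSpan (Subalgebra.toSubmodule C) M p n ≤
      M.comap (LinearMap.mulRight k (p j)) := by
    refine Submodule.span_le.2 ?_
    rintro _ ⟨r, T, hr, rfl⟩
    change Matrix.det (Matrix.of fun a b => r a (T b)) * p j ∈ M
    by_cases hT : Function.Injective T
    · let e := Equiv.ofBijective T (Finite.injective_iff_bijective.1 hT)
      set G : Matrix (Fin n) (Fin n) A := Matrix.of fun a b => r a (T b) with hG
      have h1 : G.det * p j = ∑ a, G.adjugate (e.symm j) a * ∑ l, r a l * p l := by
        have h2 : ∀ a, ∑ l, r a l * p l = G.mulVec (fun b => p (T b)) a := by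
          intro a
          simp only [Matrix.mulVec, dotProduct, hG, Matrix.of_apply]
          exact (Equiv.sum_comp e fun l => r a l * p l).symm
        simp only [h2]
        change _ = (G.adjugate.mulVec (G.mulVec fun b => p (T b))) (e.symm j)
        rw [Matrix.mulVec_mulVec, Matrix.adjugate_mul, Matrix.smul_mulVec, Matrix.one_mulVec]
        change _ = G.det • p (e (e.symm j))
        rw [Equiv.apply_symm_apply, smul_eq_mul]
      rw [h1]
      refine Submodule.sum_mem _ fun a _ => hCM (Submodule.mul_mem_mul ?_ (hr a).2)
      change G.adjugate (e.symm j) a ∈ C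
      rw [Matrix.adjugate_apply]
      refine det_mem fun i l => ?_
      rw [Matrix.updateRow_apply]
      split_ifs
      · rw [Pi.single_apply]
        split_ifs
        exacts [C.one_mem, C.zero_mem]
      · exact (hr i).1 _
    · obtain ⟨i, l, hil, hne⟩ : ∃ i l, T i = T l ∧ i ≠ l := by
        simpa [Function.Injective] using hT
      rw [Matrix.det_zero_of_column_eq hne fun a => by simp [hil], zero_mul]
      exact zero_mem _
  exact hle hy

/-- Nakayama's lemma at the augmentation ideal, without finiteness assumptions: a `C`-stable left
coideal `M'` with `M' ⊆ M + C⁺ M'` is contained in `M`. -/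
theorem IsHopfSubalgebra.le_of_le_sup_augPart_mul {C : Subalgebra k A} (hC : IsHopfSubalgebra C)
    {M M' : Submodule k A} (hM : IsLeftCoideal M) (hM' : IsLeftCoideal M')
    (hCM : Subalgebra.toSubmodule C * M ≤ M) (h : M' ≤ M ⊔ augPart C * M') : M' ≤ M := by
  intro x hx
  let V := coidealSpan (k := k) x
  have hV : IsLeftCoideal V := isLeftCoideal_coidealSpan x
  have hVM : V ≤ M' := coidealSpan_le hM' hx
  obtain ⟨n, p, a, hspan, ha⟩ := hV.exists_basis
  have hpV : ∀ j, p j ∈ V := fun j => hspan ▸ Submodule.subset_span ⟨j, rfl⟩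
  let N := M ⊔ Subalgebra.toSubmodule C * V
  have hN : IsLeftCoideal N := hM.sup (hC.isLeftCoideal.mul hV)
  have hVN : V ≤ N := by
    refine le_sup_of_le_right fun y hy => ?_
    have h1 := Submodule.mul_mem_mul (M := Subalgebra.toSubmodule C) C.one_mem hy
    rwa [one_mul] at h1
  have haN : augPart C * N ≤ M ⊔ augPart C * V := by
    rw [Submodule.mul_sup, ← mul_assoc]
    refine sup_le_sup (augPart_mul_le hCM) (mul_le_mul' ?_ le_rfl)
    rw [mul_comm]
    exact mul_augPart_le C
  have hrel : ∀ j, ∃ c : Fin n → A, (∀ i, c i ∈ augPart C) ∧ p j - ∑ i, c i * p i ∈ M := by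
    intro j
    obtain ⟨m, hm, y, hy, hmy⟩ := Submodule.mem_sup.1 (h (hVM (hpV j)))
    have hyN : y ∈ N := by
      have : y = p j - m := by rw [← hmy]; ring
      rw [this]
      exact sub_mem (hVN (hpV j)) (Submodule.mem_sup_left hm)
    obtain ⟨m', hm', z, hz, hmz⟩ := Submodule.mem_sup.1
      (haN (mem_augPart_mul_of_mem hC.isLeftCoideal hN hM' hyN hy))
    rw [← hspan] at hz
    obtain ⟨c, hc, rfl⟩ := mem_mul_span_range hz
    refine ⟨c, hc, ?_⟩
    have : p j - ∑ i, c i * p i = m + m' := by rw [← hmy, ← hmz]; ring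
    rw [this]
    exact add_mem hm hm'
  choose c hc hcM using hrel
  let r : Fin n → Fin n → A := fun j i => (if j = i then 1 else 0) - c j i
  have hr : ∀ j, IsRelation (Subalgebra.toSubmodule C) M p (r j) := by
    intro j
    refine ⟨fun i => ?_, ?_⟩
    · refine C.sub_mem ?_ (hc j i).1
      split_ifs
      exacts [C.one_mem, C.zero_mem]
    · have : ∑ i, r j i * p i = p j - ∑ i, c j i * p i := by
        simp [r, sub_mul, Finset.sum_sub_distrib]
      rw [this]
      exact hcM j
  have hε : counit (R := k) (Matrix.det (Matrix.of fun a b => r a (id b))) ≠ 0 := by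
    have h1 : (Bialgebra.counitAlgHom k A).mapMatrix (Matrix.of fun a b => r a (id b)) = 1 := by
      ext i j
      have : counit (R := k) (c i j) = 0 := (hc i j).2
      simp [r, Matrix.one_apply, this, apply_ite]
    rw [← Bialgebra.counitAlgHom_apply (R := k), AlgHom.map_det, h1, Matrix.det_one]
    exact one_ne_zero
  have hone : (1 : A) ∈ Subalgebra.toSubmodule C *
      minorSpan (Subalgebra.toSubmodule C) M p n := by
    refine hC.one_mem_of_isLeftCoideal
      (hC.isLeftCoideal.mul (isLeftCoideal_minorSpan hC.isLeftCoideal hM ha n)) ?_ ?_ ?_ hε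
    · exact Submodule.mul_le.2 fun x hx y hy => C.mul_mem hx (minorSpan_le hy)
    · rw [← mul_assoc]
      exact mul_le_mul' (Submodule.mul_le.2 fun _ hx _ hy => C.mul_mem hx hy) le_rfl
    · rw [← one_mul (Matrix.det _)]
      exact Submodule.mul_mem_mul C.one_mem (Submodule.subset_span ⟨r, id, hr, rfl⟩)
  have hpM : ∀ j, p j ∈ M := by
    intro j
    have hle : Subalgebra.toSubmodule C * minorSpan (Subalgebra.toSubmodule C) M p n ≤
        M.comap (LinearMap.mulRight k (p j)) := by
      refine Submodule.mul_le.2 fun x hx y hy => ?_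
      change x * y * p j ∈ M
      rw [mul_assoc]
      exact hCM (Submodule.mul_mem_mul hx (minorSpan_mul_mem hCM hy j))
    simpa using hle hone
  have : V ≤ M := by
    rw [← hspan]
    exact Submodule.span_le.2 (Set.range_subset_iff.2 hpM)
  exact this (self_mem_coidealSpan x)

end Purity

/-! ### Modules with trivial Fitting ideals -/

section Fitting

variable {R X : Type*} [CommRing R] [AddCommGroup X] [Module R X] {n s : ℕ}

/-- The map `c ↦ (μ c_j + ⋯)_j` sending a vector to its bordered minors, for the rows `r` and the
columns `T`. -/
def borderMap (r : Fin s → Fin n → R) (T : Fin s → Fin n) : (Fin n → R) →ₗ[R] (Fin n → R) :=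
  LinearMap.pi fun j =>
    (Matrix.detRowAlternating.toMultilinearMap.toLinearMap
      (fun (a b : Fin (s + 1)) => (Fin.cons 0 r : Fin (s + 1) → Fin n → R) a
        ((Fin.cons j T : Fin (s + 1) → Fin n) b)) 0) ∘ₗ
      LinearMap.funLeft R R (Fin.cons j T : Fin (s + 1) → Fin n)

theorem borderMap_apply (r : Fin s → Fin n → R) (T : Fin s → Fin n) (c : Fin n → R) (j : Fin n) :
    borderMap r T c j = Matrix.det (Matrix.of fun (a b : Fin (s + 1)) =>
      (Fin.cons c r : Fin (s + 1) → Fin n → R) a ((Fin.cons j T : Fin (s + 1) → Fin n) b)) := by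
  change Matrix.det _ = _
  congr 1
  ext a b
  refine Fin.cases ?_ (fun i => ?_) a
  · simp [LinearMap.funLeft]
  · simp [Function.update_of_ne]

theorem borderMap_eq (r : Fin s → Fin n → R) (T : Fin s → Fin n) (c : Fin n → R) (j : Fin n) :
    borderMap r T c j = c j * Matrix.det (Matrix.of fun a b => r a (T b)) +
      ∑ i : Fin s, r i j * ((-1) ^ (i.1 + 1) * Matrix.det (Matrix.of fun (a b : Fin s) =>
        (Fin.cons c r : Fin (s + 1) → Fin n → R) (i.succ.succAbove a) (T b))) := by
  rw [borderMap_apply, det_border]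

theorem borderMap_apply_of_mem (r : Fin s → Fin n → R) (T : Fin s → Fin n) (c : Fin n → R)
    (b : Fin s) : borderMap r T c (T b) = 0 := by
  rw [borderMap_apply]
  exact Matrix.det_zero_of_column_eq (Fin.succ_ne_zero b).symm fun a => by simp

theorem borderMap_single {r : Fin s → Fin n → R} {T : Fin s → Fin n} {l : Fin n}
    (hl : ∀ b, T b ≠ l) (j : Fin n) :
    borderMap r T (Pi.single l 1) j =
      if j = l then Matrix.det (Matrix.of fun a b => r a (T b)) else 0 := by
  rw [borderMap_eq, Finset.sum_eq_zero, add_zero, Pi.single_apply, ite_mul, one_mul, zero_mul]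
  intro i _
  obtain ⟨s, rfl⟩ : ∃ s', s = s' + 1 := ⟨s - 1, by have := i.2; omega⟩
  rw [Matrix.det_eq_zero_of_row_eq_zero 0, mul_zero, mul_zero]
  intro b
  simp [hl b]

variable {p : Fin n → X}

theorem sum_borderMap {r : Fin s → Fin n → R} (hr : ∀ a, ∑ j, r a j • p j = 0)
    (T : Fin s → Fin n) (c : Fin n → R) :
    ∑ j, borderMap r T c j • p j =
      Matrix.det (Matrix.of fun a b => r a (T b)) • ∑ j, c j • p j := by
  simp only [borderMap_eq, add_smul, Finset.sum_add_distrib, Finset.sum_smul]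
  rw [Finset.sum_comm (s := Finset.univ) (t := Finset.univ)]
  have : ∀ (i : Fin s) (z : R), ∑ j, (r i j * z) • p j = 0 := by
    intro i z
    have h := congrArg (z • ·) (hr i)
    simp only [Finset.smul_sum, smul_zero, smul_smul] at h
    rw [← h]
    exact Finset.sum_congr rfl fun j _ => by rw [mul_comm]
  simp only [this, Finset.sum_const_zero, add_zero, Finset.smul_sum, smul_smul]
  exact Finset.sum_congr rfl fun j _ => by rw [mul_comm]

variable (R p s) in
/-- The Fitting condition of constant rank `n - s` for the module generated by `p`: the
`s × s`-minors of relations generate the unit ideal, the `(s + 1) × (s + 1)`-minors vanish. -/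
structure IsFittingOfRank : Prop where
  span_eq_top : Ideal.span {x : R | ∃ (r : Fin s → Fin n → R) (T : Fin s → Fin n),
    (∀ a, ∑ j, r a j • p j = 0) ∧ x = Matrix.det (Matrix.of fun a b => r a (T b))} = ⊤
  det_eq_zero : ∀ (r : Fin (s + 1) → Fin n → R) (T : Fin (s + 1) → Fin n),
    (∀ a, ∑ j, r a j • p j = 0) → Matrix.det (Matrix.of fun a b => r a (T b)) = 0
  span_range : Submodule.span R (Set.range p) = ⊤

theorem IsFittingOfRank.borderMap_eq_zero (h : IsFittingOfRank R s p) {r : Fin s → Fin n → R}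
    (hr : ∀ a, ∑ j, r a j • p j = 0) (T : Fin s → Fin n) {c : Fin n → R}
    (hc : ∑ j, c j • p j = 0) : borderMap r T c = 0 := by
  funext j
  rw [borderMap_apply]
  refine h.det_eq_zero _ _ fun a => ?_
  refine Fin.cases ?_ (fun i => ?_) a
  · simpa using hc
  · simpa using hr i

/-- A bordered minor map descends to the module. -/
theorem IsFittingOfRank.exists_descend (h : IsFittingOfRank R s p) {r : Fin s → Fin n → R}
    (hr : ∀ a, ∑ j, r a j • p j = 0) (T : Fin s → Fin n) :
    ∃ g : X →ₗ[R] (Fin n → R), ∀ c : Fin n → R, g (∑ j, c j • p j) = borderMap r T c := by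
  let π : (Fin n → R) →ₗ[R] X := Fintype.linearCombination R p
  have hπ : Function.Surjective π := by
    rw [← LinearMap.range_eq_top, Fintype.range_linearCombination]
    exact h.span_range
  refine ⟨(LinearMap.ker π).liftQ (borderMap r T) (fun c hc => ?_) ∘ₗ
    (π.quotKerEquivOfSurjective hπ).symm.toLinearMap, fun c => ?_⟩
  · exact h.borderMap_eq_zero hr T (by simpa [π, Fintype.linearCombination_apply] using hc)
  · have : ∑ j, c j • p j = π c := by simp [π, Fintype.linearCombination_apply]
    rw [this, LinearMap.comp_apply]
    change (LinearMap.ker π).liftQ (borderMap r T) _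
      ((π.quotKerEquivOfSurjective hπ).symm (π c)) = _
    have h2 : (π.quotKerEquivOfSurjective hπ).symm (π c) = (LinearMap.ker π).mkQ c := by
      rw [LinearEquiv.symm_apply_eq]
      rfl
    rw [h2]
    rfl

theorem IsFittingOfRank.projective (h : IsFittingOfRank R s p) : Module.Projective R X := by
  let I : Ideal R :=
    { carrier := {d | ∃ g : X →ₗ[R] (Fin n → R), ∀ x, ∑ j, g x j • p j = d • x}
      add_mem' := by
        rintro d d' ⟨g, hg⟩ ⟨g', hg'⟩
        exact ⟨g + g', fun x => by simp [add_smul, Finset.sum_add_distrib, hg, hg']⟩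
      zero_mem' := ⟨0, fun x => by simp⟩
      smul_mem' := by
        rintro c d ⟨g, hg⟩
        refine ⟨c • g, fun x => ?_⟩
        simp only [LinearMap.smul_apply, Pi.smul_apply, smul_eq_mul, mul_smul]
        rw [← Finset.smul_sum, hg] }
  have hI : I = ⊤ := by
    rw [eq_top_iff, ← h.span_eq_top]
    refine Ideal.span_le.2 ?_
    rintro _ ⟨r, T, hr, rfl⟩
    obtain ⟨g, hg⟩ := h.exists_descend hr T
    refine ⟨g, fun x => ?_⟩
    have hx : x ∈ Submodule.span R (Set.range p) := h.span_range ▸ Submodule.mem_top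
    obtain ⟨c, rfl⟩ := (Submodule.mem_span_range_iff_exists_fun R).1 hx
    rw [hg]
    exact sum_borderMap hr T c
  obtain ⟨g, hg⟩ : (1 : R) ∈ I := hI ▸ Submodule.mem_top
  refine Module.Projective.of_split g (Fintype.linearCombination R p) ?_
  ext x
  simpa [Fintype.linearCombination_apply] using hg x

theorem IsFittingOfRank.finite (h : IsFittingOfRank R s p) : Module.Finite R X :=
  ⟨⟨(Set.finite_range p).toFinset, by simpa using h.span_range⟩⟩

theorem IsFittingOfRank.finrank_eq (h : IsFittingOfRank R s p) (κ : Type*) [Field κ]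
    [Algebra R κ] : Module.finrank κ (κ ⊗[R] X) = n - s := by
  obtain ⟨r, T, hr, hμ⟩ : ∃ (r : Fin s → Fin n → R) (T : Fin s → Fin n),
      (∀ a, ∑ j, r a j • p j = 0) ∧
        algebraMap R κ (Matrix.det (Matrix.of fun a b => r a (T b))) ≠ 0 := by
    by_contra hcon
    push Not at hcon
    have hle : (⊤ : Ideal R) ≤ RingHom.ker (algebraMap R κ) := by
      rw [← h.span_eq_top]
      refine Ideal.span_le.2 ?_
      rintro _ ⟨r, T, hr, rfl⟩
      exact hcon r T hr
    have : (1 : R) ∈ RingHom.ker (algebraMap R κ) := hle Submodule.mem_top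
    rw [RingHom.mem_ker, map_one] at this
    exact one_ne_zero this
  have hT : Function.Injective T := by
    intro i j hij
    by_contra hne
    refine hμ ?_
    rw [Matrix.det_zero_of_column_eq hne fun a => by simp [hij], map_zero]
  obtain ⟨g, hg⟩ := h.exists_descend hr T
  have hgp : ∀ l, g (p l) = borderMap r T (Pi.single l 1) := by
    intro l
    rw [← hg]
    simp [Pi.single_apply]
  generalize hdef : Matrix.det (Matrix.of fun a b => r a (T b)) = μ at *
  let v : {j // j ∉ Set.range T} → κ ⊗[R] X := fun j => 1 ⊗ₜ p j
  have hli : LinearIndependent κ v := by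
    rw [Fintype.linearIndependent_iff]
    intro c hc l
    have h1 := congrArg (fun t => TensorProduct.AlgebraTensorModule.rid R κ κ
      ((LinearMap.baseChange κ (LinearMap.proj (l : Fin n) ∘ₗ g)) t)) hc
    simp only [map_sum, map_smul, map_zero, v, LinearMap.baseChange_tmul, LinearMap.comp_apply,
      LinearMap.proj_apply, hgp] at h1
    rw [Finset.sum_eq_single l] at h1
    · rw [borderMap_single (fun b hb => l.2 ⟨b, hb⟩), if_pos rfl, hdef] at h1
      simpa [Algebra.smul_def, hμ] using h1
    · intro j _ hj
      rw [borderMap_single (fun b hb => j.2 ⟨b, hb⟩), if_neg]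
      · simp
      · exact fun hlj => hj (Subtype.ext hlj.symm)
    · simp
  have hspan : ⊤ ≤ Submodule.span κ (Set.range v) := by
    have hp : ∀ l, (1 : κ) ⊗ₜ[R] p l ∈ Submodule.span κ (Set.range v) := by
      intro l
      have h1 : μ • p l = ∑ j, borderMap r T (Pi.single l 1) j • p j := by
        rw [sum_borderMap hr, hdef]
        simp [Pi.single_apply]
      have h2 : algebraMap R κ μ • ((1 : κ) ⊗ₜ[R] p l) ∈ Submodule.span κ (Set.range v) := by
        rw [algebraMap_smul, ← TensorProduct.tmul_smul, h1, TensorProduct.tmul_sum]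
        refine Submodule.sum_mem _ fun j _ => ?_
        rw [TensorProduct.tmul_smul, ← algebraMap_smul κ]
        by_cases hj : j ∈ Set.range T
        · obtain ⟨b, rfl⟩ := hj
          rw [borderMap_apply_of_mem, map_zero, zero_smul]
          exact zero_mem _
        · exact Submodule.smul_mem _ _ (Submodule.subset_span ⟨⟨j, hj⟩, rfl⟩)
      exact (Submodule.smul_mem_iff _ hμ).1 h2
    rintro t -
    induction t using TensorProduct.induction_on with
    | zero => exact zero_mem _
    | add x y hx hy => exact add_mem hx hy
    | tmul z x =>
      have hx : x ∈ Submodule.span R (Set.range p) := h.span_range ▸ Submodule.mem_top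
      obtain ⟨c, rfl⟩ := (Submodule.mem_span_range_iff_exists_fun R).1 hx
      rw [TensorProduct.tmul_sum]
      refine Submodule.sum_mem _ fun j _ => ?_
      have : z ⊗ₜ[R] (c j • p j) = (algebraMap R κ (c j) * z) • ((1 : κ) ⊗ₜ[R] p j) := by
        rw [TensorProduct.smul_tmul', smul_eq_mul, mul_one, ← TensorProduct.smul_tmul,
          Algebra.smul_def]
      rw [this]
      exact Submodule.smul_mem _ _ (hp j)
  rw [Module.finrank_eq_card_basis (Module.Basis.mk hli hspan)]
  rw [Fintype.card_subtype_compl (fun x => x ∈ Set.range T), Fintype.card_fin]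
  congr 1
  exact (Set.card_range_of_injective hT).trans (Fintype.card_fin s)

/-- Lagrange's theorem in algebraic form: modulo an ideal of finite codimension, a module of
constant Fitting rank is free. -/
theorem IsFittingOfRank.exists_equiv {k : Type*} [Field k] [Algebra k R] [Module k X]
    [IsScalarTower k R X] (h : IsFittingOfRank R s p) (I : Ideal R)
    [FiniteDimensional k (R ⧸ I)] :
    Nonempty ((X ⧸ (I • ⊤ : Submodule R X)) ≃ₗ[k] (Fin (n - s) → R ⧸ I)) := by
  have := h.projective
  have := h.finite
  have : IsArtinianRing (R ⧸ I) := IsArtinianRing.of_finite k (R ⧸ I)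
  have e : (R ⧸ I) ⊗[R] X ≃ₗ[R] X ⧸ (I • ⊤ : Submodule R X) :=
    TensorProduct.quotTensorEquivQuotSMul X I
  obtain ⟨b⟩ := Module.nonempty_basis_of_flat_of_finrank_eq (R ⧸ I) ((R ⧸ I) ⊗[R] X) (n - s) (by
    intro P
    let := Ideal.Quotient.field P.1
    rw [← h.finrank_eq ((R ⧸ I) ⧸ P.1)]
    exact (TensorProduct.AlgebraTensorModule.cancelBaseChange R (R ⧸ I) ((R ⧸ I) ⧸ P.1)
      ((R ⧸ I) ⧸ P.1) X).finrank_eq)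
  exact ⟨(e.restrictScalars k).symm ≪≫ₗ b.equivFun.restrictScalars k⟩

theorem IsFittingOfRank.finite_quotient {k : Type*} [Field k] [Algebra k R] [Module k X]
    [IsScalarTower k R X] (h : IsFittingOfRank R s p) (I : Ideal R)
    [FiniteDimensional k (R ⧸ I)] : FiniteDimensional k (X ⧸ (I • ⊤ : Submodule R X)) :=
  (h.exists_equiv (k := k) I).elim fun e => Module.Finite.equiv e.symm

theorem IsFittingOfRank.finrank_quotient {k : Type*} [Field k] [Algebra k R] [Module k X]
    [IsScalarTower k R X] (h : IsFittingOfRank R s p) (I : Ideal R)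
    [FiniteDimensional k (R ⧸ I)] :
    Module.finrank k (X ⧸ (I • ⊤ : Submodule R X)) =
      (n - s) * Module.finrank k (R ⧸ I) := by
  obtain ⟨e⟩ := h.exists_equiv (k := k) I
  rw [e.finrank_eq, Module.finrank_pi_fintype]
  simp

end Fitting

/-! ### The index of a Hopf subalgebra -/

section ENatRank

variable {k V W : Type*} [Field k] [AddCommGroup V] [Module k V]

theorem toENat_rank_of_finite [FiniteDimensional k V] :
    Cardinal.toENat (Module.rank k V) = (Module.finrank k V : ℕ∞) := by
  rw [← Module.finrank_eq_rank, Cardinal.toENat_nat]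

theorem toENat_rank_eq_top (h : ¬ FiniteDimensional k V) :
    Cardinal.toENat (Module.rank k V) = ⊤ := by
  rw [Cardinal.toENat_eq_top]
  by_contra hlt
  exact h (Module.rank_lt_aleph0_iff.1 (not_le.1 hlt))

theorem finite_of_toENat_rank_ne_top (h : Cardinal.toENat (Module.rank k V) ≠ ⊤) :
    FiniteDimensional k V := by
  by_contra hV
  exact h (toENat_rank_eq_top hV)

end ENatRank

section Index

variable {k A : Type*} [Field k] [CommRing A] [HopfAlgebra k A]

/-- The ideal `C⁺ A` of the ambient Hopf algebra, as a subspace. -/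
def augSpan (C : Subalgebra k A) : Submodule k A := ⊤ * augPart C

/-- The index `[E : C] = dim E / C⁺ E`, computed as the dimension of the image of `E` in
`A / C⁺ A`. For group schemes `Spec E → Spec C`, it is the size of the kernel. -/
def hopfIndex (C : Subalgebra k A) (E : Submodule k A) : ℕ∞ :=
  Cardinal.toENat (Module.rank k (E.map (augSpan C).mkQ))

theorem mul_mem_augSpan {C : Subalgebra k A} (x : A) {y : A} (hy : y ∈ augSpan C) :
    x * y ∈ augSpan C := by
  have h : (⊤ : Submodule k A) * augSpan C ≤ augSpan C := by
    rw [augSpan, ← mul_assoc]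
    exact mul_le_mul' le_top le_rfl
  exact h (Submodule.mul_mem_mul Submodule.mem_top hy)

theorem augPart_le_augSpan (C : Subalgebra k A) : augPart C ≤ augSpan C := fun x hx => by
  rw [← one_mul x]
  exact Submodule.mul_mem_mul Submodule.mem_top hx

theorem augSpan_mono {C D : Subalgebra k A} (h : C ≤ D) : augSpan C ≤ augSpan D :=
  mul_le_mul' le_rfl (augPart_mono h)

theorem counit_eq_zero_of_mem_augSpan {C : Subalgebra k A} {x : A} (hx : x ∈ augSpan C) :
    counit (R := k) x = 0 := by
  have hle : augSpan C ≤ LinearMap.ker (counit : A →ₗ[k] k) :=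
    Submodule.mul_le.2 fun a _ b hb => by
      have : counit (R := k) b = 0 := hb.2
      rw [LinearMap.mem_ker, Bialgebra.counit_mul, this, mul_zero]
  exact hle hx

theorem one_notMem_augSpan (C : Subalgebra k A) : (1 : A) ∉ augSpan C := fun h => by
  have := counit_eq_zero_of_mem_augSpan h
  rw [Bialgebra.counit_one] at this
  exact one_ne_zero this

/-- `E ∩ C⁺ A = C⁺ E`. -/
theorem mem_augPart_mul_of_mem_augSpan {C : Subalgebra k A} {E : Submodule k A}
    (hC : IsHopfSubalgebra C) (hE : IsLeftCoideal E) {x : A} (hxE : x ∈ E)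
    (hx : x ∈ augSpan C) : x ∈ augPart C * E :=
  mem_augPart_mul_of_mem hC.isLeftCoideal hE (fun _ _ _ => Submodule.mem_top) hxE
    (by rwa [augSpan, mul_comm] at hx)

theorem augPart_mul_le_augSpan (C : Subalgebra k A) (E : Submodule k A) :
    augPart C * E ≤ augSpan C := by
  rw [augSpan, mul_comm]
  exact mul_le_mul' le_top le_rfl

/-- A Hopf subalgebra `C` is determined by the ideal `C⁺ A`: a `C`-stable left coideal contained in
`C + C⁺ A` is contained in `C`. -/
theorem IsHopfSubalgebra.le_of_le_sup_augSpan {C : Subalgebra k A} (hC : IsHopfSubalgebra C)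
    {E : Submodule k A} (hE : IsLeftCoideal E) (hCE : Subalgebra.toSubmodule C ≤ E)
    (h : E ≤ Subalgebra.toSubmodule C ⊔ augSpan C) : E ≤ Subalgebra.toSubmodule C := by
  refine hC.le_of_le_sup_augPart_mul hC.isLeftCoideal hE
    (Submodule.mul_le.2 fun _ hx _ hy => C.mul_mem hx hy) fun x hx => ?_
  obtain ⟨c, hc, y, hy, rfl⟩ := Submodule.mem_sup.1 (h hx)
  refine add_mem (Submodule.mem_sup_left hc) (Submodule.mem_sup_right ?_)
  refine mem_augPart_mul_of_mem_augSpan hC hE ?_ hy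
  simpa using sub_mem hx (hCE hc)

theorem hopfIndex_mono {C : Subalgebra k A} {E F : Submodule k A} (h : E ≤ F) :
    hopfIndex C E ≤ hopfIndex C F :=
  Cardinal.toENat.monotone' (Submodule.rank_mono (Submodule.map_mono h))

theorem hopfIndex_anti {C D : Subalgebra k A} (h : C ≤ D) (E : Submodule k A) :
    hopfIndex D E ≤ hopfIndex C E := by
  have hle : augSpan C ≤ (augSpan D).comap LinearMap.id := augSpan_mono h
  have : E.map (augSpan D).mkQ =
      (E.map (augSpan C).mkQ).map ((augSpan C).mapQ (augSpan D) LinearMap.id hle) := by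
    rw [← Submodule.map_comp, Submodule.mapQ_mkQ, LinearMap.comp_id]
  rw [hopfIndex, this]
  exact Cardinal.toENat.monotone' (rank_map_le _ _)

theorem hopfIndex_self (C : Subalgebra k A) :
    hopfIndex C (Subalgebra.toSubmodule C) = 1 := by
  have h : (Subalgebra.toSubmodule C).map (augSpan C).mkQ =
      Submodule.span k {(augSpan C).mkQ 1} := by
    refine le_antisymm ?_ ?_
    · rintro _ ⟨x, hx, rfl⟩
      rw [Submodule.mem_span_singleton]
      refine ⟨counit (R := k) x, ?_⟩
      rw [← map_smul, ← sub_eq_zero, ← map_sub, Submodule.mkQ_apply,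
        Submodule.Quotient.mk_eq_zero, ← Submodule.neg_mem_iff, neg_sub,
        ← Algebra.algebraMap_eq_smul_one]
      exact augPart_le_augSpan C (sub_counit_mem_augPart hx)
    · rw [Submodule.span_singleton_le_iff_mem]
      exact ⟨1, C.one_mem, rfl⟩
  rw [hopfIndex, h, toENat_rank_of_finite, finrank_span_singleton]
  · rfl
  · rw [Submodule.mkQ_apply, Ne, Submodule.Quotient.mk_eq_zero]
    exact one_notMem_augSpan C

theorem hopfIndex_ne_zero {C : Subalgebra k A} {E : Submodule k A} (h : 1 ∈ E) :
    hopfIndex C E ≠ 0 := by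
  rw [hopfIndex, Ne, Cardinal.toENat_eq_zero]
  intro h0
  have := rank_zero_iff.1 h0
  have h1 : (⟨(augSpan C).mkQ 1, 1, h, rfl⟩ : E.map (augSpan C).mkQ) = 0 := Subsingleton.elim _ _
  have h2 : (augSpan C).mkQ 1 = 0 := congrArg Subtype.val h1
  rw [Submodule.mkQ_apply, Submodule.Quotient.mk_eq_zero] at h2
  exact one_notMem_augSpan C h2

/-- A `D`-stable subspace of the ambient algebra as a `D`-module. -/
def stableModule (D : Subalgebra k A) (E : Submodule k A)
    (hDE : Subalgebra.toSubmodule D * E ≤ E) : Submodule D A where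
  carrier := E
  add_mem' := E.add_mem
  zero_mem' := E.zero_mem
  smul_mem' c _ hx := hDE (Submodule.mul_mem_mul c.2 hx)

/-- If `[E : D]` is finite, then `E` satisfies a Fitting condition of constant rank over `D`. -/
theorem exists_isFittingOfRank {D : Subalgebra k A} {E : Submodule k A} (hD : IsHopfSubalgebra D)
    (hE : IsLeftCoideal E) (hDE : Subalgebra.toSubmodule D * E ≤ E)
    (hfin : hopfIndex D E ≠ ⊤) :
    ∃ (n s : ℕ) (p : Fin n → stableModule D E hDE), IsFittingOfRank D s p := by
  have hfd := finite_of_toENat_rank_ne_top hfin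
  obtain ⟨V, hVf, hV, hVE, hEV⟩ : ∃ V : Submodule k A, FiniteDimensional k V ∧
      IsLeftCoideal V ∧ V ≤ E ∧ E ≤ V ⊔ augSpan D := by
    let b := Module.finBasis k (E.map (augSpan D).mkQ)
    choose x hxE hxb using fun i => (b i).2
    obtain ⟨V, h1, h2, h3, h4⟩ := hE.exists_finite x hxE
    refine ⟨V, h1, h2, h3, fun y hy => ?_⟩
    have hy' := b.sum_repr ⟨(augSpan D).mkQ y, y, hy, rfl⟩
    have hy'' := congrArg Subtype.val hy'
    simp only [AddSubmonoidClass.coe_finsetSum, SetLike.val_smul, ← hxb] at hy''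
    rw [← sub_add_cancel y
      (∑ i, b.repr ⟨(augSpan D).mkQ y, y, hy, rfl⟩ i • x i), add_comm]
    refine add_mem (Submodule.mem_sup_left
      (Submodule.sum_mem _ fun i _ => V.smul_mem _ (h4 i))) (Submodule.mem_sup_right ?_)
    rw [← Submodule.Quotient.mk_eq_zero, ← Submodule.mkQ_apply, map_sub, sub_eq_zero, map_sum]
    simp only [map_smul]
    exact hy''.symm
  have hDD : Subalgebra.toSubmodule D * Subalgebra.toSubmodule D ≤ Subalgebra.toSubmodule D :=
    Submodule.mul_le.2 fun _ hx _ hy => D.mul_mem hx hy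
  have hVD : V ≤ Subalgebra.toSubmodule D * V := fun y hy => by
    have h1 := Submodule.mul_mem_mul (M := Subalgebra.toSubmodule D) D.one_mem hy
    rwa [one_mul] at h1
  have hDV : E ≤ Subalgebra.toSubmodule D * V := by
    refine hD.le_of_le_sup_augPart_mul (hD.isLeftCoideal.mul hV) hE ?_ fun x hx => ?_
    · rw [← mul_assoc]
      exact mul_le_mul' hDD le_rfl
    · obtain ⟨v, hv, y, hy, rfl⟩ := Submodule.mem_sup.1 (hEV hx)
      refine add_mem (Submodule.mem_sup_left (hVD hv)) (Submodule.mem_sup_right ?_)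
      refine mem_augPart_mul_of_mem_augSpan hD hE ?_ hy
      simpa using sub_mem hx (hVE hv)
  obtain ⟨n, p, a, hspan, ha⟩ := hV.exists_basis
  have hp : ∀ j, p j ∈ E := fun j => hVE (hspan ▸ Submodule.subset_span ⟨j, rfl⟩)
  have hbot : IsLeftCoideal (⊥ : Submodule k A) := by
    rintro x hx f
    rw [(Submodule.mem_bot k).1 hx, map_zero]
    exact zero_mem _
  obtain ⟨s, hs, r, T, hr, hμ⟩ := exists_minor_counit_ne_zero hD.isLeftCoideal hbot ha
  have hone : (1 : A) ∈ Subalgebra.toSubmodule D *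
      minorSpan (Subalgebra.toSubmodule D) ⊥ p s := by
    refine hD.one_mem_of_isLeftCoideal
      (hD.isLeftCoideal.mul (isLeftCoideal_minorSpan hD.isLeftCoideal hbot ha s)) ?_ ?_ ?_ hμ
    · exact Submodule.mul_le.2 fun x hx y hy => D.mul_mem hx (minorSpan_le hy)
    · rw [← mul_assoc]
      exact mul_le_mul' hDD le_rfl
    · rw [← one_mul (Matrix.det _)]
      exact Submodule.mul_mem_mul D.one_mem (Submodule.subset_span ⟨r, T, hr, rfl⟩)
  refine ⟨n, s, fun j => ⟨p j, hp j⟩, ?_, ?_, ?_⟩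
  · have hle : Subalgebra.toSubmodule D * minorSpan (Subalgebra.toSubmodule D) ⊥ p s ≤
        ((Ideal.span {x : D | ∃ (r : Fin s → Fin n → D) (T : Fin s → Fin n),
          (∀ a, ∑ j, r a j • (⟨p j, hp j⟩ : stableModule D E hDE) = 0) ∧
            x = Matrix.det (Matrix.of fun a b => r a (T b))}).restrictScalars k).map
          D.val.toLinearMap := by
      refine Submodule.mul_le.2 fun x hx y hy => ?_
      obtain ⟨z, hz, hzy⟩ : y ∈ ((Ideal.span {x : D | ∃ (r : Fin s → Fin n → D)
          (T : Fin s → Fin n), (∀ a, ∑ j, r a j • (⟨p j, hp j⟩ : stableModule D E hDE) = 0) ∧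
            x = Matrix.det (Matrix.of fun a b => r a (T b))}).restrictScalars k).map
          D.val.toLinearMap := by
        refine Submodule.span_le.2 ?_ hy
        rintro _ ⟨r, T, hr, rfl⟩
        refine ⟨Matrix.det (Matrix.of fun a b => (⟨r a (T b), (hr a).1 _⟩ : D)),
          Ideal.subset_span ⟨fun a j => ⟨r a j, (hr a).1 j⟩, T, fun a => ?_, rfl⟩, ?_⟩
        · refine Subtype.ext ?_
          rw [AddSubmonoidClass.coe_finsetSum]
          exact (Submodule.mem_bot k).1 (hr a).2
        · change D.val _ = _
          rw [AlgHom.map_det]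
          rfl
      exact ⟨⟨x, hx⟩ * z, Ideal.mul_mem_left _ _ hz, by rw [← hzy]; rfl⟩
    obtain ⟨z, hz, hz1⟩ := hle hone
    have : z = 1 := Subtype.ext hz1
    exact (Ideal.eq_top_iff_one _).2 (this ▸ hz)
  · intro r T hr
    have h0 : Matrix.det (Matrix.of fun a b => ((r a (T b) : D) : A)) ∈
        minorSpan (Subalgebra.toSubmodule D) ⊥ p (s + 1) := by
      refine Submodule.subset_span ⟨fun a j => r a j, T, fun a => ⟨fun j => (r a j).2, ?_⟩, rfl⟩
      have := congrArg Subtype.val (hr a)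
      rw [AddSubmonoidClass.coe_finsetSum] at this
      exact (Submodule.mem_bot k).2 this
    rw [hs, Submodule.mem_bot] at h0
    refine Subtype.ext ?_
    change D.val _ = 0
    rw [AlgHom.map_det]
    exact h0
  · rw [eq_top_iff]
    rintro ⟨x, hx⟩ -
    have hx' := hDV hx
    rw [← hspan] at hx'
    obtain ⟨c, hc, hcx⟩ := mem_mul_span_range hx'
    rw [Submodule.mem_span_range_iff_exists_fun]
    refine ⟨fun j => ⟨c j, hc j⟩, Subtype.ext ?_⟩
    rw [AddSubmonoidClass.coe_finsetSum]
    exact hcx.symm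

/-- The ideal `D ∩ C⁺ A` of `D`. -/
def augIdeal (C D : Subalgebra k A) : Ideal D where
  carrier := {d | (d : A) ∈ augSpan C}
  add_mem' := fun ha hb => (augSpan C).add_mem ha hb
  zero_mem' := zero_mem (augSpan C)
  smul_mem' c _ hx := mul_mem_augSpan (c : A) hx

theorem mem_augIdeal {C D : Subalgebra k A} {d : D} :
    d ∈ augIdeal C D ↔ (d : A) ∈ augSpan C := Iff.rfl

/-- The quotient of `D` by `D ∩ C⁺ A` is the image of `D` modulo `C⁺ A`. -/
def quotientAugIdealEquiv (C D : Subalgebra k A) :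
    (D ⧸ augIdeal C D) ≃ₗ[k] (Subalgebra.toSubmodule D).map (augSpan C).mkQ :=
  (Submodule.Quotient.restrictScalarsEquiv k (augIdeal C D)).symm ≪≫ₗ
    Submodule.quotEquivOfEq _ _ (by
      ext d
      rw [LinearMap.mem_ker, LinearMap.comp_apply, Submodule.mkQ_apply,
        Submodule.Quotient.mk_eq_zero, Submodule.restrictScalars_mem]
      exact mem_augIdeal) ≪≫ₗ
    ((augSpan C).mkQ ∘ₗ (Subalgebra.toSubmodule D).subtype).quotKerEquivRange ≪≫ₗ
    LinearEquiv.ofEq _ _ (by rw [LinearMap.range_comp, Submodule.range_subtype])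

/-- The quotient of `E` by `C⁺ E` is the image of `E` modulo `C⁺ A`. -/
def quotientStableEquiv {C D : Subalgebra k A} {E : Submodule k A} (hC : IsHopfSubalgebra C)
    (hCD : C ≤ D) (hE : IsLeftCoideal E) (hDE : Subalgebra.toSubmodule D * E ≤ E) :
    (stableModule D E hDE ⧸ (augIdeal C D • ⊤ : Submodule D (stableModule D E hDE))) ≃ₗ[k]
      E.map (augSpan C).mkQ :=
  (Submodule.Quotient.restrictScalarsEquiv k
      (augIdeal C D • ⊤ : Submodule D (stableModule D E hDE))).symm ≪≫ₗ
    Submodule.quotEquivOfEq _ _ (by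
      ext x
      rw [LinearMap.mem_ker, LinearMap.comp_apply, Submodule.mkQ_apply,
        Submodule.Quotient.mk_eq_zero, Submodule.restrictScalars_mem]
      constructor
      · intro hx
        refine Submodule.smul_induction_on hx (fun c hc y _ => ?_) (fun y z hy hz => ?_)
        · change (c : A) * (y : A) ∈ augSpan C
          rw [mul_comm]
          exact mul_mem_augSpan _ (mem_augIdeal.1 hc)
        · exact add_mem hy hz
      · intro hx
        have h := mem_augPart_mul_of_mem_augSpan hC hE x.2 hx
        have hle : ∀ y ∈ augPart C * E, ∃ hy : y ∈ E,
            (⟨y, hy⟩ : stableModule D E hDE) ∈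
              (augIdeal C D • ⊤ : Submodule D (stableModule D E hDE)) := by
          intro y hy
          induction hy using Submodule.mul_induction_on' with
          | mem_mul_mem m hm n hn =>
            exact ⟨hDE (Submodule.mul_mem_mul (hCD hm.1) hn),
              Submodule.smul_mem_smul (r := (⟨m, hCD hm.1⟩ : D))
                (n := (⟨n, hn⟩ : stableModule D E hDE))
                (mem_augIdeal.2 (augPart_le_augSpan C hm)) Submodule.mem_top⟩
          | add x _ y _ hx hy =>
            obtain ⟨h1, h2⟩ := hx
            obtain ⟨g1, g2⟩ := hy
            exact ⟨add_mem h1 g1, add_mem h2 g2⟩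
        exact (hle _ h).2) ≪≫ₗ
    ((augSpan C).mkQ ∘ₗ (stableModule D E hDE).subtype.restrictScalars k).quotKerEquivRange ≪≫ₗ
    LinearEquiv.ofEq _ _ (by
      rw [LinearMap.range_comp]
      congr 1
      ext x
      exact ⟨fun ⟨y, hy⟩ => hy ▸ y.2, fun hx => ⟨⟨x, hx⟩, rfl⟩⟩)

/-- Multiplicativity of the index in towers of Hopf subalgebras. -/
theorem hopfIndex_mul {C D E : Subalgebra k A} (hC : IsHopfSubalgebra C)
    (hD : IsHopfSubalgebra D) (hE : IsHopfSubalgebra E) (hCD : C ≤ D) (hDE : D ≤ E) :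
    hopfIndex C (Subalgebra.toSubmodule E) =
      hopfIndex C (Subalgebra.toSubmodule D) * hopfIndex D (Subalgebra.toSubmodule E) := by
  have hD0 : hopfIndex C (Subalgebra.toSubmodule D) ≠ 0 := hopfIndex_ne_zero D.one_mem
  have hE0 : hopfIndex D (Subalgebra.toSubmodule E) ≠ 0 := hopfIndex_ne_zero E.one_mem
  by_cases h1 : hopfIndex D (Subalgebra.toSubmodule E) = ⊤
  · have := hopfIndex_anti hCD (Subalgebra.toSubmodule E)
    rw [h1, top_le_iff] at this
    rw [this, h1, ENat.mul_top hD0]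
  by_cases h2 : hopfIndex C (Subalgebra.toSubmodule D) = ⊤
  · have := hopfIndex_mono (C := C)
      (show Subalgebra.toSubmodule D ≤ Subalgebra.toSubmodule E from hDE)
    rw [h2, top_le_iff] at this
    rw [this, h2, ENat.top_mul hE0]
  have hst : Subalgebra.toSubmodule D * Subalgebra.toSubmodule E ≤ Subalgebra.toSubmodule E :=
    Submodule.mul_le.2 fun _ hx _ hy => E.mul_mem (hDE hx) hy
  obtain ⟨n, s, p, hp⟩ := exists_isFittingOfRank hD hE.isLeftCoideal hst h1
  have h3 : ∀ C' : Subalgebra k A, IsHopfSubalgebra C' → C' ≤ D →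
      hopfIndex C' (Subalgebra.toSubmodule D) ≠ ⊤ →
      hopfIndex C' (Subalgebra.toSubmodule E) =
        ((n - s : ℕ) : ℕ∞) * hopfIndex C' (Subalgebra.toSubmodule D) := by
    intro C' hC' hCD' hfin
    have := finite_of_toENat_rank_ne_top hfin
    have : FiniteDimensional k (D ⧸ augIdeal C' D) :=
      Module.Finite.equiv (quotientAugIdealEquiv C' D).symm
    have hE' := quotientStableEquiv hC' hCD' hE.isLeftCoideal hst
    have hp1 := hp.finrank_quotient (k := k) (augIdeal C' D)
    have := hp.finite_quotient (k := k) (augIdeal C' D)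
    have := Module.Finite.equiv hE'
    rw [hopfIndex, hopfIndex, toENat_rank_of_finite, toENat_rank_of_finite, ← hE'.finrank_eq, hp1,
      (quotientAugIdealEquiv C' D).finrank_eq, Nat.cast_mul]
  have h4 := h3 D hD le_rfl (by rw [hopfIndex_self]; exact ENat.one_ne_top)
  rw [hopfIndex_self, mul_one] at h4
  rw [h3 C hC hCD h2, h4, mul_comm]

end Index

/-! ### Points of affine group schemes -/

section Points

variable {k A B R R' : Type*} [Field k] [CommRing A] [HopfAlgebra k A] [CommRing B]
  [HopfAlgebra k B] [CommRing R] [Algebra k R] [CommRing R'] [Algebra k R']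

instance pointsInv : Inv (WithConv (A →ₐ[k] R)) where
  inv g := toConv (g.ofConv.comp (HopfAlgebra.antipodeAlgHom k A))

/-- The group of `R`-points of the affine group scheme `Spec A`. -/
instance pointsGroup : Group (WithConv (A →ₐ[k] R)) where
  inv_mul_cancel g := by
    have h : toConv (g.ofConv.comp (HopfAlgebra.antipodeAlgHom k A)) * g =
        toConv (g.ofConv.comp (toConv (HopfAlgebra.antipodeAlgHom k A) *
          toConv (AlgHom.id k A)).ofConv) := by
      rw [AlgHom.comp_convMul_distrib]
      rfl
    refine h.trans ?_
    rw [AlgHom.antipode_id_cancel]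
    apply WithConv.ofConv_injective
    ext x
    exact AlgHom.commutes g.ofConv _

variable (k R R') in
/-- The inclusion `R → R ⊗ R'` of the left factor. -/
abbrev tensorLeft : R →ₐ[k] R ⊗[k] R' := Algebra.TensorProduct.includeLeft

variable (k R R') in
/-- The inclusion `R' → R ⊗ R'` of the right factor. -/
abbrev tensorRight : R' →ₐ[k] R ⊗[k] R' := Algebra.TensorProduct.includeRight

theorem point_inv_apply (g : WithConv (A →ₐ[k] R)) (x : A) :
    g⁻¹ x = g (HopfAlgebra.antipode k x) := rfl

theorem point_one_apply (x : A) :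
    (1 : WithConv (A →ₐ[k] R)) x = algebraMap k R (counit x) := rfl

theorem point_mul_apply (g h : WithConv (A →ₐ[k] R)) (x : A) :
    (g * h) x = Algebra.TensorProduct.lift g.ofConv h.ofConv (fun _ _ => Commute.all _ _)
      (comul x) := AlgHom.convMul_apply g h x

/-- The group homomorphism `G(R) → G(R')` induced by `R → R'`. -/
def mapPoint (φ : R →ₐ[k] R') : WithConv (A →ₐ[k] R) →* WithConv (A →ₐ[k] R') where
  toFun g := toConv (φ.comp g.ofConv)
  map_one' := by
    apply WithConv.ofConv_injective
    ext x
    exact AlgHom.commutes φ _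
  map_mul' g h := by
    rw [AlgHom.comp_convMul_distrib]

theorem mapPoint_apply (φ : R →ₐ[k] R') (g : WithConv (A →ₐ[k] R)) (x : A) :
    mapPoint φ g x = φ (g x) := rfl

/-- The group homomorphism `H(R) → G(R)` dual to a morphism `f : k[G] → k[H]`. -/
def comapPoint (f : A →ₐc[k] B) : WithConv (B →ₐ[k] R) →* WithConv (A →ₐ[k] R) where
  toFun g := toConv (g.ofConv.comp (f : A →ₐ[k] B))
  map_one' := by
    apply WithConv.ofConv_injective
    ext x
    change algebraMap k R (counit (f x)) = algebraMap k R (counit x)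
    rw [CoalgHomClass.counit_comp_apply]
  map_mul' g h := by
    rw [AlgHom.convMul_comp_bialgHom_distrib]

theorem comapPoint_apply (f : A →ₐc[k] B) (g : WithConv (B →ₐ[k] R)) (x : A) :
    comapPoint f g x = g (f x) := rfl

theorem mapPoint_comapPoint (f : A →ₐc[k] B) (φ : R →ₐ[k] R') (g : WithConv (B →ₐ[k] R)) :
    mapPoint φ (comapPoint f g) = comapPoint f (mapPoint φ g) := rfl

/-- The morphism `u ⊗ v` out of a tensor product of commutative algebras. -/
def tensorLift {S : Type*} [CommRing S] [Algebra k S] (u : R →ₐ[k] S) (v : R' →ₐ[k] S) :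
    R ⊗[k] R' →ₐ[k] S :=
  Algebra.TensorProduct.lift u v (fun _ _ => Commute.all _ _)

theorem tensorLift_tmul {S : Type*} [CommRing S] [Algebra k S] (u : R →ₐ[k] S) (v : R' →ₐ[k] S)
    (a : R) (b : R') : tensorLift u v (a ⊗ₜ b) = u a * v b :=
  Algebra.TensorProduct.lift_tmul _ _ _ _ _

theorem tensorLift_left {S : Type*} [CommRing S] [Algebra k S] (u : R →ₐ[k] S) (v : R' →ₐ[k] S) :
    (tensorLift u v).comp (tensorLeft k R R') = u := by
  ext a
  exact (tensorLift_tmul u v a 1).trans (by rw [map_one, mul_one])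

theorem tensorLift_right {S : Type*} [CommRing S] [Algebra k S] (u : R →ₐ[k] S)
    (v : R' →ₐ[k] S) : (tensorLift u v).comp (tensorRight k R R') = v := by
  ext a
  exact (tensorLift_tmul u v 1 a).trans (by rw [map_one, one_mul])

theorem map_eq_tensorLift {S S' : Type*} [CommRing S] [Algebra k S] [CommRing S'] [Algebra k S']
    (u : R →ₐ[k] S) (v : R' →ₐ[k] S') : Algebra.TensorProduct.map u v =
      tensorLift ((tensorLeft k S S').comp u) ((tensorRight k S S').comp v) := by
  ext a
  · rw [tensorLift_left]
    simp
  · have := tensorLift_right ((tensorLeft k S S').comp u) ((tensorRight k S S').comp v)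
    exact (by simp : _ = tensorRight k S S' (v a)).trans (DFunLike.congr_fun this a).symm

/-- `(g · w)(x) = (id ⊗ w)(Δ x)` for the universal point `g`. -/
theorem includeLeft_mul_apply (w : A →ₐ[k] R) (x : A) :
    (toConv (tensorLeft k A R) * toConv ((tensorRight k A R).comp w) :
      WithConv (A →ₐ[k] A ⊗[k] R)) x =
      LinearMap.lTensor A w.toLinearMap (comul x) := by
  rw [point_mul_apply]
  generalize (comul x : A ⊗[k] A) = t
  induction t using TensorProduct.induction_on with
  | zero => simp
  | add x y hx hy => simp only [map_add, hx, hy]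
  | tmul a b => simp

/-- `(w · g)(x) = (w ⊗ id)(Δ x)` for the universal point `g`. -/
theorem mul_includeRight_apply (w : A →ₐ[k] R) (x : A) :
    (toConv ((tensorLeft k R A).comp w) * toConv (tensorRight k R A) :
      WithConv (A →ₐ[k] R ⊗[k] A)) x =
      LinearMap.rTensor A w.toLinearMap (comul x) := by
  rw [point_mul_apply]
  generalize (comul x : A ⊗[k] A) = t
  induction t using TensorProduct.induction_on with
  | zero => simp
  | add x y hx hy => simp only [map_add, hx, hy]
  | tmul a b => simp

theorem point_mul_apply_mem {E : Subalgebra k A} (hE : IsHopfSubalgebra E) {P : Subalgebra k R}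
    {g h : WithConv (A →ₐ[k] R)} (hg : ∀ x ∈ E, g x ∈ P) (hh : ∀ x ∈ E, h x ∈ P) {x : A}
    (hx : x ∈ E) : (g * h) x ∈ P := by
  obtain ⟨n, a, b, ha, hb, h'⟩ := exists_sum_tmul_of_mem_range_map (hE.comul_mem x hx)
  rw [point_mul_apply, h', map_sum]
  refine P.sum_mem fun i _ => ?_
  rw [Algebra.TensorProduct.lift_tmul]
  exact P.mul_mem (hg _ (ha i)) (hh _ (hb i))

theorem point_inv_apply_mem {E : Subalgebra k A} (hE : IsHopfSubalgebra E) {P : Subalgebra k R}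
    {g : WithConv (A →ₐ[k] R)} (hg : ∀ x ∈ E, g x ∈ P) {x : A} (hx : x ∈ E) : g⁻¹ x ∈ P :=
  hg _ (hE.antipode_mem x hx)

theorem IsComatrix.map_mul {ι : Type*} [Fintype ι] [DecidableEq ι] {p : ι → A} {a : Matrix ι ι A}
    (ha : IsComatrix (k := k) p a) (g h : WithConv (A →ₐ[k] R)) (j i : ι) :
    (g * h) (a j i) = ∑ l, g (a j l) * h (a l i) := by
  rw [point_mul_apply, ha.comul_entry, map_sum]
  exact Finset.sum_congr rfl fun l _ => Algebra.TensorProduct.lift_tmul _ _ _ _ _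

/-- The comultiplication is the product of the two universal points. -/
theorem comul_point :
    (toConv (Bialgebra.comulAlgHom k A) : WithConv (A →ₐ[k] A ⊗[k] A)) =
      toConv (tensorLeft k A A) * toConv (tensorRight k A A) := by
  apply WithConv.ofConv_injective
  ext b
  change comul b = _
  rw [point_mul_apply]
  generalize (comul b : A ⊗[k] A) = t
  induction t using TensorProduct.induction_on with
  | zero => simp
  | add x y hx hy => rw [map_add, ← hx, ← hy]
  | tmul a c => simp

end Points

/-! ### Normal subgroups and their left invariants -/

section Normal

variable {k A B : Type u} [Field k] [CommRing A] [HopfAlgebra k A] [CommRing B]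
  [HopfAlgebra k B]

/-- `f : k[G] → k[N]` is dual to the inclusion of a subgroup scheme which is normal: conjugates of
points of `N` by points of `G` are points of `N`. -/
def IsNormalHom (f : A →ₐc[k] B) : Prop :=
  ∀ (R : Type u) [CommRing R] [Algebra k R] (g : WithConv (A →ₐ[k] R)) (ν : WithConv (B →ₐ[k] R)),
    ∃ ν' : WithConv (B →ₐ[k] R), g * comapPoint f ν * g⁻¹ = comapPoint f ν'

/-- The left coaction `k[G] → k[N] ⊗ k[G]`, `x ↦ ((n, g) ↦ x (n g))`. -/
def leftCoaction (f : A →ₐc[k] B) : A →ₐ[k] B ⊗[k] A :=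
  (Algebra.TensorProduct.map (f : A →ₐ[k] B) (AlgHom.id k A)).comp (Bialgebra.comulAlgHom k A)

theorem leftCoaction_eq (f : A →ₐc[k] B) :
    toConv (leftCoaction f) =
      comapPoint f (toConv (tensorLeft k B A)) * toConv (tensorRight k B A) := by
  apply WithConv.ofConv_injective
  ext x
  exact (mul_includeRight_apply (f : A →ₐ[k] B) x).symm

/-- The subalgebra of functions on `G` invariant under left translation by `N`. -/
def leftInvariants (f : A →ₐc[k] B) : Subalgebra k A :=
  AlgHom.equalizer (leftCoaction f) Algebra.TensorProduct.includeRight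

theorem mem_leftInvariants {f : A →ₐc[k] B} {x : A} :
    x ∈ leftInvariants f ↔ leftCoaction f x = 1 ⊗ₜ x := Iff.rfl

/-- A function is semi-invariant of weight `χ` if and only if it is so on points. -/
theorem leftCoaction_apply_eq_iff {f : A →ₐc[k] B} {x : A} {χ : B} :
    leftCoaction f x = χ ⊗ₜ x ↔
      ∀ (R : Type u) [CommRing R] [Algebra k R] (ν : WithConv (B →ₐ[k] R))
        (y : WithConv (A →ₐ[k] R)), (comapPoint f ν * y) x = ν χ * y x := by
  constructor
  · intro h R _ _ ν y
    have h1 : comapPoint f ν * y =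
        mapPoint (tensorLift ν.ofConv y.ofConv) (toConv (leftCoaction f)) := by
      rw [leftCoaction_eq, map_mul, mapPoint_comapPoint]
      congr 1
      · congr 1
        exact congrArg toConv (tensorLift_left _ _).symm
      · exact congrArg toConv (tensorLift_right _ _).symm
    rw [h1, mapPoint_apply]
    change tensorLift ν.ofConv y.ofConv (leftCoaction f x) = _
    rw [h, tensorLift_tmul]
  · intro h
    have := h (B ⊗[k] A) (toConv (tensorLeft k B A)) (toConv (tensorRight k B A))
    rw [← leftCoaction_eq] at this
    refine this.trans ?_
    change (χ ⊗ₜ[k] (1 : A)) * ((1 : B) ⊗ₜ[k] x) = _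
    simp

theorem mem_leftInvariants_iff {f : A →ₐc[k] B} {x : A} :
    x ∈ leftInvariants f ↔
      ∀ (R : Type u) [CommRing R] [Algebra k R] (ν : WithConv (B →ₐ[k] R))
        (y : WithConv (A →ₐ[k] R)), (comapPoint f ν * y) x = y x := by
  rw [mem_leftInvariants, leftCoaction_apply_eq_iff]
  refine forall_congr' fun R => forall_congr' fun _ => forall_congr' fun _ =>
    forall_congr' fun ν => forall_congr' fun y => ?_
  have : ν 1 = 1 := map_one ν.ofConv
  rw [this, one_mul]

theorem leftCoaction_sliceRight {f : A →ₐc[k] B} {M : Type*} [AddCommGroup M] [Module k M]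
    (β : Module.Dual k M) (t : A ⊗[k] M) :
    leftCoaction f (sliceRight β t) =
      sliceRight β (LinearMap.rTensor M (leftCoaction f).toLinearMap t) := by
  rw [sliceRight_rTensor]
  rfl

/-- Right translates of semi-invariants are semi-invariants of the same weight. -/
theorem leftCoaction_sliceRight_comul {f : A →ₐc[k] B} {x : A} {χ : B}
    (hx : leftCoaction f x = χ ⊗ₜ x) (β : Module.Dual k A) :
    leftCoaction f (sliceRight β (comul x)) = χ ⊗ₜ sliceRight β (comul x) := by
  rw [leftCoaction_sliceRight, ← mul_includeRight_apply]
  have h1 : toConv ((tensorLeft k (B ⊗[k] A) A).comp (leftCoaction f)) =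
      mapPoint (tensorLeft k (B ⊗[k] A) A) (toConv (leftCoaction f)) := rfl
  rw [h1, leftCoaction_eq, map_mul, mul_assoc, mapPoint_comapPoint,
    leftCoaction_apply_eq_iff.1 hx]
  have h2 : ∀ t : A ⊗[k] A, sliceRight β ((((χ ⊗ₜ[k] (1 : A)) ⊗ₜ[k] (1 : A)) :
      (B ⊗[k] A) ⊗[k] A) * LinearMap.rTensor A
        (tensorRight k B A).toLinearMap t) =
      χ ⊗ₜ sliceRight β t := by
    intro t
    induction t using TensorProduct.induction_on with
    | zero => simp
    | add x y hx hy => simp only [map_add, mul_add, TensorProduct.tmul_add, hx, hy]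
    | tmul a b => simp
  rw [← h2, ← mul_includeRight_apply]
  rfl

variable {f : A →ₐc[k] B}

theorem IsNormalHom.conj_inv (hf : IsNormalHom f) {R : Type u} [CommRing R] [Algebra k R]
    (g : WithConv (A →ₐ[k] R)) (ν : WithConv (B →ₐ[k] R)) :
    ∃ ν' : WithConv (B →ₐ[k] R), g⁻¹ * comapPoint f ν * g = comapPoint f ν' := by
  obtain ⟨ν', h⟩ := hf R g⁻¹ ν
  exact ⟨ν', by rw [← h, inv_inv]⟩

/-- The invariants of a normal subgroup form a Hopf subalgebra. -/
theorem IsNormalHom.isHopfSubalgebra (hf : IsNormalHom f) :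
    IsHopfSubalgebra (leftInvariants f) where
  comul_mem x hx := by
    refine mem_range_map_of_slices (fun β => ?_) fun φ => ?_
    · rw [Subalgebra.mem_toSubmodule, mem_leftInvariants, leftCoaction_sliceRight_comul hx]
    · rw [Subalgebra.mem_toSubmodule, mem_leftInvariants]
      have h1 : leftCoaction f (sliceLeft φ (comul x)) =
          sliceLeft φ (LinearMap.lTensor A (leftCoaction f).toLinearMap (comul x)) := by
        rw [sliceLeft_lTensor]
        rfl
      have h2 : (1 : B) ⊗ₜ[k] sliceLeft φ (comul x) = sliceLeft φ (LinearMap.lTensor A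
          (tensorRight k B A).toLinearMap (comul x)) := by
        rw [sliceLeft_lTensor]
        rfl
      rw [h1, h2, ← includeLeft_mul_apply, ← includeLeft_mul_apply]
      congr 1
      have h3 : toConv ((tensorRight k A (B ⊗[k] A)).comp (leftCoaction f)) =
          mapPoint (tensorRight k A (B ⊗[k] A)) (toConv (leftCoaction f)) := rfl
      rw [h3, leftCoaction_eq, map_mul, mapPoint_comapPoint, ← mul_assoc]
      obtain ⟨ν', hν⟩ := hf _ (toConv (tensorLeft k A (B ⊗[k] A)))
        (mapPoint (tensorRight k A (B ⊗[k] A)) (toConv (tensorLeft k B A)))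
      rw [mul_inv_eq_iff_eq_mul] at hν
      rw [hν, mul_assoc]
      exact mem_leftInvariants_iff.1 hx _ ν' _
  antipode_mem x hx := by
    rw [mem_leftInvariants_iff] at hx ⊢
    intro R _ _ ν y
    rw [← point_inv_apply, ← point_inv_apply, mul_inv_rev, ← map_inv]
    obtain ⟨ν', hν⟩ := hf.conj_inv y ν⁻¹
    rw [← eq_mul_inv_iff_mul_eq] at hν
    rw [hν, hx]

end Normal

/-! ### Semi-invariants of normal subgroups -/

/-- A prime ideal of an Artinian ring is associated to the ring. -/
theorem exists_ne_zero_forall_mul_eq_zero {F : Type*} [CommRing F] [IsArtinianRing F] (m : Ideal F)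
    [m.IsPrime] : ∃ e : F, e ≠ 0 ∧ ∀ a ∈ m, a * e = 0 := by
  have hm : m ∈ (Module.annihilator F F).minimalPrimes := by
    refine ⟨⟨inferInstance, ?_⟩, fun q hq hqm => ?_⟩
    · intro x hx
      have := Module.mem_annihilator.1 hx 1
      rw [smul_eq_mul, mul_one] at this
      rw [this]
      exact zero_mem _
    · have := hq.1
      exact ((IsArtinianRing.isMaximal_of_isPrime q).eq_of_le
        (Ideal.IsPrime.ne_top ‹m.IsPrime›) hqm).ge
  obtain ⟨-, e, he⟩ := isAssociatedPrime_iff.1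
    (Module.associatedPrimes.minimalPrimes_annihilator_subset_associatedPrimes F F hm)
  refine ⟨e, ?_, fun a ha => ?_⟩
  · rintro rfl
    refine (Ideal.IsPrime.ne_top ‹m.IsPrime›) (he.trans ?_)
    rw [eq_top_iff]
    intro x _
    simp [Submodule.mem_colon_singleton]
  · rw [he, Submodule.mem_colon_singleton] at ha
    simpa using ha

section SemiInvariants

variable {k A B : Type u} [Field k] [CommRing A] [HopfAlgebra k A] [CommRing B]
  [HopfAlgebra k B] {f : A →ₐc[k] B}

/-- Slices of products along a coproduct. -/
theorem sliceRight_mul_sliceRight {M : Type*} [CommRing M] [Algebra k M]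
    (β γ : Module.Dual k B) (s t : M ⊗[k] B) :
    sliceRight β s * sliceRight γ t =
      sliceRight (LinearMap.mul' k k ∘ₗ TensorProduct.map β γ)
        ((Algebra.TensorProduct.map (AlgHom.id k M) (tensorLeft k B B)) s *
          (Algebra.TensorProduct.map (AlgHom.id k M) (tensorRight k B B)) t) := by
  induction s using TensorProduct.induction_on with
  | zero => simp
  | add x y hx hy => simp only [map_add, add_mul, hx, hy]
  | tmul a b =>
    induction t using TensorProduct.induction_on with
    | zero => simp
    | add x y hx hy => simp only [map_add, mul_add, hx, hy]
    | tmul c d => simp [smul_smul, mul_comm]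

/-- The weight of a semi-invariant `D`, conjugated: the function `(g, n) ↦ D (g⁻¹ n g)`. -/
def conjWeight (f : A →ₐc[k] B) (D : A) : A ⊗[k] B :=
  ((toConv (tensorLeft k A B))⁻¹ * comapPoint f (toConv (tensorRight k A B)) *
    toConv (tensorLeft k A B) : WithConv (A →ₐ[k] A ⊗[k] B)) D

theorem tensorLift_conjWeight {R : Type*} [CommRing R] [Algebra k R] (D : A)
    (g : WithConv (A →ₐ[k] R)) (ν : WithConv (B →ₐ[k] R)) :
    tensorLift g.ofConv ν.ofConv (conjWeight f D) = (g⁻¹ * comapPoint f ν * g) D := by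
  rw [conjWeight, ← mapPoint_apply, map_mul, map_mul, map_inv, mapPoint_comapPoint]
  have h1 : mapPoint (tensorLift g.ofConv ν.ofConv) (toConv (tensorLeft k A B)) = g :=
    congrArg toConv (tensorLift_left _ _)
  have h2 : mapPoint (tensorLift g.ofConv ν.ofConv) (toConv (tensorRight k A B)) = ν :=
    congrArg toConv (tensorLift_right _ _)
  rw [h1, h2]

/-- `D` is semi-invariant under left translation by `N`, with weight `D|_N`, and `D (1) = 1`. -/
structure IsNormalizedSemiInvariant (f : A →ₐc[k] B) (D : A) : Prop where
  coaction : leftCoaction f D = f D ⊗ₜ D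
  counit_eq : counit (R := k) D = 1

namespace IsNormalizedSemiInvariant

variable {D : A} {R : Type u} [CommRing R] [Algebra k R]

theorem mul_apply (hD : IsNormalizedSemiInvariant f D) (ν : WithConv (B →ₐ[k] R))
    (y : WithConv (A →ₐ[k] R)) : (comapPoint f ν * y) D = comapPoint f ν D * y D :=
  leftCoaction_apply_eq_iff.1 hD.coaction R ν y

theorem one_apply (hD : IsNormalizedSemiInvariant f D) :
    (1 : WithConv (A →ₐ[k] R)) D = 1 := by
  rw [point_one_apply, hD.counit_eq, map_one]

theorem conj_mul (hf : IsNormalHom f) (hD : IsNormalizedSemiInvariant f D)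
    (g y : WithConv (A →ₐ[k] R)) (ν : WithConv (B →ₐ[k] R)) :
    (g⁻¹ * comapPoint f ν * g * y) D = (g⁻¹ * comapPoint f ν * g) D * y D := by
  obtain ⟨ν', h⟩ := hf.conj_inv g ν
  rw [h, hD.mul_apply]

theorem conj_mul_distrib (hf : IsNormalHom f) (hD : IsNormalizedSemiInvariant f D)
    (g : WithConv (A →ₐ[k] R)) (ν ν' : WithConv (B →ₐ[k] R)) :
    (g⁻¹ * comapPoint f (ν * ν') * g) D =
      (g⁻¹ * comapPoint f ν * g) D * (g⁻¹ * comapPoint f ν' * g) D := by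
  rw [← hD.conj_mul hf, map_mul]
  congr 1
  group

theorem mul_inv_apply (hD : IsNormalizedSemiInvariant f D) (ν : WithConv (B →ₐ[k] R)) :
    comapPoint f ν D * comapPoint f ν⁻¹ D = 1 := by
  rw [← hD.mul_apply, ← map_mul, mul_inv_cancel, map_one, hD.one_apply]

theorem conj_conj (hf : IsNormalHom f) (hD : IsNormalizedSemiInvariant f D)
    (g : WithConv (A →ₐ[k] R)) (ν ν' : WithConv (B →ₐ[k] R)) :
    ((comapPoint f ν' * g)⁻¹ * comapPoint f ν * (comapPoint f ν' * g)) D =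
      (g⁻¹ * comapPoint f ν * g) D := by
  have h1 : (comapPoint f ν' * g)⁻¹ * comapPoint f ν * (comapPoint f ν' * g) =
      g⁻¹ * comapPoint f (ν'⁻¹ * ν * ν') * g := by
    rw [map_mul, map_mul, map_inv]
    group
  have h2 : (g⁻¹ * comapPoint f ν'⁻¹ * g) D * (g⁻¹ * comapPoint f ν' * g) D = 1 := by
    rw [← hD.conj_mul_distrib hf, inv_mul_cancel, map_one, mul_one, inv_mul_cancel, hD.one_apply]
  rw [h1, hD.conj_mul_distrib hf, hD.conj_mul_distrib hf, mul_right_comm, h2, one_mul]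

theorem inv_mul_eq (ν : WithConv (B →ₐ[k] R)) (y z : WithConv (A →ₐ[k] R)) :
    (comapPoint f ν * y)⁻¹ * z = y⁻¹ * comapPoint f ν⁻¹ * y * (y⁻¹ * z) := by
  rw [map_inv]
  group

theorem lTensor_comul_conjWeight (hf : IsNormalHom f) (hD : IsNormalizedSemiInvariant f D) :
    LinearMap.lTensor A comul (conjWeight f D) =
      (Algebra.TensorProduct.map (AlgHom.id k A) (tensorLeft k B B)) (conjWeight f D) *
        (Algebra.TensorProduct.map (AlgHom.id k A) (tensorRight k B B)) (conjWeight f D) := by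
  have key : ∀ w : B →ₐ[k] B ⊗[k] B,
      Algebra.TensorProduct.map (AlgHom.id k A) w (conjWeight f D) =
        ((toConv (tensorLeft k A (B ⊗[k] B)))⁻¹ *
          comapPoint f (mapPoint (tensorRight k A (B ⊗[k] B)) (toConv w)) *
          toConv (tensorLeft k A (B ⊗[k] B)) : WithConv (A →ₐ[k] A ⊗[k] (B ⊗[k] B))) D := by
    intro w
    rw [← tensorLift_conjWeight, map_eq_tensorLift]
    rfl
  have h1 : LinearMap.lTensor A comul (conjWeight f D) =
      Algebra.TensorProduct.map (AlgHom.id k A) (Bialgebra.comulAlgHom k B) (conjWeight f D) := rfl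
  rw [h1, key, key, key, ← hD.conj_mul_distrib hf, ← map_mul, ← comul_point]

/-- The algebra spanned by the functions `g ↦ χ (g⁻¹ n g)`, for the weight `χ` of `D`. -/
def weightAlgebra (hf : IsNormalHom f) (hD : IsNormalizedSemiInvariant f D) : Subalgebra k A :=
  (LinearMap.range ((TensorProduct.rid k A).toLinearMap ∘ₗ
    LinearMap.applyₗ (conjWeight f D) ∘ₗ LinearMap.lTensorHom A)).toSubalgebra
    ⟨counit, by
      change sliceRight counit (conjWeight f D) = 1
      have h1 : ∀ t : A ⊗[k] B, sliceRight (counit : B →ₗ[k] k) t =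
          tensorLift (AlgHom.id k A) (1 : WithConv (B →ₐ[k] A)).ofConv t := by
        intro t
        induction t using TensorProduct.induction_on with
        | zero => simp
        | add x y hx hy => simp only [map_add, hx, hy]
        | tmul a b =>
          rw [tensorLift_tmul, sliceRight_tmul, Algebra.smul_def, mul_comm]
          rfl
      rw [h1, ← ofConv_toConv (AlgHom.id k A), tensorLift_conjWeight, map_one, mul_one,
        inv_mul_cancel, hD.one_apply]⟩
    (by
      rintro _ _ ⟨β, rfl⟩ ⟨γ, rfl⟩
      refine ⟨LinearMap.mul' k k ∘ₗ TensorProduct.map β γ ∘ₗ comul, ?_⟩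
      change sliceRight (LinearMap.mul' k k ∘ₗ TensorProduct.map β γ ∘ₗ comul) (conjWeight f D) =
        sliceRight β (conjWeight f D) * sliceRight γ (conjWeight f D)
      rw [sliceRight_mul_sliceRight, ← hD.lTensor_comul_conjWeight hf]
      generalize conjWeight f D = t
      induction t using TensorProduct.induction_on with
      | zero => simp
      | add x y hx hy => simp only [map_add, hx, hy]
      | tmul a b => simp)

theorem finite_weightAlgebra (hf : IsNormalHom f) (hD : IsNormalizedSemiInvariant f D) :
    FiniteDimensional k (hD.weightAlgebra hf) := by
  obtain ⟨n, e, e', he⟩ := exists_sum_sliceLeft (fun _ : Unit => conjWeight f D)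
  have hle : Subalgebra.toSubmodule (hD.weightAlgebra hf) ≤ Submodule.span k (Set.range e) := by
    rintro _ ⟨β, rfl⟩
    change sliceRight β (conjWeight f D) ∈ _
    rw [he (), map_sum]
    refine Submodule.sum_mem _ fun i _ => ?_
    rw [sliceRight_tmul]
    exact Submodule.smul_mem _ _ (Submodule.subset_span ⟨i, rfl⟩)
  have : FiniteDimensional k (Submodule.span k (Set.range e)) :=
    FiniteDimensional.span_of_finite k (Set.finite_range _)
  exact Submodule.finiteDimensional_of_le hle

theorem weightAlgebra_le_leftInvariants (hf : IsNormalHom f)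
    (hD : IsNormalizedSemiInvariant f D) : hD.weightAlgebra hf ≤ leftInvariants f := by
  rintro _ ⟨β, rfl⟩
  change sliceRight β (conjWeight f D) ∈ _
  have key : ∀ w : A →ₐ[k] B ⊗[k] A,
      LinearMap.rTensor B w.toLinearMap (conjWeight f D) =
        ((mapPoint (tensorLeft k (B ⊗[k] A) B) (toConv w))⁻¹ *
          comapPoint f (toConv (tensorRight k (B ⊗[k] A) B)) *
          mapPoint (tensorLeft k (B ⊗[k] A) B) (toConv w) :
            WithConv (A →ₐ[k] (B ⊗[k] A) ⊗[k] B)) D := by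
    intro w
    rw [← tensorLift_conjWeight]
    change Algebra.TensorProduct.map w (AlgHom.id k B) _ = _
    rw [map_eq_tensorLift]
    rfl
  rw [mem_leftInvariants, leftCoaction_sliceRight]
  have h1 : (1 : B) ⊗ₜ[k] sliceRight β (conjWeight f D) = sliceRight β
      (LinearMap.rTensor B (tensorRight k B A).toLinearMap (conjWeight f D)) := by
    rw [sliceRight_rTensor]
    rfl
  rw [h1, key, key, leftCoaction_eq, map_mul, mapPoint_comapPoint, hD.conj_conj hf]

/-- The slices of an element of `E ⊗ M ⊆ A ⊗ M` lie in `E`. -/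
theorem sliceRight_mem_of_mem_range {M : Type*} [CommRing M] [Algebra k M] {E : Subalgebra k A}
    {t : A ⊗[k] M}
    (ht : t ∈ (Algebra.TensorProduct.map E.val (AlgHom.id k M)).range) (β : Module.Dual k M) :
    sliceRight β t ∈ E := by
  obtain ⟨s, rfl⟩ := ht
  have : sliceRight β (LinearMap.rTensor M E.val.toLinearMap s) ∈ E := by
    rw [sliceRight_rTensor]
    exact (sliceRight β s).2
  exact this

theorem weightAlgebra_le (hf : IsNormalHom f) (hD : IsNormalizedSemiInvariant f D)
    {E : Subalgebra k A} (hE : IsHopfSubalgebra E) (hDE : D ∈ E) : hD.weightAlgebra hf ≤ E := by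
  rintro _ ⟨β, rfl⟩
  change sliceRight β (conjWeight f D) ∈ _
  refine sliceRight_mem_of_mem_range ?_ β
  have h1 : ∀ x ∈ E, (toConv (tensorLeft k A B) : WithConv (A →ₐ[k] A ⊗[k] B)) x ∈
      (Algebra.TensorProduct.map E.val (AlgHom.id k B)).range :=
    fun x hx => ⟨⟨x, hx⟩ ⊗ₜ 1, rfl⟩
  have h2 : ∀ x ∈ E, comapPoint f (toConv (tensorRight k A B)) x ∈
      (Algebra.TensorProduct.map E.val (AlgHom.id k B)).range :=
    fun x hx => ⟨1 ⊗ₜ f x, rfl⟩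
  exact point_mul_apply_mem hE (fun x hx => point_mul_apply_mem hE
    (fun x hx => point_inv_apply_mem hE h1 hx) h2 hx) h1 hDE

/-- Multiplication by a suitable nonzero invariant `e` makes all conjugates of the weight of `D`
equal: `e` is an element of the finite-dimensional `weightAlgebra` killed by its augmentation
ideal. -/
theorem exists_absorbing (hf : IsNormalHom f) (hD : IsNormalizedSemiInvariant f D)
    {E : Subalgebra k A} (hE : IsHopfSubalgebra E) (hDE : D ∈ E) :
    ∃ e ∈ E, e ∈ leftInvariants f ∧ e ≠ 0 ∧
      ∀ (R : Type u) [CommRing R] [Algebra k R] (g : WithConv (A →ₐ[k] R))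
        (ν : WithConv (B →ₐ[k] R)),
        g e * (g⁻¹ * comapPoint f ν * g) D = g e * comapPoint f ν D := by
  have := hD.finite_weightAlgebra hf
  have : IsArtinianRing (hD.weightAlgebra hf) := IsArtinianRing.of_finite k _
  let ε : hD.weightAlgebra hf →ₐ[k] k :=
    (Bialgebra.counitAlgHom k A).comp (hD.weightAlgebra hf).val
  have : (RingHom.ker ε).IsPrime := RingHom.ker_isPrime _
  obtain ⟨e, he0, he⟩ := exists_ne_zero_forall_mul_eq_zero (RingHom.ker ε)
  refine ⟨e, hD.weightAlgebra_le hf hE hDE e.2, hD.weightAlgebra_le_leftInvariants hf e.2,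
    fun h => he0 (Subtype.ext h), fun R _ _ g ν => ?_⟩
  have hcounit : ∀ β : Module.Dual k B,
      counit (R := k) (sliceRight β (conjWeight f D)) = β (f D) := by
    intro β
    have h1 : ∀ t : A ⊗[k] B, counit (R := k) (sliceRight β t) =
        β (tensorLift (1 : WithConv (A →ₐ[k] B)).ofConv (AlgHom.id k B) t) := by
      intro t
      induction t using TensorProduct.induction_on with
      | zero => simp
      | add x y hx hy => simp only [map_add, hx, hy]
      | tmul a b =>
        rw [tensorLift_tmul, sliceRight_tmul]
        change _ = β (algebraMap k B (counit a) * b)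
        rw [← Algebra.smul_def, map_smul, map_smul, smul_eq_mul, smul_eq_mul, mul_comm]
    rw [h1, ← ofConv_toConv (AlgHom.id k B), tensorLift_conjWeight, inv_one, one_mul, mul_one]
    rfl
  have h2 : ((e : A) ⊗ₜ[k] (1 : B)) * conjWeight f D = (e : A) ⊗ₜ f D := by
    refine eq_of_sliceRight fun β => ?_
    have h3 : ∀ t : A ⊗[k] B, sliceRight β (((e : A) ⊗ₜ[k] (1 : B)) * t) =
        e * sliceRight β t := by
      intro t
      induction t using TensorProduct.induction_on with
      | zero => simp
      | add x y hx hy => simp only [map_add, mul_add, hx, hy]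
      | tmul a b => simp
    let z : hD.weightAlgebra hf := ⟨sliceRight β (conjWeight f D), β, rfl⟩
    have h4 := he (z - algebraMap k _ (β (f D))) (by
      rw [RingHom.mem_ker, map_sub, AlgHom.commutes, sub_eq_zero]
      exact hcounit β)
    rw [sub_mul, sub_eq_zero] at h4
    have h5 : sliceRight β (conjWeight f D) * e = algebraMap k A (β (f D)) * e :=
      congrArg Subtype.val h4
    rw [h3, mul_comm, h5, sliceRight_tmul, Algebra.smul_def]
  have h6 := congrArg (tensorLift g.ofConv ν.ofConv) h2
  rw [map_mul, tensorLift_conjWeight, tensorLift_tmul, tensorLift_tmul, map_one, mul_one] at h6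
  exact h6

/-- There is a semi-invariant of weight inverse to that of `D`, namely a slice of the function
`(y, z) ↦ e(y) D(y⁻¹ z)` on `G × G`. Replacing `y` by `n y` multiplies `D(y⁻¹ z)` by the value at
`n⁻¹` of a conjugate of the weight, and the factor `e(y)` of `exists_absorbing` removes the
conjugation. -/
theorem exists_inverse_weight (hf : IsNormalHom f) (hD : IsNormalizedSemiInvariant f D)
    {E : Subalgebra k A} (hE : IsHopfSubalgebra E) (hDE : D ∈ E) :
    ∃ u ∈ E, counit (R := k) u = 1 ∧
      leftCoaction f u = HopfAlgebra.antipode k (f D) ⊗ₜ u := by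
  obtain ⟨e, heE, heK, he0, he⟩ := hD.exists_absorbing hf hE hDE
  rw [mem_leftInvariants_iff] at heK
  let U : A ⊗[k] A := tensorLeft k A A e *
    ((toConv (tensorLeft k A A))⁻¹ * toConv (tensorRight k A A) : WithConv (A →ₐ[k] A ⊗[k] A)) D
  have hU : ∀ (R : Type u) [CommRing R] [Algebra k R] (y z : WithConv (A →ₐ[k] R)),
      tensorLift y.ofConv z.ofConv U = y e * (y⁻¹ * z) D := by
    intro R _ _ y z
    have h1 : mapPoint (tensorLift y.ofConv z.ofConv) (toConv (tensorLeft k A A)) = y :=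
      congrArg toConv (tensorLift_left _ _)
    have h2 : mapPoint (tensorLift y.ofConv z.ofConv) (toConv (tensorRight k A A)) = z :=
      congrArg toConv (tensorLift_right _ _)
    rw [map_mul]
    congr 1
    · exact congrArg (fun g : WithConv (A →ₐ[k] R) => g e) h1
    · rw [← mapPoint_apply, map_mul, map_inv, h1, h2]
  have hU0 : U ≠ 0 := by
    intro h
    have := hU A (toConv (AlgHom.id k A)) (toConv (AlgHom.id k A))
    rw [h, map_zero, inv_mul_cancel, hD.one_apply, mul_one] at this
    exact he0 this.symm
  obtain ⟨β, hβ⟩ : ∃ β, sliceRight β U ≠ 0 := by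
    by_contra! h
    exact hU0 (eq_zero_of_sliceRight h)
  have hUE : sliceRight β U ∈ E := by
    refine sliceRight_mem_of_mem_range (Subalgebra.mul_mem _ ⟨⟨e, heE⟩ ⊗ₜ 1, rfl⟩ ?_) β
    have h1 : ∀ x ∈ E, (toConv (tensorLeft k A A) : WithConv (A →ₐ[k] A ⊗[k] A)) x ∈
        (Algebra.TensorProduct.map E.val (AlgHom.id k A)).range :=
      fun x hx => ⟨⟨x, hx⟩ ⊗ₜ 1, rfl⟩
    have h2 : ∀ x ∈ E, (toConv (tensorRight k A A) : WithConv (A →ₐ[k] A ⊗[k] A)) x ∈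
        (Algebra.TensorProduct.map E.val (AlgHom.id k A)).range :=
      fun x hx => ⟨1 ⊗ₜ x, rfl⟩
    exact point_mul_apply_mem hE (fun x hx => point_inv_apply_mem hE h1 hx) h2 hDE
  have hsemi : leftCoaction f (sliceRight β U) =
      HopfAlgebra.antipode k (f D) ⊗ₜ sliceRight β U := by
    have key : ∀ w : A →ₐ[k] B ⊗[k] A, LinearMap.rTensor A w.toLinearMap U =
        tensorLeft k (B ⊗[k] A) A (w e) *
          ((mapPoint (tensorLeft k (B ⊗[k] A) A) (toConv w))⁻¹ *
            toConv (tensorRight k (B ⊗[k] A) A) : WithConv (A →ₐ[k] (B ⊗[k] A) ⊗[k] A)) D := by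
      intro w
      refine Eq.trans ?_ (hU _ (mapPoint (tensorLeft k (B ⊗[k] A) A) (toConv w))
        (toConv (tensorRight k (B ⊗[k] A) A)))
      change Algebra.TensorProduct.map w (AlgHom.id k A) _ = _
      rw [map_eq_tensorLift]
      rfl
    rw [leftCoaction_sliceRight, key, leftCoaction_eq, map_mul (mapPoint _), mapPoint_comapPoint]
    have h1 : ∀ t : A ⊗[k] A, sliceRight β ((((HopfAlgebra.antipode k (f D)) ⊗ₜ[k] (1 : A)) ⊗ₜ[k]
        (1 : A) : (B ⊗[k] A) ⊗[k] A) *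
          LinearMap.rTensor A (tensorRight k B A).toLinearMap t) =
        HopfAlgebra.antipode k (f D) ⊗ₜ sliceRight β t := by
      intro t
      induction t using TensorProduct.induction_on with
      | zero => simp
      | add x y hx hy => simp only [map_add, mul_add, TensorProduct.tmul_add, hx, hy]
      | tmul a b => simp
    rw [← h1, key]
    congr 1
    set ν : WithConv (B →ₐ[k] (B ⊗[k] A) ⊗[k] A) :=
      mapPoint (tensorLeft k (B ⊗[k] A) A) (toConv (tensorLeft k B A)) with hν
    set y : WithConv (A →ₐ[k] (B ⊗[k] A) ⊗[k] A) :=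
      mapPoint (tensorLeft k (B ⊗[k] A) A) (toConv (tensorRight k B A)) with hy
    set z : WithConv (A →ₐ[k] (B ⊗[k] A) ⊗[k] A) := toConv (tensorRight k (B ⊗[k] A) A)
    have h2 : tensorLeft k (B ⊗[k] A) A (leftCoaction f e) = y e := by
      refine Eq.trans (congrArg (fun g : WithConv (A →ₐ[k] B ⊗[k] A) =>
        tensorLeft k (B ⊗[k] A) A (g e)) (leftCoaction_eq f)) (Eq.trans ?_ (heK _ ν y))
      rw [hν, hy, ← mapPoint_comapPoint, ← map_mul]
      rfl
    rw [h2, inv_mul_eq, hD.conj_mul hf, ← mul_assoc, he, mul_assoc, mul_left_comm]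
    rfl
  obtain ⟨ψ, hψ⟩ : ∃ ψ : Module.Dual k A, ψ (sliceRight β U) ≠ 0 := by
    by_contra! h
    exact hβ ((Module.forall_dual_apply_eq_zero_iff k _).1 h)
  have hψ' : counit (R := k) (sliceRight ((ψ (sliceRight β U))⁻¹ • ψ) (comul (sliceRight β U))) =
      1 := by
    have h1 : ∀ (φ : Module.Dual k A) (t : A ⊗[k] A), counit (R := k) (sliceRight φ t) =
        φ (TensorProduct.lid k A (LinearMap.rTensor A counit t)) := by
      intro φ t
      induction t using TensorProduct.induction_on with
      | zero => simp
      | add x y hx hy => simp only [map_add, hx, hy]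
      | tmul a b => simp [mul_comm]
    rw [h1, Coalgebra.rTensor_counit_comul]
    simp [hψ]
  exact ⟨_, hE.sliceRight_mem hUE _, hψ', leftCoaction_sliceRight_comul hsemi _⟩

end IsNormalizedSemiInvariant

end SemiInvariants

/-! ### The ideal of a normal subgroup is generated by invariants -/

section NormalIdeal

variable {k A B : Type u} [Field k] [CommRing A] [HopfAlgebra k A] [CommRing B]
  [HopfAlgebra k B] {f : A →ₐc[k] B}

/-- A finite-dimensional space has a basis adapted to the kernel of a linear map. -/
theorem exists_adapted_basis {V M : Type*} [AddCommGroup V] [Module k V] [AddCommGroup M]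
    [Module k M] [FiniteDimensional k V] (φ : V →ₗ[k] M) :
    ∃ (d e : ℕ) (b : Module.Basis (Fin d ⊕ Fin e) k V), (∀ j, φ (b (.inl j)) = 0) ∧
      LinearIndependent k fun i => φ (b (.inr i)) := by
  obtain ⟨W', hW⟩ := (LinearMap.ker φ).exists_isCompl
  let b := ((Module.finBasis k (LinearMap.ker φ)).prod (Module.finBasis k W')).map
    (Submodule.prodEquivOfIsCompl (LinearMap.ker φ) W' hW)
  refine ⟨_, _, b, fun j => ?_, ?_⟩
  · have : b (.inl j) = (Module.finBasis k (LinearMap.ker φ) j : V) := by simp [b]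
    rw [this]
    exact (Module.finBasis k (LinearMap.ker φ) j).2
  · have h1 : ∀ i, φ (b (.inr i)) = (φ ∘ₗ W'.subtype) (Module.finBasis k W' i) := by
      intro i
      simp [b]
    simp only [h1]
    refine (Module.finBasis k W').linearIndependent.map' _ ?_
    rw [LinearMap.ker_eq_bot']
    intro x hx
    have : (x : V) ∈ LinearMap.ker φ ⊓ W' := ⟨hx, x.2⟩
    rw [hW.inf_eq_bot, Submodule.mem_bot] at this
    exact Subtype.ext this

theorem eq_zero_of_sum_tmul_eq_zero {ι M N : Type*} [Fintype ι] [AddCommGroup M] [Module k M]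
    [AddCommGroup N] [Module k N] {v : ι → N} (hv : LinearIndependent k v) {x : ι → M}
    (h : ∑ i, x i ⊗ₜ[k] v i = 0) (i : ι) : x i = 0 := by
  refine (Module.forall_dual_apply_eq_zero_iff k _).1 fun φ => ?_
  have h2 := congrArg (sliceLeft φ) h
  rw [map_sum, map_zero] at h2
  simp only [sliceLeft_tmul] at h2
  exact Fintype.linearIndependent_iff.1 hv (fun i => φ (x i)) h2 i

/-- The ideal of a normal subgroup is generated by the invariants vanishing at the unit, within
every Hopf subalgebra `E`. In a basis of the left coideal spanned by `x` whose first `d` elements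
vanish on the subgroup, the `d × d`-minors of the first `d` rows of the comatrix are semi-invariants
of the same weight; multiplying them by a semi-invariant of the inverse weight gives invariants. -/
theorem IsNormalHom.mem_augPart_mul (hf : IsNormalHom f) {E : Subalgebra k A}
    (hE : IsHopfSubalgebra E) {x : A} (hxE : x ∈ E) (hx : f x = 0) :
    x ∈ augPart (leftInvariants f ⊓ E) * Subalgebra.toSubmodule E := by
  classical
  obtain ⟨d, e, b, hb0, hbi⟩ := exists_adapted_basis
    ((f : A →ₐ[k] B).toLinearMap ∘ₗ (coidealSpan (k := k) x).subtype)
  obtain ⟨a, ha⟩ := exists_isComatrix (isLeftCoideal_coidealSpan x) b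
  have haE := ha.entry_mem hE (coidealSpan_le hE.isLeftCoideal hxE)
  have hzero : ∀ j i, f (a (.inl j) (.inr i)) = 0 := by
    intro j
    refine fun i => eq_zero_of_sum_tmul_eq_zero (x := fun i => f (a (.inl j) (.inr i))) hbi ?_ i
    have h1 := CoalgHomClass.map_comp_comul_apply f (b (.inl j) : A)
    have h2 : f (b (.inl j) : A) = 0 := hb0 j
    rw [h2, map_zero, ha.comul_family, map_sum, Fintype.sum_sum_type] at h1
    refine Eq.trans ?_ h1
    have h3 : ∀ l, f (b (.inl l) : A) = 0 := hb0
    simp only [TensorProduct.map_tmul]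
    rw [Finset.sum_eq_zero (s := (Finset.univ : Finset (Fin d))), zero_add]
    · rfl
    · intro l _
      change f (a (.inl j) (.inl l)) ⊗ₜ[k] f (b (.inl l) : A) = 0
      rw [h3, TensorProduct.tmul_zero]
  -- the minors of the first `d` rows are semi-invariants of the same weight
  let D : (Fin d → Fin d ⊕ Fin e) → A := fun T =>
    Matrix.det (Matrix.of fun j l => a (.inl j) (T l))
  have hDE : ∀ T, D T ∈ E := fun T => det_mem fun j l => haE _ _
  have hD : ∀ T, leftCoaction f (D T) = f (D .inl) ⊗ₜ D T := by
    intro T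
    rw [leftCoaction_apply_eq_iff]
    intro R _ _ ν y
    have h1 : ∀ (g : WithConv (A →ₐ[k] R)) T, g (D T) =
        Matrix.det (Matrix.of fun j l => g (a (.inl j) (T l))) := by
      intro g T
      change g.ofConv (Matrix.det _) = _
      rw [AlgHom.map_det]
      rfl
    rw [← comapPoint_apply, h1, h1, h1, ← Matrix.det_mul]
    congr 1
    ext j l
    rw [Matrix.of_apply, ha.map_mul, Fintype.sum_sum_type, Matrix.mul_apply]
    simp only [Matrix.of_apply]
    rw [add_eq_left]
    refine Finset.sum_eq_zero fun i _ => ?_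
    rw [comapPoint_apply, hzero]
    have : ν 0 = 0 := map_zero ν.ofConv
    rw [this, zero_mul]
  have hεD : ∀ T, counit (R := k) (D T) = Matrix.det (Matrix.of fun j l =>
      if (Sum.inl j : Fin d ⊕ Fin e) = T l then (1 : k) else 0) := by
    intro T
    rw [← Bialgebra.counitAlgHom_apply (R := k), AlgHom.map_det]
    congr 1
    ext j l
    exact ha.counit_entry _ _
  have hD1 : IsNormalizedSemiInvariant f (D .inl) := by
    refine ⟨hD _, (hεD _).trans ?_⟩
    have : (Matrix.of fun j l => if (Sum.inl j : Fin d ⊕ Fin e) = .inl l then (1 : k) else 0) =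
        (1 : Matrix (Fin d) (Fin d) k) := by
      ext j l
      simp [Matrix.one_apply]
    rw [this, Matrix.det_one]
  obtain ⟨u, huE, hu1, hu⟩ := hD1.exists_inverse_weight hf hE (hDE _)
  have hDu : ∀ T, D T * u ∈ leftInvariants f ⊓ E := by
    refine fun T => ⟨?_, E.mul_mem (hDE T) huE⟩
    change D T * u ∈ leftInvariants f
    rw [mem_leftInvariants, map_mul, hD, hu, Algebra.TensorProduct.tmul_mul_tmul]
    congr 1
    have := hD1.mul_inv_apply (toConv (AlgHom.id k B))
    rw [comapPoint_apply, comapPoint_apply, point_inv_apply] at this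
    exact this
  -- Cramer's rule expresses the remaining entries of the first rows through the minors
  have hentry : ∀ j i, a (.inl j) (.inr i) ∈
      augPart (leftInvariants f ⊓ E) * Subalgebra.toSubmodule E := by
    intro j i
    let c : Fin d → A := fun l => a (.inl l) (.inr i)
    let M : Matrix (Fin d) (Fin d) A := Matrix.of fun j l => a (.inl j) (.inl l)
    have h1 := congrFun (Matrix.mulVec_cramer M c) j
    have h2 : ∀ l, M.cramer c l = D (Function.update .inl l (.inr i)) := by
      intro l
      rw [Matrix.cramer_apply]
      congr 1
      ext j m
      rw [Matrix.updateCol_apply, Matrix.of_apply, Function.update_apply]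
      split_ifs <;> rfl
    have h3 : a (.inl j) (.inr i) =
        ∑ l, (D (Function.update .inl l (.inr i)) * u) * a (.inl j) (.inl l) -
          (D .inl * u - algebraMap k A (counit (D .inl * u))) * a (.inl j) (.inr i) := by
      have h4 : D .inl * a (.inl j) (.inr i) =
          ∑ l, a (.inl j) (.inl l) * D (Function.update .inl l (.inr i)) := by
        simp only [← h2]
        exact h1.symm
      rw [Bialgebra.counit_mul, hu1, hD1.counit_eq, mul_one, map_one, sub_mul, one_mul]
      rw [mul_right_comm, h4, Finset.sum_mul, sub_sub_eq_add_sub, eq_sub_iff_add_eq, add_comm]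
      congr 1
      exact Finset.sum_congr rfl fun l _ => by ring
    rw [h3]
    refine sub_mem (Submodule.sum_mem _ fun l _ => ?_) ?_
    · refine Submodule.mul_mem_mul ⟨hDu _, ?_⟩ (haE _ _)
      change counit (R := k) _ = 0
      rw [Bialgebra.counit_mul, hεD, Matrix.det_eq_zero_of_column_eq_zero l, zero_mul]
      intro m
      simp
    · exact Submodule.mul_mem_mul (sub_counit_mem_augPart (hDu _)) (haE _ _)
  -- the elements of the first part of the basis are combinations of these entries
  have hinl : ∀ j, (b (.inl j) : A) ∈
      augPart (leftInvariants f ⊓ E) * Subalgebra.toSubmodule E := by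
    intro j
    rw [ha.sum_counit (.inl j), Fintype.sum_sum_type]
    refine add_mem ?_ (Submodule.sum_mem _ fun i _ => Submodule.smul_mem _ _ (hentry j i))
    rw [Finset.sum_eq_zero]
    · exact zero_mem _
    · intro l _
      have h1 : f (b (.inl l) : A) = 0 := hb0 l
      rw [← CoalgHomClass.counit_comp_apply f (b (.inl l) : A), h1, map_zero, zero_smul]
  have hx' := congrArg Subtype.val (b.sum_repr ⟨x, self_mem_coidealSpan x⟩)
  rw [AddSubmonoidClass.coe_finsetSum, Fintype.sum_sum_type] at hx'
  have h0 : ∀ i, b.repr ⟨x, self_mem_coidealSpan x⟩ (.inr i) = 0 := by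
    refine Fintype.linearIndependent_iff.1 hbi
      (fun i => b.repr ⟨x, self_mem_coidealSpan x⟩ (.inr i)) ?_
    have h1 := congrArg (f : A →ₐ[k] B).toLinearMap hx'
    have h2 : (f : A →ₐ[k] B).toLinearMap x = 0 := hx
    have h3 : ∀ j, (f : A →ₐ[k] B).toLinearMap (b (.inl j) : A) = 0 := hb0
    simp only [map_add, map_sum, SetLike.val_smul, map_smul, h3, smul_zero,
      Finset.sum_const_zero, zero_add, h2] at h1
    exact h1
  simp only [h0, zero_smul, ZeroMemClass.coe_zero, Finset.sum_const_zero, add_zero,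
    SetLike.val_smul] at hx'
  rw [← hx']
  exact Submodule.sum_mem _ fun j _ => Submodule.smul_mem _ _ (hinl j)

end NormalIdeal

/-! ### Constructions with Hopf subalgebras -/

section Antipode

variable {k A B : Type*} [Field k] [CommRing A] [HopfAlgebra k A] [CommRing B] [HopfAlgebra k B]

/-- Morphisms of bialgebras between Hopf algebras commute with antipodes. -/
theorem map_antipode (f : A →ₐc[k] B) (x : A) :
    f (HopfAlgebra.antipode k x) = HopfAlgebra.antipode k (f x) := by
  have h : (comapPoint f (toConv (AlgHom.id k B)))⁻¹ =
      comapPoint f ((toConv (AlgHom.id k B))⁻¹) := (map_inv _ _).symm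
  exact congrArg (fun g : WithConv (A →ₐ[k] B) => g x) h

theorem antipode_antipode (x : A) :
    HopfAlgebra.antipode k (HopfAlgebra.antipode k x) = x :=
  congrArg (fun g : WithConv (A →ₐ[k] A) => g x) (inv_inv (toConv (AlgHom.id k A)))

theorem point_mul_inv_rev {R : Type*} [CommRing R] [Algebra k R] (g h : WithConv (A →ₐ[k] R))
    (x : A) : (g * h) (HopfAlgebra.antipode k x) = (h⁻¹ * g⁻¹) x := by
  rw [← point_inv_apply, mul_inv_rev]

theorem IsComatrix.comul_antipode {ι : Type*} [Fintype ι] [DecidableEq ι] {p : ι → A}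
    {a : Matrix ι ι A} (ha : IsComatrix (k := k) p a) (j i : ι) :
    comul (R := k) (HopfAlgebra.antipode k (a j i)) =
      ∑ l, HopfAlgebra.antipode k (a l i) ⊗ₜ HopfAlgebra.antipode k (a j l) := by
  have h1 : comul (R := k) (HopfAlgebra.antipode k (a j i)) =
      (toConv (tensorLeft k A A) * toConv (tensorRight k A A) : WithConv (A →ₐ[k] A ⊗[k] A))
        (HopfAlgebra.antipode k (a j i)) := by
    rw [← comul_point]
    rfl
  rw [h1, point_mul_inv_rev, ha.map_mul]
  refine Finset.sum_congr rfl fun l _ => ?_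
  change ((1 : A) ⊗ₜ[k] HopfAlgebra.antipode k (a j l)) *
    (HopfAlgebra.antipode k (a l i) ⊗ₜ[k] (1 : A)) = _
  simp

end Antipode

section HopfSubalgebras

variable {k A B : Type*} [Field k] [CommRing A] [HopfAlgebra k A] [CommRing B] [HopfAlgebra k B]

/-- The algebra `C ⊗ C` inside `A ⊗ A`. -/
def tensorSquare (C : Subalgebra k A) : Subalgebra k (A ⊗[k] A) :=
  (Algebra.TensorProduct.map C.val C.val).range

theorem tmul_mem_tensorSquare {C : Subalgebra k A} {x y : A} (hx : x ∈ C) (hy : y ∈ C) :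
    x ⊗ₜ[k] y ∈ tensorSquare C := ⟨⟨x, hx⟩ ⊗ₜ ⟨y, hy⟩, rfl⟩

theorem tensorSquare_mono {C D : Subalgebra k A} (h : C ≤ D) :
    tensorSquare C ≤ tensorSquare D := by
  rintro _ ⟨s, rfl⟩
  refine ⟨Algebra.TensorProduct.map (Subalgebra.inclusion h) (Subalgebra.inclusion h) s, ?_⟩
  change ((Algebra.TensorProduct.map D.val D.val).comp
    (Algebra.TensorProduct.map (Subalgebra.inclusion h) (Subalgebra.inclusion h))) s =
      Algebra.TensorProduct.map C.val C.val s
  rw [← Algebra.TensorProduct.map_comp]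
  rfl

theorem IsHopfSubalgebra.of_slices {C : Subalgebra k A}
    (hl : ∀ x ∈ C, ∀ f, sliceLeft f (comul (R := k) x) ∈ C)
    (hr : ∀ x ∈ C, ∀ f, sliceRight f (comul (R := k) x) ∈ C)
    (hS : ∀ x ∈ C, HopfAlgebra.antipode k x ∈ C) : IsHopfSubalgebra C where
  comul_mem x hx := mem_range_map_of_slices (hr x hx) (hl x hx)
  antipode_mem := hS

theorem IsHopfSubalgebra.inf {C D : Subalgebra k A} (hC : IsHopfSubalgebra C)
    (hD : IsHopfSubalgebra D) : IsHopfSubalgebra (C ⊓ D) :=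
  .of_slices (fun x hx f => ⟨hC.isLeftCoideal x hx.1 f, hD.isLeftCoideal x hx.2 f⟩)
    (fun _ hx f => ⟨hC.sliceRight_mem hx.1 f, hD.sliceRight_mem hx.2 f⟩)
    (fun x hx => ⟨hC.antipode_mem x hx.1, hD.antipode_mem x hx.2⟩)

theorem isHopfSubalgebra_adjoin {s : Set A}
    (hΔ : ∀ x ∈ s, comul x ∈ tensorSquare (Algebra.adjoin k s))
    (hS : ∀ x ∈ s, HopfAlgebra.antipode k x ∈ Algebra.adjoin k s) :
    IsHopfSubalgebra (Algebra.adjoin k s) where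
  comul_mem := by
    have : Algebra.adjoin k s ≤
        (tensorSquare (Algebra.adjoin k s)).comap (Bialgebra.comulAlgHom k A) :=
      Algebra.adjoin_le hΔ
    exact fun x hx => this hx
  antipode_mem := by
    have : Algebra.adjoin k s ≤
        (Algebra.adjoin k s).comap (HopfAlgebra.antipodeAlgHom k A) :=
      Algebra.adjoin_le hS
    exact fun x hx => this hx

theorem IsHopfSubalgebra.sup {C D : Subalgebra k A} (hC : IsHopfSubalgebra C)
    (hD : IsHopfSubalgebra D) : IsHopfSubalgebra (C ⊔ D) := by
  have hle : C ⊔ D = Algebra.adjoin k ((C : Set A) ∪ D) := rfl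
  rw [hle]
  refine isHopfSubalgebra_adjoin (fun x hx => ?_) fun x hx => ?_
  · rw [← hle]
    rcases hx with hx | hx
    · exact tensorSquare_mono le_sup_left (hC.comul_mem x hx)
    · exact tensorSquare_mono le_sup_right (hD.comul_mem x hx)
  · rw [← hle]
    rcases hx with hx | hx
    · exact (le_sup_left : C ≤ C ⊔ D) (hC.antipode_mem x hx)
    · exact (le_sup_right : D ≤ C ⊔ D) (hD.antipode_mem x hx)

theorem IsHopfSubalgebra.map {C : Subalgebra k A} (hC : IsHopfSubalgebra C) (f : A →ₐc[k] B) :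
    IsHopfSubalgebra (C.map (f : A →ₐ[k] B)) where
  comul_mem := by
    rintro _ ⟨x, hx, rfl⟩
    obtain ⟨n, a, b, ha, hb, h⟩ := exists_sum_tmul_of_mem_range_map (hC.comul_mem x hx)
    change comul (f x) ∈ _
    rw [← CoalgHomClass.map_comp_comul_apply, h, map_sum]
    exact Subalgebra.sum_mem (tensorSquare (C.map (f : A →ₐ[k] B))) fun i _ =>
      tmul_mem_tensorSquare ⟨a i, ha i, rfl⟩ ⟨b i, hb i, rfl⟩
  antipode_mem := by
    rintro _ ⟨x, hx, rfl⟩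
    exact ⟨_, hC.antipode_mem x hx, map_antipode f x⟩

theorem sliceLeft_map {M N M' N' : Type*} [AddCommGroup M] [Module k M] [AddCommGroup N]
    [Module k N] [AddCommGroup M'] [Module k M'] [AddCommGroup N'] [Module k N']
    (u : M →ₗ[k] M') (v : N →ₗ[k] N') (f : Module.Dual k M') (t : M ⊗[k] N) :
    sliceLeft f (TensorProduct.map u v t) = v (sliceLeft (f ∘ₗ u) t) := by
  induction t using TensorProduct.induction_on with
  | zero => simp
  | add x y hx hy => simp only [map_add, hx, hy]
  | tmul a b => simp

theorem sliceRight_map {M N M' N' : Type*} [AddCommGroup M] [Module k M] [AddCommGroup N]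
    [Module k N] [AddCommGroup M'] [Module k M'] [AddCommGroup N'] [Module k N']
    (u : M →ₗ[k] M') (v : N →ₗ[k] N') (f : Module.Dual k N') (t : M ⊗[k] N) :
    sliceRight f (TensorProduct.map u v t) = u (sliceRight (f ∘ₗ v) t) := by
  induction t using TensorProduct.induction_on with
  | zero => simp
  | add x y hx hy => simp only [map_add, hx, hy]
  | tmul a b => simp

theorem IsHopfSubalgebra.comap {C : Subalgebra k B} (hC : IsHopfSubalgebra C) (f : A →ₐc[k] B)
    (hf : Function.Injective f) : IsHopfSubalgebra (C.comap (f : A →ₐ[k] B)) := by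
  have hext : ∀ φ : Module.Dual k A, ∃ ψ : Module.Dual k B,
      φ = ψ ∘ₗ (f : A →ₐ[k] B).toLinearMap := by
    intro φ
    obtain ⟨g, hg⟩ := LinearMap.exists_leftInverse_of_injective
      (f : A →ₐ[k] B).toLinearMap (LinearMap.ker_eq_bot.2 hf)
    exact ⟨φ ∘ₗ g, by rw [LinearMap.comp_assoc, hg, LinearMap.comp_id]⟩
  have hΔ : ∀ x, comul (f x) = TensorProduct.map (f : A →ₐ[k] B).toLinearMap
      (f : A →ₐ[k] B).toLinearMap (comul (R := k) x) :=
    fun x => (CoalgHomClass.map_comp_comul_apply f x).symm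
  refine .of_slices (fun x hx φ => ?_) (fun x hx φ => ?_) fun x hx => ?_
  · obtain ⟨ψ, rfl⟩ := hext φ
    have := hC.isLeftCoideal (f x) hx ψ
    rw [lact_apply, hΔ, sliceLeft_map] at this
    exact this
  · obtain ⟨ψ, rfl⟩ := hext φ
    have := hC.sliceRight_mem (x := f x) hx ψ
    rw [hΔ, sliceRight_map] at this
    exact this
  · change f _ ∈ C
    rw [map_antipode]
    exact hC.antipode_mem _ hx

/-- Hopf subalgebras are directed unions of finitely generated ones. -/
theorem IsHopfSubalgebra.exists_fg {C : Subalgebra k A} (hC : IsHopfSubalgebra C) {ι : Type*}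
    [Finite ι] (x : ι → A) (hx : ∀ i, x i ∈ C) :
    ∃ D : Subalgebra k A, IsHopfSubalgebra D ∧ D.FG ∧ D ≤ C ∧ ∀ i, x i ∈ D := by
  classical
  obtain ⟨V, hVf, hV, hVC, hxV⟩ := hC.isLeftCoideal.exists_finite x hx
  let b := Module.finBasis k V
  obtain ⟨a, ha⟩ := exists_isComatrix hV b
  have haC := ha.entry_mem hC hVC
  let s : Set A := (Set.range fun q : _ × _ => a q.1 q.2) ∪
    Set.range fun q : _ × _ => HopfAlgebra.antipode k (a q.1 q.2)
  have h1 : ∀ j i, a j i ∈ Algebra.adjoin k s := fun j i =>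
    Algebra.subset_adjoin (.inl ⟨(j, i), rfl⟩)
  have h2 : ∀ j i, HopfAlgebra.antipode k (a j i) ∈ Algebra.adjoin k s := fun j i =>
    Algebra.subset_adjoin (.inr ⟨(j, i), rfl⟩)
  refine ⟨Algebra.adjoin k s, isHopfSubalgebra_adjoin ?_ ?_, ?_, Algebra.adjoin_le ?_,
    fun i => ?_⟩
  · rintro _ (⟨q, rfl⟩ | ⟨q, rfl⟩)
    · rw [ha.comul_entry]
      exact Subalgebra.sum_mem _ fun l _ => tmul_mem_tensorSquare (h1 _ _) (h1 _ _)
    · rw [ha.comul_antipode]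
      exact Subalgebra.sum_mem _ fun l _ => tmul_mem_tensorSquare (h2 _ _) (h2 _ _)
  · rintro _ (⟨q, rfl⟩ | ⟨q, rfl⟩)
    · exact h2 _ _
    · rw [antipode_antipode]
      exact h1 _ _
  · refine Subalgebra.fg_def.2 ⟨s, ?_, rfl⟩
    exact (Set.finite_range _).union (Set.finite_range _)
  · rintro _ (⟨q, rfl⟩ | ⟨q, rfl⟩)
    · exact haC _ _
    · exact hC.antipode_mem _ (haC _ _)
  · have hi := congrArg Subtype.val (b.sum_repr ⟨x i, hxV i⟩)
    rw [AddSubmonoidClass.coe_finsetSum] at hi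
    change _ = x i at hi
    rw [← hi]
    refine Subalgebra.sum_mem _ fun j _ => ?_
    rw [SetLike.val_smul, ha.sum_counit j]
    exact Subalgebra.smul_mem _ (Subalgebra.sum_mem _ fun l _ => Subalgebra.smul_mem _ (h1 _ _) _) _

theorem isHopfSubalgebra_top : IsHopfSubalgebra (⊤ : Subalgebra k A) :=
  .of_slices (fun _ _ _ => trivial) (fun _ _ _ => trivial) (fun _ _ => trivial)

theorem isHopfSubalgebra_iSup {ι : Type*} [Nonempty ι] {C : ι → Subalgebra k A}
    (hC : ∀ i, IsHopfSubalgebra (C i)) : IsHopfSubalgebra (⨆ i, C i) := by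
  have hle : ⨆ i, C i = Algebra.adjoin k (⋃ i, (C i : Set A)) := by
    refine le_antisymm (iSup_le fun i x hx => Algebra.subset_adjoin (Set.mem_iUnion.2 ⟨i, hx⟩))
      (Algebra.adjoin_le (Set.iUnion_subset fun i => le_iSup C i))
  rw [hle]
  refine isHopfSubalgebra_adjoin (fun x hx => ?_) fun x hx => ?_
  · rw [← hle]
    obtain ⟨i, hi⟩ := Set.mem_iUnion.1 hx
    exact tensorSquare_mono (le_iSup C i) ((hC i).comul_mem x hi)
  · rw [← hle]
    obtain ⟨i, hi⟩ := Set.mem_iUnion.1 hx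
    exact le_iSup C i ((hC i).antipode_mem x hi)

/-! ### Hopf subalgebras and the ideals they generate -/

theorem mul_le_sup_augSpan {C D : Subalgebra k A} (h : augPart D ≤ augSpan C) :
    Subalgebra.toSubmodule C * Subalgebra.toSubmodule D ≤
      Subalgebra.toSubmodule C ⊔ augSpan C := by
  refine Submodule.mul_le.2 fun c hc d hd => ?_
  have : c * d = counit (R := k) d • c + c * (d - algebraMap k A (counit d)) := by
    rw [Algebra.smul_def]
    ring
  rw [this]
  exact add_mem (Submodule.mem_sup_left (Submodule.smul_mem _ _ hc))
    (Submodule.mem_sup_right (mul_mem_augSpan _ (h (sub_counit_mem_augPart hd))))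

/-- A Hopf subalgebra is determined by the ideal it generates. -/
theorem IsHopfSubalgebra.le_of_augPart_le {C D : Subalgebra k A} (hC : IsHopfSubalgebra C)
    (hD : IsHopfSubalgebra D) (h : augPart D ≤ augSpan C) : D ≤ C := by
  have hle := hC.le_of_le_sup_augSpan (hC.isLeftCoideal.mul hD.isLeftCoideal)
    (fun x hx => by
      have := Submodule.mul_mem_mul (N := Subalgebra.toSubmodule D) hx D.one_mem
      rwa [mul_one] at this) (mul_le_sup_augSpan h)
  intro x hx
  have := hle (Submodule.mul_mem_mul (M := Subalgebra.toSubmodule C) C.one_mem hx)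
  rwa [one_mul] at this

theorem augPart_sup_le (C D : Subalgebra k A) : augPart (C ⊔ D) ≤ augSpan C ⊔ augSpan D := by
  have h1 : Subalgebra.toSubmodule (C ⊔ D) =
      Subalgebra.toSubmodule C * Subalgebra.toSubmodule D := by
    rw [Subalgebra.mul_toSubmodule]
  have h2 : ∀ x ∈ Subalgebra.toSubmodule C * Subalgebra.toSubmodule D,
      x - algebraMap k A (counit x) ∈ augSpan C ⊔ augSpan D := by
    intro x hx
    induction hx using Submodule.mul_induction_on' with
    | mem_mul_mem c hc d hd =>
      have : c * d - algebraMap k A (counit (c * d)) =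
          algebraMap k A (counit d) * (c - algebraMap k A (counit c)) +
            c * (d - algebraMap k A (counit d)) := by
        rw [Bialgebra.counit_mul, map_mul]
        ring
      rw [this]
      exact add_mem
        (Submodule.mem_sup_left (mul_mem_augSpan _
          (augPart_le_augSpan _ (sub_counit_mem_augPart hc))))
        (Submodule.mem_sup_right (mul_mem_augSpan _
          (augPart_le_augSpan _ (sub_counit_mem_augPart hd))))
    | add x _ y _ hx hy =>
      have : x + y - algebraMap k A (counit (x + y)) =
          (x - algebraMap k A (counit x)) + (y - algebraMap k A (counit y)) := by
        rw [map_add, map_add]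
        ring
      rw [this]
      exact add_mem hx hy
  rintro x ⟨hx, hε⟩
  have hε' : counit (R := k) x = 0 := hε
  have := h2 x (h1 ▸ hx)
  rwa [hε', map_zero, sub_zero] at this

theorem augSpan_le {C : Subalgebra k A} {W : Submodule k A} (hW : ⊤ * W ≤ W)
    (h : augPart C ≤ W) : augSpan C ≤ W :=
  (mul_le_mul' le_rfl h).trans hW

theorem top_mul_augSpan_le (C : Subalgebra k A) : ⊤ * augSpan C ≤ augSpan C :=
  Submodule.mul_le.2 fun x _ _ hy => mul_mem_augSpan x hy

theorem augSpan_sup (C D : Subalgebra k A) : augSpan (C ⊔ D) = augSpan C ⊔ augSpan D := by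
  refine le_antisymm (augSpan_le ?_ (augPart_sup_le C D))
    (sup_le (augSpan_mono le_sup_left) (augSpan_mono le_sup_right))
  rw [Submodule.mul_sup]
  exact sup_le_sup (top_mul_augSpan_le C) (top_mul_augSpan_le D)

/-- Hopf subalgebras of finitely generated Hopf algebras are finitely generated. -/
theorem IsHopfSubalgebra.fg_of_le {C S : Subalgebra k A} (hC : IsHopfSubalgebra C)
    (hS : S.FG) (hCS : C ≤ S) : C.FG := by
  have : Algebra.FiniteType k S := S.fg_iff_finiteType.1 hS
  have : IsNoetherianRing S := Algebra.FiniteType.isNoetherianRing k S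
  obtain ⟨t, ht, htI⟩ := Submodule.fg_span_iff_fg_span_finset_subset (R := S)
    {x : S | (x : A) ∈ augPart C} |>.1 (IsNoetherian.noetherian _)
  obtain ⟨D, hD, hDfg, hDC, htD⟩ := hC.exists_fg (fun x : t => ((x : S) : A))
    (fun x => (ht x.2).1)
  have hle : C ≤ D := by
    refine hD.le_of_augPart_le hC fun x hx => ?_
    have h1 : (⟨x, hCS hx.1⟩ : S) ∈ Submodule.span S {x : S | (x : A) ∈ augPart C} :=
      Submodule.subset_span hx
    rw [htI] at h1
    have h2 : ∀ y ∈ Submodule.span S (t : Set S), (y : A) ∈ augSpan D := by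
      intro y hy
      induction hy using Submodule.span_induction with
      | mem y hy => exact augPart_le_augSpan D ⟨htD ⟨y, hy⟩, (ht hy).2⟩
      | zero => exact zero_mem _
      | add y z _ _ hy hz => exact add_mem hy hz
      | smul c y _ hy => exact mul_mem_augSpan (c : A) hy
    exact h2 _ h1
  exact le_antisymm hle hDC ▸ hDfg

end HopfSubalgebras

/-! ### The quotient by the ideal of a Hopf subalgebra -/

section Quotients

theorem exists_algHom_comp_eq {k A B R : Type*} [Field k] [CommRing A] [Algebra k A] [CommRing B]
    [Algebra k B] [CommRing R] [Algebra k R] {f : A →ₐ[k] B} (hf : Function.Surjective f)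
    {ψ : A →ₐ[k] R} (h : ∀ x, f x = 0 → ψ x = 0) : ∃ ν : B →ₐ[k] R, ∀ x, ν (f x) = ψ x := by
  refine ⟨(Ideal.Quotient.liftₐ (RingHom.ker f) ψ fun x hx => h x hx).comp
    (Ideal.quotientKerAlgEquivOfSurjective hf).symm.toAlgHom, fun x => ?_⟩
  have : (Ideal.quotientKerAlgEquivOfSurjective hf).symm (f x) =
      Ideal.Quotient.mk (RingHom.ker f) x := by
    rw [AlgEquiv.symm_apply_eq]
    rfl
  change Ideal.Quotient.liftₐ (RingHom.ker f) ψ (fun x hx => h x hx)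
    ((Ideal.quotientKerAlgEquivOfSurjective hf).symm (f x)) = _
  rw [this]
  rfl

theorem point_mul_congr {k A R : Type*} [Field k] [CommRing A] [HopfAlgebra k A] [CommRing R]
    [Algebra k R] {C : Subalgebra k A} (hC : IsHopfSubalgebra C) {g g' h h' : WithConv (A →ₐ[k] R)}
    (hg : ∀ x ∈ C, g x = g' x) (hh : ∀ x ∈ C, h x = h' x) {x : A} (hx : x ∈ C) :
    (g * h) x = (g' * h') x := by
  obtain ⟨n, a, b, ha, hb, e⟩ := exists_sum_tmul_of_mem_range_map (hC.comul_mem x hx)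
  rw [point_mul_apply, point_mul_apply, e, map_sum, map_sum]
  refine Finset.sum_congr rfl fun i _ => ?_
  rw [Algebra.TensorProduct.lift_tmul, Algebra.TensorProduct.lift_tmul]
  exact congrArg₂ (· * ·) (hg _ (ha i)) (hh _ (hb i))

variable {k A : Type u} [Field k] [CommRing A] [HopfAlgebra k A]

/-- The ideal `C⁺ A`. -/
def augSpanIdeal (C : Subalgebra k A) : Ideal A where
  carrier := augSpan C
  add_mem' := fun ha hb => (augSpan C).add_mem ha hb
  zero_mem' := zero_mem (augSpan C)
  smul_mem' c _ hx := mul_mem_augSpan c hx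

theorem augSpanIdeal_le {C : Subalgebra k A} {R : Type*} [CommRing R] [Algebra k R]
    {φ : A →ₐ[k] R} (h : ∀ x ∈ augPart C, φ x = 0) {x : A} (hx : x ∈ augSpan C) : φ x = 0 := by
  have hle : augSpan C ≤ LinearMap.ker φ.toLinearMap :=
    Submodule.mul_le.2 fun a _ c hc => by
      change φ (a * c) = 0
      rw [map_mul, h c hc, mul_zero]
  exact hle hx

theorem IsHopfSubalgebra.isHopfIdeal {C : Subalgebra k A} (hC : IsHopfSubalgebra C) :
    (augSpanIdeal C).IsHopfIdeal k where
  counit_eq_zero _ hx := counit_eq_zero_of_mem_augSpan hx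
  map_mkQ_comul_eq_zero x hx := by
    let q : A →ₐ[k] A ⧸ augSpanIdeal C := Ideal.Quotient.mkₐ k (augSpanIdeal C)
    have hq : ∀ c ∈ C, q c = algebraMap k _ (counit c) := fun c hc => by
      rw [← q.commutes, ← sub_eq_zero, ← map_sub]
      exact Ideal.Quotient.eq_zero_iff_mem.2 (augPart_le_augSpan C (sub_counit_mem_augPart hc))
    refine augSpanIdeal_le (φ := (Algebra.TensorProduct.map q q).comp
      (Bialgebra.comulAlgHom k A)) (fun c hc => ?_) hx
    obtain ⟨n, a, b, ha, hb, e⟩ := exists_sum_tmul_of_mem_range_map (hC.comul_mem c hc.1)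
    have h1 : counit (R := k) c = ∑ i, counit (R := k) (a i) * counit (R := k) (b i) := by
      have := lact_counit (k := k) c
      rw [lact_apply, e, map_sum] at this
      rw [← this, map_sum]
      exact Finset.sum_congr rfl fun i _ => by rw [sliceLeft_tmul, map_smul, smul_eq_mul]
    have h2 : counit (R := k) c = 0 := hc.2
    change Algebra.TensorProduct.map q q (comul c) = 0
    rw [e, map_sum]
    have h3 : ∀ i, Algebra.TensorProduct.map q q (a i ⊗ₜ[k] b i) =
        algebraMap k _ (counit (R := k) (a i) * counit (R := k) (b i)) := by
      intro i
      rw [Algebra.TensorProduct.map_tmul, hq _ (ha i), hq _ (hb i),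
        Algebra.TensorProduct.algebraMap_apply, map_mul, Algebra.algebraMap_eq_smul_one,
        Algebra.algebraMap_eq_smul_one, TensorProduct.tmul_smul, ← TensorProduct.smul_tmul',
        smul_mul_smul_comm, mul_one, ← TensorProduct.smul_tmul', smul_smul, mul_comm]
    simp only [h3]
    rw [← map_sum, ← h1, h2, map_zero]
  antipode_mem x hx := by
    have h := augSpanIdeal_le (φ := (Ideal.Quotient.mkₐ k (augSpanIdeal C)).comp
      (HopfAlgebra.antipodeAlgHom k A)) (C := C) (fun c hc => ?_) hx
    · exact Ideal.Quotient.eq_zero_iff_mem.1 h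
    · refine Ideal.Quotient.eq_zero_iff_mem.2 (augPart_le_augSpan C ⟨hC.antipode_mem c hc.1, ?_⟩)
      change counit (R := k) (HopfAlgebra.antipode k c) = 0
      rw [HopfAlgebra.counit_antipode]
      exact hc.2

/-- The quotient Hopf algebra `A / C⁺ A`. -/
theorem IsHopfSubalgebra.exists_quotient {C : Subalgebra k A} (hC : IsHopfSubalgebra C) :
    ∃ (B : Type u) (_ : CommRing B) (_ : HopfAlgebra k B) (f : A →ₐc[k] B),
      Function.Surjective f ∧ ∀ x, f x = 0 ↔ x ∈ augSpan C := by
  have := hC.isHopfIdeal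
  exact ⟨A ⧸ augSpanIdeal C, inferInstance, inferInstance,
    Bialgebra.Quotient.mkBialgHom (augSpanIdeal C), Ideal.Quotient.mk_surjective,
    fun x => Ideal.Quotient.eq_zero_iff_mem⟩

variable {B : Type u} [CommRing B] [HopfAlgebra k B]

/-- Kernels of morphisms of group schemes are normal. -/
theorem IsHopfSubalgebra.isNormalHom {C : Subalgebra k A} (hC : IsHopfSubalgebra C)
    {f : A →ₐc[k] B} (hf : Function.Surjective f) (hker : ∀ x, f x = 0 ↔ x ∈ augSpan C) :
    IsNormalHom f := by
  intro R _ _ g ν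
  have h1 : ∀ x ∈ C, comapPoint f ν x = (1 : WithConv (A →ₐ[k] R)) x := by
    intro x hx
    have h := (hker _).2 (augPart_le_augSpan C (sub_counit_mem_augPart hx))
    rw [map_sub, sub_eq_zero] at h
    rw [comapPoint_apply, h]
    have : f (algebraMap k A (counit x)) = algebraMap k B (counit x) :=
      AlgHomClass.commutes f _
    rw [this]
    exact ν.ofConv.commutes _
  have h2 : ∀ x ∈ C, (g * comapPoint f ν * g⁻¹) x = (1 : WithConv (A →ₐ[k] R)) x := by
    intro x hx
    have h3 : (1 : WithConv (A →ₐ[k] R)) = g * 1 * g⁻¹ := by rw [mul_one, mul_inv_cancel]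
    rw [h3]
    exact point_mul_congr hC (fun y hy => point_mul_congr hC (fun _ _ => rfl) h1 hy)
      (fun _ _ => rfl) hx
  obtain ⟨ν', hν⟩ := exists_algHom_comp_eq (f := (f : A →ₐ[k] B)) hf
    (ψ := (g * comapPoint f ν * g⁻¹).ofConv) (fun x hx => by
      refine augSpanIdeal_le (C := C) (fun c hc => ?_) ((hker x).1 hx)
      have h4 : counit (R := k) c = 0 := hc.2
      refine (h2 c hc.1).trans ?_
      rw [point_one_apply, h4, map_zero])
  refine ⟨toConv ν', ?_⟩
  apply WithConv.ofConv_injective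
  ext x
  exact (hν x).symm

/-- Invariants are constant on the subgroup. -/
theorem map_eq_of_mem_leftInvariants {f : A →ₐc[k] B} {x : A} (hx : x ∈ leftInvariants f) :
    f x = algebraMap k B (counit x) := by
  have := mem_leftInvariants_iff.1 hx B (toConv (AlgHom.id k B)) 1
  rw [mul_one] at this
  exact this

/-- Restriction of `C⁺ A` to a Hopf subalgebra `E`: the second isomorphism theorem. -/
theorem IsHopfSubalgebra.mem_augSpan_inf {C E : Subalgebra k A} (hC : IsHopfSubalgebra C)
    (hE : IsHopfSubalgebra E) {x : A} (hxE : x ∈ E) (hx : x ∈ augSpan C) :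
    x ∈ augSpan (C ⊓ E) := by
  obtain ⟨B, _, _, f, hf, hker⟩ := hC.exists_quotient
  have hn := hC.isNormalHom hf hker
  have hle : leftInvariants f ≤ C := hC.le_of_augPart_le hn.isHopfSubalgebra fun y hy => by
    have h1 : counit (R := k) y = 0 := hy.2
    rw [← hker, map_eq_of_mem_leftInvariants hy.1, h1, map_zero]
  exact augSpan_mono (inf_le_inf_right E hle)
    (augPart_mul_le_augSpan _ _ (hn.mem_augPart_mul hE hxE ((hker x).2 hx)))

/-- The modular law for Hopf subalgebras. -/
theorem IsHopfSubalgebra.le_of_le_sup {C D L : Subalgebra k A} (hC : IsHopfSubalgebra C)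
    (hD : IsHopfSubalgebra D) (hL : IsHopfSubalgebra L) (hDL : D ≤ L) (h : L ≤ C ⊔ D)
    (hCL : C ⊓ L ≤ D) : L ≤ D := by
  refine hD.le_of_le_sup_augSpan hL.isLeftCoideal hDL fun y hy => ?_
  have h1 : y ∈ Subalgebra.toSubmodule D * Subalgebra.toSubmodule C := by
    rw [Subalgebra.mul_toSubmodule, sup_comm]
    exact h hy
  have h2 : Subalgebra.toSubmodule D * Subalgebra.toSubmodule C ≤
      Subalgebra.toSubmodule D ⊔ augSpan C := by
    refine Submodule.mul_le.2 fun d hd c hc => ?_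
    have : d * c = counit (R := k) c • d + d * (c - algebraMap k A (counit c)) := by
      rw [Algebra.smul_def]
      ring
    rw [this]
    exact add_mem (Submodule.mem_sup_left (Submodule.smul_mem _ _ hd))
      (Submodule.mem_sup_right
        (mul_mem_augSpan _ (augPart_le_augSpan C (sub_counit_mem_augPart hc))))
  obtain ⟨d, hd, z, hz, rfl⟩ := Submodule.mem_sup.1 (h2 h1)
  refine add_mem (Submodule.mem_sup_left hd) (Submodule.mem_sup_right ?_)
  refine augSpan_mono hCL (hC.mem_augSpan_inf hL ?_ hz)
  simpa using L.sub_mem hy (hDL hd)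

end Quotients

/-! ### The index formula for a normal subgroup and its quotient -/

section IndexFormula

theorem rank_map_eq_of_ker_eq {k A X Y : Type u} [Field k] [AddCommGroup A] [Module k A]
    [AddCommGroup X] [Module k X] [AddCommGroup Y] [Module k Y] {u : A →ₗ[k] X} {v : A →ₗ[k] Y}
    {E : Submodule k A} (h : ∀ x ∈ E, u x = 0 ↔ v x = 0) :
    Module.rank k (E.map u) = Module.rank k (E.map v) := by
  have hk : LinearMap.ker (u ∘ₗ E.subtype) = LinearMap.ker (v ∘ₗ E.subtype) := by
    ext x
    exact h x x.2
  have e := (u ∘ₗ E.subtype).quotKerEquivRange.symm ≪≫ₗ Submodule.quotEquivOfEq _ _ hk ≪≫ₗ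
    (v ∘ₗ E.subtype).quotKerEquivRange
  rw [LinearMap.range_comp, LinearMap.range_comp, Submodule.range_subtype] at e
  exact e.rank_eq

variable {k A B : Type u} [Field k] [CommRing A] [HopfAlgebra k A] [CommRing B]
  [HopfAlgebra k B]

theorem map_augPart_mul {f : A →ₐc[k] B} {C E : Subalgebra k A} {y : B}
    (hy : y ∈ augPart (C.map (f : A →ₐ[k] B)) *
      Subalgebra.toSubmodule (E.map (f : A →ₐ[k] B))) :
    ∃ x ∈ augPart C * Subalgebra.toSubmodule E, f x = y := by
  induction hy using Submodule.mul_induction_on' with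
  | mem_mul_mem m hm n hn =>
    obtain ⟨⟨c, hc, rfl⟩, hε⟩ := hm
    obtain ⟨e, he, rfl⟩ := hn
    refine ⟨c * e, Submodule.mul_mem_mul ⟨hc, ?_⟩ he, map_mul f c e⟩
    have h1 : counit (R := k) (f c) = 0 := hε
    rw [CoalgHomClass.counit_comp_apply] at h1
    exact h1
  | add y _ z _ hy hz =>
    obtain ⟨a, ha, rfl⟩ := hy
    obtain ⟨b, hb, rfl⟩ := hz
    exact ⟨a + b, add_mem ha hb, map_add f a b⟩

theorem map_mem_augSpan (f : A →ₐc[k] B) {C : Subalgebra k A} {x : A} (hx : x ∈ augSpan C) :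
    f x ∈ augSpan (C.map (f : A →ₐ[k] B)) := by
  have hle : augSpan C ≤ (augSpan (C.map (f : A →ₐ[k] B))).comap (f : A →ₐ[k] B).toLinearMap :=
    Submodule.mul_le.2 fun a _ c hc => by
      change f (a * c) ∈ augSpan (C.map (f : A →ₐ[k] B))
      rw [map_mul]
      refine mul_mem_augSpan _ (augPart_le_augSpan _ ⟨⟨c, hc.1, rfl⟩, ?_⟩)
      change counit (R := k) (f c) = 0
      rw [CoalgHomClass.counit_comp_apply]
      exact hc.2
  exact hle hx

/-- For `K` the invariants of `N`, the preimage of `f(C)⁺ f(A)` in `E` is given by the Hopf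
subalgebra generated by `C` and `K ⊓ E`. -/
theorem IsNormalHom.map_mem_augSpan_iff {f : A →ₐc[k] B} (hf : IsNormalHom f)
    {C E : Subalgebra k A} (hC : IsHopfSubalgebra C) (hE : IsHopfSubalgebra E) (hCE : C ≤ E)
    {x : A} (hx : x ∈ E) :
    f x ∈ augSpan (C.map (f : A →ₐ[k] B)) ↔ x ∈ augSpan (C ⊔ leftInvariants f ⊓ E) := by
  rw [augSpan_sup]
  constructor
  · intro h
    obtain ⟨y, hy, hyx⟩ := map_augPart_mul (mem_augPart_mul_of_mem_augSpan (hC.map f)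
      (hE.map f).isLeftCoideal ⟨x, hx, rfl⟩ h)
    have hyE : y ∈ E := (Submodule.mul_le.2 fun _ hc _ he => E.mul_mem (hCE hc.1) he :
      augPart C * Subalgebra.toSubmodule E ≤ Subalgebra.toSubmodule E) hy
    have h2 : x - y ∈ augPart (leftInvariants f ⊓ E) * Subalgebra.toSubmodule E :=
      hf.mem_augPart_mul hE (E.sub_mem hx hyE) (by
        rw [map_sub, hyx]
        exact sub_self _)
    rw [← add_sub_cancel y x]
    exact add_mem (Submodule.mem_sup_left (augPart_mul_le_augSpan _ _ hy))
      (Submodule.mem_sup_right (augPart_mul_le_augSpan _ _ h2))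
  · intro h
    obtain ⟨y, hy, z, hz, rfl⟩ := Submodule.mem_sup.1 h
    rw [map_add]
    refine add_mem (map_mem_augSpan f hy) ?_
    have : f z = 0 := by
      refine augSpanIdeal_le (φ := (f : A →ₐ[k] B)) (fun c hc => ?_) hz
      have h2 : counit (R := k) c = 0 := hc.2
      change f c = 0
      rw [map_eq_of_mem_leftInvariants hc.1.1, h2, map_zero]
    rw [this]
    exact zero_mem _

/-- The index is the product of the index in the quotient and the index in the normal subgroup. -/
theorem IsNormalHom.hopfIndex_eq_mul {f : A →ₐc[k] B} (hf : IsNormalHom f)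
    {C E : Subalgebra k A} (hC : IsHopfSubalgebra C) (hE : IsHopfSubalgebra E) (hCE : C ≤ E) :
    hopfIndex C (Subalgebra.toSubmodule E) =
      hopfIndex (leftInvariants f ⊓ C) (Subalgebra.toSubmodule (leftInvariants f ⊓ E)) *
      hopfIndex (C.map (f : A →ₐ[k] B)) (Subalgebra.toSubmodule (E.map (f : A →ₐ[k] B))) := by
  set K := leftInvariants f with hKdef
  have hK : IsHopfSubalgebra K := hf.isHopfSubalgebra
  have hKE := hK.inf hE
  rw [hopfIndex_mul hC (hC.sup hKE) hE le_sup_left (sup_le hCE inf_le_right)]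
  congr 1
  · have h1 : (Subalgebra.toSubmodule (C ⊔ K ⊓ E)).map (augSpan C).mkQ =
        (Subalgebra.toSubmodule (K ⊓ E)).map (augSpan C).mkQ := by
      refine le_antisymm ?_ (Submodule.map_mono (le_sup_right : K ⊓ E ≤ C ⊔ K ⊓ E))
      rw [← Subalgebra.mul_toSubmodule, Submodule.map_le_iff_le_comap]
      refine Submodule.mul_le.2 fun c hc y hy => ?_
      have : c * y = counit (R := k) c • y + y * (c - algebraMap k A (counit c)) := by
        rw [Algebra.smul_def]
        ring
      refine ⟨counit (R := k) c • y, Submodule.smul_mem _ _ hy, ?_⟩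
      rw [this, map_add, left_eq_add, Submodule.mkQ_apply, Submodule.Quotient.mk_eq_zero]
      exact mul_mem_augSpan _ (augPart_le_augSpan C (sub_counit_mem_augPart hc))
    rw [hopfIndex, hopfIndex, h1]
    congr 1
    refine rank_map_eq_of_ker_eq fun x hx => ?_
    rw [Submodule.mkQ_apply, Submodule.mkQ_apply, Submodule.Quotient.mk_eq_zero,
      Submodule.Quotient.mk_eq_zero]
    refine ⟨fun h => ?_, fun h => augSpan_mono inf_le_right h⟩
    refine augSpan_mono ?_ (hC.mem_augSpan_inf hKE hx h)
    exact le_inf (inf_le_right.trans inf_le_left) inf_le_left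
  · have h1 : (Subalgebra.toSubmodule (E.map (f : A →ₐ[k] B))).map
        (augSpan (C.map (f : A →ₐ[k] B))).mkQ = (Subalgebra.toSubmodule E).map
          ((augSpan (C.map (f : A →ₐ[k] B))).mkQ ∘ₗ (f : A →ₐ[k] B).toLinearMap) := by
      rw [Submodule.map_comp]
      rfl
    rw [hopfIndex, hopfIndex, h1]
    congr 1
    refine rank_map_eq_of_ker_eq fun x hx => ?_
    rw [Submodule.mkQ_apply, LinearMap.comp_apply, Submodule.mkQ_apply,
      Submodule.Quotient.mk_eq_zero, Submodule.Quotient.mk_eq_zero]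
    exact (hf.map_mem_augSpan_iff hC hE hCE hx).symm

theorem hopfIndex_map {f : A →ₐc[k] B} (hf : Function.Injective f) {C E : Subalgebra k A}
    (hC : IsHopfSubalgebra C) (hE : IsHopfSubalgebra E) :
    hopfIndex (C.map (f : A →ₐ[k] B)) (Subalgebra.toSubmodule (E.map (f : A →ₐ[k] B))) =
      hopfIndex C (Subalgebra.toSubmodule E) := by
  have h1 : (Subalgebra.toSubmodule (E.map (f : A →ₐ[k] B))).map
      (augSpan (C.map (f : A →ₐ[k] B))).mkQ = (Subalgebra.toSubmodule E).map
        ((augSpan (C.map (f : A →ₐ[k] B))).mkQ ∘ₗ (f : A →ₐ[k] B).toLinearMap) := by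
    rw [Submodule.map_comp]
    rfl
  rw [hopfIndex, hopfIndex, h1]
  congr 1
  refine (rank_map_eq_of_ker_eq fun x hx => ?_)
  rw [Submodule.mkQ_apply, LinearMap.comp_apply, Submodule.mkQ_apply,
    Submodule.Quotient.mk_eq_zero, Submodule.Quotient.mk_eq_zero]
  refine ⟨fun h => ?_, fun h => map_mem_augSpan f h⟩
  obtain ⟨y, hy, hyx⟩ := map_augPart_mul (mem_augPart_mul_of_mem_augSpan (hC.map f)
    (hE.map f).isLeftCoideal ⟨x, hx, rfl⟩ h)
  rw [← hf hyx]
  exact augPart_mul_le_augSpan _ _ hy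

end IndexFormula

/-! ### Ideals of polynomial rings transported by a field endomorphism -/

section LeadingExponents

variable {k : Type*} [Field k] {n : ℕ}

/-- The exponents of the leading monomials of the nonzero elements of an ideal, for the
lexicographic order. -/
def leadingExponents (J : Ideal (MvPolynomial (Fin n) k)) : Set (Fin n →₀ ℕ) :=
  {a | ∃ p ∈ J, p ≠ 0 ∧ MonomialOrder.lex.degree p = a}

theorem leadingExponents_upward {J : Ideal (MvPolynomial (Fin n) k)} {a b : Fin n →₀ ℕ}
    (ha : a ∈ leadingExponents J) (hab : a ≤ b) : b ∈ leadingExponents J := by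
  classical
  obtain ⟨p, hp, hp0, rfl⟩ := ha
  have hm : MvPolynomial.monomial (b - MonomialOrder.lex.degree p) (1 : k) ≠ 0 := by simp
  refine ⟨MvPolynomial.monomial (b - MonomialOrder.lex.degree p) 1 * p, J.mul_mem_left _ hp,
    mul_ne_zero hm hp0, ?_⟩
  rw [MonomialOrder.degree_mul hm hp0, MonomialOrder.degree_monomial, if_neg one_ne_zero,
    tsub_add_cancel_of_le hab]

theorem leadingExponents_mono_map {s : k →+* k} {J J' : Ideal (MvPolynomial (Fin n) k)}
    (h : ∀ p ∈ J, MvPolynomial.map s p ∈ J') : leadingExponents J ⊆ leadingExponents J' := by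
  rintro _ ⟨p, hp, hp0, rfl⟩
  refine ⟨MvPolynomial.map s p, h p hp, ?_, ?_⟩
  · rwa [Ne, map_eq_zero_iff _ (MvPolynomial.map_injective s s.injective)]
  · rw [MonomialOrder.degree, MonomialOrder.degree,
      MvPolynomial.support_map_of_injective _ s.injective]

/-- Dickson's lemma for an increasing sequence of sets of leading exponents. -/
theorem exists_leadingExponents_eq {J : ℕ → Ideal (MvPolynomial (Fin n) k)}
    (h : ∀ i, leadingExponents (J i) ⊆ leadingExponents (J (i + 1))) :
    ∃ m, ∀ i, m ≤ i → leadingExponents (J (i + 1)) = leadingExponents (J i) := by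
  let I : ℕ →o Ideal (MvPolynomial (Fin n) k) :=
    ⟨fun i => Ideal.span ((fun a => MvPolynomial.monomial a (1 : k)) '' leadingExponents (J i)),
      monotone_nat_of_le_succ fun i => Ideal.span_mono (Set.image_mono (h i))⟩
  obtain ⟨m, hm⟩ := monotone_stabilizes_iff_noetherian.2
    (inferInstance : IsNoetherianRing (MvPolynomial (Fin n) k)) I
  refine ⟨m, fun i hi => Set.Subset.antisymm (fun a ha => ?_) (h i)⟩
  have h1 : MvPolynomial.monomial a (1 : k) ∈ I i := by
    rw [← hm i hi, hm (i + 1) (by omega)]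
    exact Ideal.subset_span ⟨a, ha, rfl⟩
  obtain ⟨b, hb, hba⟩ := MvPolynomial.mem_ideal_span_monomial_image.1 h1 a (by simp)
  exact leadingExponents_upward hb hba

/-- If `σ(J) ⊆ J'` and the leading exponents of `J'` are already leading exponents of `J`, then
every ring homomorphism killing `σ(J)` kills `J'`: cancelling leading terms shows that `J'` is
spanned by `σ(J)` over `k`. -/
theorem eq_zero_of_leadingExponents_eq {s : k →+* k} {J J' : Ideal (MvPolynomial (Fin n) k)}
    (h : ∀ p ∈ J, MvPolynomial.map s p ∈ J') (hJ : leadingExponents J' ⊆ leadingExponents J)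
    {T : Type*} [Ring T] (θ : MvPolynomial (Fin n) k →+* T)
    (hθ : ∀ p ∈ J, θ (MvPolynomial.map s p) = 0) : ∀ q ∈ J', θ q = 0 := by
  classical
  have key : ∀ (d : MonomialOrder.lex.syn) (q : MvPolynomial (Fin n) k), q ∈ J' →
      MonomialOrder.lex.toSyn (MonomialOrder.lex.degree q) = d → θ q = 0 := by
    intro d
    induction d using WellFoundedLT.induction with
    | ind d ih =>
      intro q hq hd
      by_cases hq0 : q = 0
      · rw [hq0, map_zero]
      obtain ⟨p, hp, hp0, hpq⟩ := hJ ⟨q, hq, hq0, rfl⟩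
      set a := MonomialOrder.lex.degree q with ha
      have hpa : p.coeff a ≠ 0 := by
        rw [← hpq]
        exact MonomialOrder.coeff_degree_ne_zero_iff.2 hp0
      have hspa : s (p.coeff a) ≠ 0 := (map_ne_zero s).2 hpa
      set r := MvPolynomial.C (q.coeff a / s (p.coeff a)) * MvPolynomial.map s p with hr
      have hrJ : r ∈ J' := J'.mul_mem_left _ (h p hp)
      have hθr : θ r = 0 := by rw [hr, map_mul, hθ p hp, mul_zero]
      have hc : (q - r).coeff a = 0 := by
        rw [MvPolynomial.coeff_sub, hr, MvPolynomial.coeff_C_mul, MvPolynomial.coeff_map,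
          div_mul_cancel₀ _ hspa, sub_self]
      rw [← sub_add_cancel q r, map_add, hθr, add_zero]
      by_cases hz : q - r = 0
      · rw [hz, map_zero]
      refine ih _ ?_ (q - r) (J'.sub_mem hq hrJ) rfl
      have hb : (q - r).coeff (MonomialOrder.lex.degree (q - r)) ≠ 0 :=
        MonomialOrder.coeff_degree_ne_zero_iff.2 hz
      rw [← hd]
      refine lt_of_le_of_ne ?_ fun he => ?_
      · by_cases h1 : q.coeff (MonomialOrder.lex.degree (q - r)) = 0
        · rw [MvPolynomial.coeff_sub, h1, zero_sub, neg_ne_zero, hr, MvPolynomial.coeff_C_mul,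
            MvPolynomial.coeff_map] at hb
          rw [← hpq]
          refine MonomialOrder.le_degree (MvPolynomial.mem_support_iff.2 fun h2 => hb ?_)
          rw [h2, map_zero, mul_zero]
        · exact MonomialOrder.le_degree (MvPolynomial.mem_support_iff.2 h1)
      · rw [MonomialOrder.lex.toSyn.injective he] at hb
        exact hb hc
  exact fun q hq => key _ q hq rfl

end LeadingExponents

/-! ### Towers of Hopf subalgebras -/

section Towers

variable {k A : Type*} [Field k] [CommRing A] [DifferenceRing A]

/-- The `k`-subalgebra generated by `σ(C)`. -/
def sigmaAdjoin [Algebra k A] (C : Subalgebra k A) : Subalgebra k A :=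
  Algebra.adjoin k (dsigma '' (C : Set A))

section Basic

variable [Algebra k A]

theorem dsigma_mem_sigmaAdjoin {C : Subalgebra k A} {x : A} (hx : x ∈ C) :
    dsigma x ∈ sigmaAdjoin C := Algebra.subset_adjoin ⟨x, hx, rfl⟩

theorem sigmaAdjoin_le {C D : Subalgebra k A} (h : ∀ x ∈ C, dsigma x ∈ D) : sigmaAdjoin C ≤ D :=
  Algebra.adjoin_le (by
    rintro _ ⟨x, hx, rfl⟩
    exact h x hx)

theorem sigmaAdjoin_mono {C D : Subalgebra k A} (h : C ≤ D) : sigmaAdjoin C ≤ sigmaAdjoin D :=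
  sigmaAdjoin_le fun _ hx => dsigma_mem_sigmaAdjoin (h hx)

/-- `σ(C)` is closed under products, so it spans the subalgebra which it generates. -/
theorem toSubmodule_sigmaAdjoin (C : Subalgebra k A) :
    Subalgebra.toSubmodule (sigmaAdjoin C) = Submodule.span k (dsigma '' (C : Set A)) := by
  rw [sigmaAdjoin, Algebra.adjoin_eq_span]
  congr 1
  exact congrArg (fun M : Submonoid A => (M : Set A))
    (Submonoid.closure_eq (C.toSubmonoid.map (dsigma : A →+* A)))

theorem sigmaAdjoin_adjoin [DifferenceRing k] [DifferenceAlgebra k A] (s : Set A) :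
    sigmaAdjoin (Algebra.adjoin k s) = Algebra.adjoin k (dsigma '' s) := by
  refine le_antisymm (sigmaAdjoin_le fun x hx => ?_) (Algebra.adjoin_mono
    (Set.image_mono Algebra.subset_adjoin))
  induction hx using Algebra.adjoin_induction with
  | mem x hx => exact Algebra.subset_adjoin ⟨x, hx, rfl⟩
  | algebraMap c =>
    rw [DifferenceAlgebra.sigma_algebraMap]
    exact Subalgebra.algebraMap_mem _ _
  | add x y _ _ hx hy => rw [map_add]; exact add_mem hx hy
  | mul x y _ _ hx hy => rw [map_mul]; exact mul_mem hx hy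

theorem sigmaAdjoin_sup [DifferenceRing k] [DifferenceAlgebra k A] (C D : Subalgebra k A) :
    sigmaAdjoin (C ⊔ D) = sigmaAdjoin C ⊔ sigmaAdjoin D := by
  have h : C ⊔ D = Algebra.adjoin k ((C : Set A) ∪ D) := rfl
  rw [h, sigmaAdjoin_adjoin, Set.image_union, Algebra.adjoin_union]
  rfl

end Basic

theorem IsHopfSubalgebra.sigmaAdjoin [DifferenceRing k] [HopfAlgebra k A]
    [DifferenceHopfAlgebra k A] {C : Subalgebra k A} (hC : IsHopfSubalgebra C) :
    IsHopfSubalgebra (sigmaAdjoin C) := by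
  refine isHopfSubalgebra_adjoin ?_ ?_
  · rintro _ ⟨x, hx, rfl⟩
    obtain ⟨n, a, b, ha, hb, e⟩ := exists_sum_tmul_of_mem_range_map (hC.comul_mem x hx)
    rw [DifferenceHopfAlgebra.sigma_comul, e, map_sum]
    refine sum_mem fun i _ => ?_
    rw [DifferenceAlgebra.dsigma_tmul]
    exact tmul_mem_tensorSquare (dsigma_mem_sigmaAdjoin (ha i)) (dsigma_mem_sigmaAdjoin (hb i))
  · rintro _ ⟨x, hx, rfl⟩
    rw [DifferenceHopfAlgebra.sigma_antipode]
    exact dsigma_mem_sigmaAdjoin (hC.antipode_mem x hx)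

/-- An exhaustive sequence of Hopf subalgebras, each generated by the preceding one and its image
under `σ`. For a `σ`-closed embedding of `G` into an algebraic group, the coordinate rings of the
Zariski closures of `G` are of this kind. -/
structure IsTower [HopfAlgebra k A] (S : ℕ → Subalgebra k A) : Prop where
  hopf : ∀ i, IsHopfSubalgebra (S i)
  fg : (S 0).FG
  succ : ∀ i, S (i + 1) = S i ⊔ sigmaAdjoin (S i)
  exhaust : ∀ x, ∃ i, x ∈ S i

namespace IsTower

variable [HopfAlgebra k A] {S S' : ℕ → Subalgebra k A}

theorem monotone (hS : IsTower S) : Monotone S :=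
  monotone_nat_of_le_succ fun i => by rw [hS.succ]; exact le_sup_left

theorem sigma_mem (hS : IsTower S) (i : ℕ) : ∀ x ∈ S i, dsigma x ∈ S (i + 1) := fun x hx => by
  rw [hS.succ]
  exact (le_sup_right : sigmaAdjoin (S i) ≤ _) (dsigma_mem_sigmaAdjoin hx)

theorem exists_le (hS : IsTower S) {C : Subalgebra k A} (hC : C.FG) : ∃ c, C ≤ S c := by
  obtain ⟨t, rfl⟩ := hC
  choose f hf using hS.exhaust
  exact ⟨t.sup f, Algebra.adjoin_le fun x hx => hS.monotone (Finset.le_sup hx) (hf x)⟩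

/-- A tower is cofinal, up to a shift, in every other one. -/
theorem exists_le_add (hS : IsTower S) (hS' : IsTower S') : ∃ c, ∀ i, S i ≤ S' (i + c) := by
  obtain ⟨c, hc⟩ := hS'.exists_le hS.fg
  refine ⟨c, fun i => ?_⟩
  induction i with
  | zero => simpa using hc
  | succ i ih =>
    rw [hS.succ, add_right_comm, hS'.succ]
    exact sup_le_sup ih (sigmaAdjoin_mono ih)

theorem hopfIndex_add (hS : IsTower S) {d : ℕ∞} {m : ℕ}
    (h : ∀ i, m ≤ i → hopfIndex (S i) (Subalgebra.toSubmodule (S (i + 1))) = d) {a : ℕ}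
    (ha : m ≤ a) (n : ℕ) : hopfIndex (S a) (Subalgebra.toSubmodule (S (a + n))) = d ^ n := by
  induction n with
  | zero => rw [add_zero, hopfIndex_self, pow_zero]
  | succ n ih =>
    rw [hopfIndex_mul (hS.hopf a) (hS.hopf (a + n)) (hS.hopf _) (hS.monotone (by omega))
      (hS.monotone (by omega)), ih, pow_succ]
    exact congrArg _ (h (a + n) (by omega))

/-- Two towers interleave up to a shift, so that the powers of their eventual indices `d`, `d'`
satisfy `d' ^ n ≤ d ^ (n + c)` for a constant `c` and all `n`. -/
theorem le_of_eventually (hS : IsTower S) (hS' : IsTower S') {d d' : ℕ∞} {m m' : ℕ}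
    (h : ∀ i, m ≤ i → hopfIndex (S i) (Subalgebra.toSubmodule (S (i + 1))) = d)
    (h' : ∀ i, m' ≤ i → hopfIndex (S' i) (Subalgebra.toSubmodule (S' (i + 1))) = d') :
    d' ≤ d := by
  obtain ⟨c, hc⟩ := hS.exists_le_add hS'
  obtain ⟨c', hc'⟩ := hS'.exists_le_add hS
  have key : ∀ n, d' ^ n ≤ d ^ (c + n + c') := fun n => by
    rw [← hS'.hopfIndex_add h' (a := max m m' + c) (by omega) n,
      ← hS.hopfIndex_add h (a := max m m') (by omega) (c + n + c')]
    refine (hopfIndex_anti (hc _) _).trans (hopfIndex_mono ?_)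
    have := hc' (max m m' + c + n)
    rw [show max m m' + c + n + c' = max m m' + (c + n + c') by omega] at this
    exact this
  have hd0 : d ≠ 0 := by
    rw [← h m le_rfl]
    exact hopfIndex_ne_zero (S (m + 1)).one_mem
  induction d using ENat.recTopCoe with
  | top => exact le_top
  | coe d =>
    induction d' using ENat.recTopCoe with
    | top =>
      have := key 1
      rw [pow_one] at this
      exact absurd (top_le_iff.1 this) (by exact_mod_cast ENat.natCast_ne_top (d ^ (c + 1 + c')))
    | coe d' =>
      have hd : (0 : ℝ) < d := by
        have : d ≠ 0 := by exact_mod_cast hd0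
        positivity
      by_contra hlt
      have hlt' : d < d' := by exact_mod_cast not_le.1 hlt
      have h1 : (1 : ℝ) < d' / d := by
        rw [one_lt_div hd]
        exact_mod_cast hlt'
      obtain ⟨n, hn⟩ := pow_unbounded_of_one_lt ((d : ℝ) ^ (c + c')) h1
      have h2 : (d' : ℝ) ^ n ≤ (d : ℝ) ^ (c + n + c') := by
        have := key n
        exact_mod_cast this
      rw [div_pow, lt_div_iff₀ (pow_pos hd n), ← pow_add] at hn
      rw [show c + n + c' = c + c' + n by omega] at h2
      exact absurd h2 (not_le.2 hn)

end IsTower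

end Towers

/-! ### Stabilisation of the kernels in a tower -/

section Stabilisation

variable {k A : Type*} [Field k] [CommRing A] [HopfAlgebra k A] {S : ℕ → Subalgebra k A}

theorem kernelRing_mk_surjective (i : ℕ) : Function.Surjective (KernelRing.mk S i) :=
  Ideal.Quotient.mkₐ_surjective k (kernelIdeal S i)

theorem kernelRing_mk_eq_counit {i : ℕ} {x : A} (hx : x ∈ S i) (hx' : x ∈ S (i + 1)) :
    KernelRing.mk S (i + 1) ⟨x, hx'⟩ = algebraMap k _ (counit x) := by
  rw [← AlgHom.commutes (KernelRing.mk S (i + 1)), ← sub_eq_zero, ← map_sub]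
  refine Ideal.Quotient.eq_zero_iff_mem.2 (Ideal.subset_span ?_)
  exact ⟨(S i).sub_mem hx ((S i).algebraMap_mem _), (sub_counit_mem_augPart hx).2⟩

variable [DifferenceRing A]

theorem IsTower.kernelIdeal_eq (hS : IsTower S) (i : ℕ) :
    kernelIdeal S (i + 1) = augIdeal (S i) (S (i + 1)) := by
  refine le_antisymm (Ideal.span_le.2 fun x hx => augPart_le_augSpan (S i) hx) fun x hx => ?_
  have h := mem_augPart_mul_of_mem_augSpan (hS.hopf i) (hS.hopf (i + 1)).isLeftCoideal x.2
    (mem_augIdeal.1 hx)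
  have hle : ∀ y ∈ augPart (S i) * Subalgebra.toSubmodule (S (i + 1)), ∃ hy : y ∈ S (i + 1),
      (⟨y, hy⟩ : S (i + 1)) ∈ kernelIdeal S (i + 1) := by
    intro y hy
    induction hy using Submodule.mul_induction_on' with
    | mem_mul_mem m hm n hn =>
      have hm' := hS.monotone (Nat.le_succ i) hm.1
      exact ⟨mul_mem hm' hn, Ideal.mul_mem_right (⟨n, hn⟩ : S (i + 1)) _
        (Ideal.subset_span ⟨hm.1, hm.2⟩ : (⟨m, hm'⟩ : S (i + 1)) ∈ kernelIdeal S (i + 1))⟩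
    | add x _ y _ hx hy =>
      obtain ⟨h1, h2⟩ := hx
      obtain ⟨g1, g2⟩ := hy
      exact ⟨add_mem h1 g1, Ideal.add_mem _ h2 g2⟩
  exact (hle _ h).2

theorem IsTower.mk_eq_zero_iff (hS : IsTower S) {i : ℕ}
    (x : S (i + 1)) : KernelRing.mk S (i + 1) x = 0 ↔ (x : A) ∈ augSpan (S i) := by
  rw [← mem_augIdeal (D := S (i + 1)), ← hS.kernelIdeal_eq]
  exact Ideal.Quotient.eq_zero_iff_mem

theorem IsTower.toENat_rank_kernelRing (hS : IsTower S) (i : ℕ) :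
    Cardinal.toENat (Module.rank k (KernelRing S (i + 1))) =
      hopfIndex (S i) (Subalgebra.toSubmodule (S (i + 1))) := by
  have e : KernelRing S (i + 1) ≃ₗ[k] (S (i + 1) ⧸ augIdeal (S i) (S (i + 1))) :=
    (Ideal.quotientEquivAlgOfEq k (hS.kernelIdeal_eq i)).toLinearEquiv
  rw [(e ≪≫ₗ quotientAugIdealEquiv (S i) (S (i + 1))).rank_eq]
  rfl

/-- The identity map of `k`, as a map to `k` regarded as an algebra over itself by means of `σ`. -/
def toTwist (k : Type*) [CommRing k] : k →+* SigmaTwist k := RingHom.id k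

theorem exists_toTwist (c : SigmaTwist k) : ∃ d, toTwist k d = c := ⟨c, rfl⟩

variable [DifferenceRing k] [DifferenceHopfAlgebra k A]

theorem smul_toTwist (c d : k) : c • toTwist k d = toTwist k (dsigma c * d) :=
  Algebra.smul_def (R := k) (A := SigmaTwist k) c d

theorem toTwist_tmul_smul {V : Type*} [AddCommGroup V] [Module k V] (c d : k) (v : V) :
    toTwist k d ⊗ₜ[k] (c • v) = toTwist k (dsigma c * d) ⊗ₜ[k] v := by
  rw [← TensorProduct.smul_tmul, smul_toTwist]

/-- The map dual to `σ_{i+1} : 𝒢_{i+1} → ^σ(𝒢_i)`, as a map to the ring `k[𝒢_{i+1}]`. -/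
def kernelDual (hS : ∀ i, ∀ x ∈ S i, dsigma x ∈ S (i + 1)) (i : ℕ) :
    SigmaTwist k ⊗[k] KernelRing S i →+* KernelRing S (i + 1) :=
  (KernelRing.sigmaDual hS i).toRingHom

theorem kernelDual_tmul (hS : ∀ i, ∀ x ∈ S i, dsigma x ∈ S (i + 1)) {i : ℕ} (c : k)
    (f : KernelRing S i) :
    kernelDual hS i (toTwist k c ⊗ₜ f) = c • KernelRing.sigmaMap hS i f :=
  KernelRing.sigmaDual_tmul hS i c f

/-- `k[𝒢_{i+1}]` is spanned by the image of `σ`. -/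
theorem IsTower.span_sigmaMap (hS : IsTower S) (i : ℕ) :
    Submodule.span k (Set.range (KernelRing.sigmaMap hS.sigma_mem i)) = ⊤ := by
  set W := Submodule.span k (Set.range (KernelRing.sigmaMap hS.sigma_mem i)) with hW
  refine top_le_iff.1 fun z _ => ?_
  obtain ⟨⟨x, hx⟩, rfl⟩ := kernelRing_mk_surjective (i + 1) z
  have h : x ∈ Subalgebra.toSubmodule (S i) * Submodule.span k (dsigma '' (S i : Set A)) := by
    rw [← toSubmodule_sigmaAdjoin, Subalgebra.mul_toSubmodule, ← hS.succ]
    exact hx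
  have hle : ∀ y ∈ Subalgebra.toSubmodule (S i) * Submodule.span k (dsigma '' (S i : Set A)),
      ∃ hy : y ∈ S (i + 1), KernelRing.mk S (i + 1) ⟨y, hy⟩ ∈ W := by
    intro y hy
    induction hy using Submodule.mul_induction_on' with
    | mem_mul_mem m hm n hn =>
      have hm' := hS.monotone (Nat.le_succ i) hm
      have hn' : ∃ hn : n ∈ S (i + 1), KernelRing.mk S (i + 1) ⟨n, hn⟩ ∈ W := by
        induction hn using Submodule.span_induction with
        | mem n hn =>
          obtain ⟨y, hy, rfl⟩ := hn
          exact ⟨hS.sigma_mem i y hy, Submodule.subset_span ⟨KernelRing.mk S i ⟨y, hy⟩, rfl⟩⟩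
        | zero => exact ⟨zero_mem _, by
            have : (⟨0, zero_mem _⟩ : S (i + 1)) = 0 := rfl
            rw [this, map_zero]
            exact zero_mem W⟩
        | add a b _ _ ha hb =>
          obtain ⟨h1, h2⟩ := ha
          obtain ⟨g1, g2⟩ := hb
          refine ⟨add_mem h1 g1, ?_⟩
          have : (⟨a + b, add_mem h1 g1⟩ : S (i + 1)) = ⟨a, h1⟩ + ⟨b, g1⟩ := rfl
          rw [this, map_add]
          exact add_mem h2 g2
        | smul c a _ ha =>
          obtain ⟨h1, h2⟩ := ha
          refine ⟨Subalgebra.smul_mem _ h1 c, ?_⟩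
          have : (⟨c • a, Subalgebra.smul_mem _ h1 c⟩ : S (i + 1)) = c • ⟨a, h1⟩ := rfl
          rw [this, map_smul]
          exact W.smul_mem c h2
      obtain ⟨h1, h2⟩ := hn'
      refine ⟨mul_mem hm' h1, ?_⟩
      have : (⟨m * n, mul_mem hm' h1⟩ : S (i + 1)) = ⟨m, hm'⟩ * ⟨n, h1⟩ := rfl
      rw [this, map_mul, kernelRing_mk_eq_counit hm, ← Algebra.smul_def]
      exact W.smul_mem _ h2
    | add a _ b _ ha hb =>
      obtain ⟨h1, h2⟩ := ha
      obtain ⟨g1, g2⟩ := hb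
      refine ⟨add_mem h1 g1, ?_⟩
      have : (⟨a + b, add_mem h1 g1⟩ : S (i + 1)) = ⟨a, h1⟩ + ⟨b, g1⟩ := rfl
      rw [this, map_add]
      exact add_mem h2 g2
  exact (hle x h).2

theorem IsTower.kernelDual_surjective (hS : IsTower S) (i : ℕ) :
    Function.Surjective (kernelDual hS.sigma_mem i) := by
  intro z
  have hz : z ∈ Submodule.span k (Set.range (KernelRing.sigmaMap hS.sigma_mem i)) := by
    rw [hS.span_sigmaMap]
    trivial
  induction hz using Submodule.span_induction with
  | mem x hx =>
    obtain ⟨y, rfl⟩ := hx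
    exact ⟨toTwist k 1 ⊗ₜ[k] y, by rw [kernelDual_tmul, one_smul]⟩
  | zero => exact ⟨0, map_zero _⟩
  | add a b _ _ ha hb =>
    obtain ⟨s, rfl⟩ := ha
    obtain ⟨t, rfl⟩ := hb
    exact ⟨s + t, map_add _ _ _⟩
  | smul c a _ ha =>
    obtain ⟨s, rfl⟩ := ha
    refine ⟨toTwist k c ⊗ₜ[k] 1 * s, ?_⟩
    rw [map_mul, kernelDual_tmul, map_one, smul_one_mul]

/-- The generators of `k[𝒢_i]` obtained from generators `b` of `k[𝒢_0]` by applying `σ^i`. -/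
def kernelGenerators (hS : ∀ i, ∀ x ∈ S i, dsigma x ∈ S (i + 1)) {n : ℕ} (b : Fin n → S 0) :
    (i : ℕ) → Fin n → KernelRing S i
  | 0 => fun l => KernelRing.mk S 0 (b l)
  | i + 1 => fun l => KernelRing.sigmaMap hS i (kernelGenerators hS b i l)

theorem aeval_kernelGenerators_succ (hS : ∀ i, ∀ x ∈ S i, dsigma x ∈ S (i + 1)) {n : ℕ}
    (b : Fin n → S 0) (i : ℕ) (p : MvPolynomial (Fin n) k) :
    MvPolynomial.aeval (kernelGenerators hS b (i + 1)) (MvPolynomial.map dsigma p) =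
      KernelRing.sigmaMap hS i (MvPolynomial.aeval (kernelGenerators hS b i) p) := by
  induction p using MvPolynomial.induction_on with
  | C c => simp [KernelRing.sigmaMap_algebraMap]
  | add p q hp hq => simp only [map_add, hp, hq]
  | mul_X p l hp =>
    simp only [map_mul, hp, MvPolynomial.map_X, MvPolynomial.aeval_X]
    rfl

theorem IsTower.aeval_kernelGenerators_surjective (hS : IsTower S) {n : ℕ} {b : Fin n → S 0}
    (hb : Algebra.adjoin k (Set.range b) = ⊤) (i : ℕ) : Function.Surjective
      (MvPolynomial.aeval (R := k) (kernelGenerators hS.sigma_mem b i)) := by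
  induction i with
  | zero =>
    intro z
    obtain ⟨x, rfl⟩ := kernelRing_mk_surjective 0 z
    have hx : x ∈ Algebra.adjoin k (Set.range b) := hb ▸ trivial
    rw [Algebra.adjoin_range_eq_range_aeval] at hx
    obtain ⟨p, rfl⟩ := hx
    exact ⟨p, (MvPolynomial.comp_aeval_apply _ _ _).symm⟩
  | succ i ih =>
    intro z
    have hz : z ∈ Submodule.span k (Set.range (KernelRing.sigmaMap hS.sigma_mem i)) := by
      rw [hS.span_sigmaMap]
      trivial
    have hle : Submodule.span k (Set.range (KernelRing.sigmaMap hS.sigma_mem i)) ≤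
        LinearMap.range (MvPolynomial.aeval (R := k)
          (kernelGenerators hS.sigma_mem b (i + 1))).toLinearMap := by
      refine Submodule.span_le.2 ?_
      rintro _ ⟨y, rfl⟩
      obtain ⟨p, rfl⟩ := ih y
      exact ⟨MvPolynomial.map dsigma p, aeval_kernelGenerators_succ _ b i p⟩
    exact hle hz

/-- The morphisms `σ_{i+1} : 𝒢_{i+1} → ^σ(𝒢_i)` are eventually isomorphisms. With the `σ^i` of fixed
generators of `k[𝒢_0]` as generators of `k[𝒢_i]`, the ideal of relations of `k[𝒢_i]` is mapped
by `σ` into that of `k[𝒢_{i+1}]`, so the leading exponents of the ideals increase, hence stabilise;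
and when they do, the image of the former ideal generates the latter. -/
theorem IsTower.exists_sigmaDual_bijective (hS : IsTower S) :
    ∃ m, ∀ i, m ≤ i → Function.Bijective (KernelRing.sigmaDual hS.sigma_mem i) := by
  obtain ⟨n, b, hb⟩ : ∃ (n : ℕ) (b : Fin n → S 0), Algebra.adjoin k (Set.range b) = ⊤ := by
    have : Algebra.FiniteType k (S 0) := (S 0).fg_iff_finiteType.1 hS.fg
    obtain ⟨t, ht⟩ := this.out
    refine ⟨t.card, fun l => (t.equivFin.symm l : S 0), ?_⟩
    rw [← ht]
    congr 1
    ext x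
    exact ⟨fun ⟨l, hl⟩ => hl ▸ (t.equivFin.symm l).2,
      fun hx => ⟨t.equivFin ⟨x, hx⟩, by simp⟩⟩
  set g := kernelGenerators hS.sigma_mem b with hg
  let J : ℕ → Ideal (MvPolynomial (Fin n) k) := fun i =>
    RingHom.ker (MvPolynomial.aeval (R := k) (g i))
  have hJ : ∀ i, ∀ p ∈ J i, MvPolynomial.map dsigma p ∈ J (i + 1) := fun i p hp => by
    rw [RingHom.mem_ker, hg, aeval_kernelGenerators_succ, ← hg, RingHom.mem_ker.1 hp, map_zero]
  obtain ⟨m, hm⟩ := exists_leadingExponents_eq fun i => leadingExponents_mono_map (hJ i)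
  refine ⟨m, fun i hi => ⟨?_, hS.kernelDual_surjective i⟩⟩
  change Function.Injective (kernelDual hS.sigma_mem i)
  -- the evaluation of polynomials in `^σ(k[𝒢_i])`
  let θ : MvPolynomial (Fin n) k →+* SigmaTwist k ⊗[k] KernelRing S i :=
    MvPolynomial.eval₂Hom
      ((Algebra.TensorProduct.includeLeft :
        SigmaTwist k →ₐ[k] SigmaTwist k ⊗[k] KernelRing S i).toRingHom.comp (toTwist k))
      (fun l => 1 ⊗ₜ[k] g i l)
  have hθC : ∀ c : k, θ (MvPolynomial.C c) = toTwist k c ⊗ₜ[k] (1 : KernelRing S i) :=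
    fun c => MvPolynomial.eval₂Hom_C _ _ _
  have hθX : ∀ l, θ (MvPolynomial.X l) = 1 ⊗ₜ[k] g i l :=
    fun l => MvPolynomial.eval₂Hom_X' _ _ _
  have hθmap : ∀ p, θ (MvPolynomial.map dsigma p) =
      1 ⊗ₜ[k] MvPolynomial.aeval (R := k) (g i) p := by
    intro p
    induction p using MvPolynomial.induction_on with
    | C c =>
      rw [MvPolynomial.map_C, hθC, MvPolynomial.algHom_C]
      rw [Algebra.algebraMap_eq_smul_one, ← map_one (toTwist k), toTwist_tmul_smul, mul_one]
    | add p q hp hq => simp only [map_add, hp, hq, TensorProduct.tmul_add]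
    | mul_X p l hp =>
      rw [map_mul, map_mul, hp, MvPolynomial.map_X, hθX, Algebra.TensorProduct.tmul_mul_tmul,
        one_mul, map_mul, MvPolynomial.aeval_X]
  have hθs : ∀ t, ∃ p, θ p = t := by
    intro t
    induction t using TensorProduct.induction_on with
    | zero => exact ⟨0, map_zero _⟩
    | add s t hs ht =>
      obtain ⟨p, rfl⟩ := hs
      obtain ⟨q, rfl⟩ := ht
      exact ⟨p + q, map_add _ _ _⟩
    | tmul c z =>
      obtain ⟨c, rfl⟩ := exists_toTwist c
      obtain ⟨p, rfl⟩ := hS.aeval_kernelGenerators_surjective hb i z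
      refine ⟨MvPolynomial.C c * MvPolynomial.map dsigma p, ?_⟩
      rw [map_mul, hθC, hθmap, Algebra.TensorProduct.tmul_mul_tmul, mul_one, one_mul]
  have hdual : ∀ p, kernelDual hS.sigma_mem i (θ p) =
      MvPolynomial.aeval (R := k) (g (i + 1)) p := by
    intro p
    induction p using MvPolynomial.induction_on with
    | C c =>
      rw [hθC, kernelDual_tmul, map_one, MvPolynomial.algHom_C, Algebra.algebraMap_eq_smul_one]
    | add p q hp hq => rw [map_add, map_add, hp, hq, map_add]
    | mul_X p l hp =>
      rw [map_mul, map_mul, hp, hθX, ← map_one (toTwist k), kernelDual_tmul, map_mul,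
        MvPolynomial.aeval_X, one_smul]
      rfl
  rw [injective_iff_map_eq_zero]
  intro t ht
  obtain ⟨p, rfl⟩ := hθs t
  rw [hdual] at ht
  refine eq_zero_of_leadingExponents_eq (hJ i) (hm i hi).le θ (fun q hq => ?_) p ht
  rw [hθmap, RingHom.mem_ker.1 hq, TensorProduct.tmul_zero]

/-- Base change along `σ : k → k` preserves the dimension of a coordinate ring. -/
theorem rank_kernelRing_succ (hS : ∀ i, ∀ x ∈ S i, dsigma x ∈ S (i + 1)) {i : ℕ}
    (h : Function.Bijective (KernelRing.sigmaDual hS i)) :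
    Module.rank k (KernelRing S (i + 1)) = Module.rank k (KernelRing S i) := by
  let b := Module.Free.chooseBasis k (KernelRing S i)
  have hli : LinearIndependent k fun j => KernelRing.sigmaMap hS i (b j) := by
    rw [linearIndependent_iff']
    intro s c hc j hj
    have h0 : kernelDual hS i (∑ l : s, toTwist k (c l) ⊗ₜ[k] b l) = 0 := by
      rw [map_sum, ← hc, ← Finset.sum_coe_sort s]
      exact Finset.sum_congr rfl fun l _ => kernelDual_tmul hS _ _
    exact eq_zero_of_sum_tmul_eq_zero (b.linearIndependent.comp _ Subtype.val_injective)
      ((injective_iff_map_eq_zero (kernelDual hS i)).1 h.1 _ h0) ⟨j, hj⟩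
  have hsp : ⊤ ≤ Submodule.span k (Set.range fun j => KernelRing.sigmaMap hS i (b j)) := by
    intro z _
    obtain ⟨t, rfl⟩ : ∃ t, kernelDual hS i t = z := h.2 z
    induction t using TensorProduct.induction_on with
    | zero => rw [map_zero]; exact zero_mem _
    | add s t hs ht => rw [map_add]; exact add_mem (hs trivial) (ht trivial)
    | tmul c x =>
      obtain ⟨c, rfl⟩ := exists_toTwist c
      have hx : x ∈ Submodule.span k (Set.range b) := by rw [b.span_eq]; trivial
      rw [kernelDual_tmul]
      refine Submodule.smul_mem _ _ ?_
      induction hx using Submodule.span_induction with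
      | mem x hx =>
        obtain ⟨j, rfl⟩ := hx
        exact Submodule.subset_span ⟨j, rfl⟩
      | zero => rw [map_zero]; exact zero_mem _
      | add x y _ _ hx hy => rw [map_add]; exact add_mem (hx trivial) (hy trivial)
      | smul d x _ hx =>
        rw [Algebra.smul_def, map_mul, KernelRing.sigmaMap_algebraMap, ← Algebra.smul_def]
        exact Submodule.smul_mem _ _ (hx trivial)
  rw [← (Module.Basis.mk hli hsp).mk_eq_rank'', b.mk_eq_rank'']

theorem IsTower.exists_hopfIndex_eq (hS : IsTower S) :
    ∃ m d, ∀ i, m ≤ i → hopfIndex (S i) (Subalgebra.toSubmodule (S (i + 1))) = d := by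
  obtain ⟨m, hm⟩ := hS.exists_sigmaDual_bijective
  refine ⟨m, Cardinal.toENat (Module.rank k (KernelRing S m)), fun i hi => ?_⟩
  rw [← hS.toENat_rank_kernelRing]
  congr 1
  induction i, hi using Nat.le_induction with
  | base => exact rank_kernelRing_succ _ (hm m le_rfl)
  | succ i hi ih => rw [← ih, rank_kernelRing_succ _ (hm (i + 1) (by omega))]

end Stabilisation

/-! ### The tower of Zariski closures -/

section Image

variable {k A N : Type*} [Field k] [CommRing A] [DifferenceRing A] [HopfAlgebra k A] [CommRing N]
  [DifferenceRing N] [HopfAlgebra k N]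

theorem map_sigmaAdjoin (ρ : SigmaHopfHom k A N) (C : Subalgebra k A) :
    (sigmaAdjoin C).map (ρ.toBialgHom : A →ₐ[k] N) =
      sigmaAdjoin (C.map (ρ.toBialgHom : A →ₐ[k] N)) := by
  rw [sigmaAdjoin, sigmaAdjoin, AlgHom.map_adjoin, Subalgebra.coe_map, Set.image_image,
    Set.image_image]
  congr 1
  exact Set.image_congr fun x _ => ρ.map_sigma x

/-- The image of a tower on `k{G}` in `k{N}` is a tower, for a `σ`-closed subgroup `N`. -/
theorem IsTower.map {S : ℕ → Subalgebra k A} (hS : IsTower S) (ρ : SigmaHopfHom k A N)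
    (hρ : Function.Surjective ρ.toBialgHom) :
    IsTower fun i => (S i).map (ρ.toBialgHom : A →ₐ[k] N) where
  hopf i := (hS.hopf i).map ρ.toBialgHom
  fg := hS.fg.map _
  succ i := by rw [hS.succ, Algebra.map_sup, map_sigmaAdjoin]
  exhaust y := by
    obtain ⟨x, rfl⟩ := hρ y
    obtain ⟨i, hi⟩ := hS.exhaust x
    exact ⟨i, x, hi, rfl⟩

end Image

section Stages

variable {k B : Type*} [Field k] [DifferenceRing k] [CommRing B] [HopfAlgebra k B]

theorem gen_mem_stage {i j : ℕ} (h : j ≤ i) (b : B) :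
    SigmaExt.gen k B j b ∈ SigmaExt.stage k B i := Algebra.subset_adjoin ⟨j, h, b, rfl⟩

theorem stage_mono {i j : ℕ} (h : i ≤ j) : SigmaExt.stage k B i ≤ SigmaExt.stage k B j :=
  Algebra.adjoin_le (by
    rintro _ ⟨l, hl, b, rfl⟩
    exact gen_mem_stage (hl.trans h) b)

theorem iterate_dsigma_map_incl_mem {i j : ℕ} (h : j ≤ i) (t : B ⊗[k] B) :
    dsigma^[j] (Algebra.TensorProduct.map (SigmaExt.incl k B) (SigmaExt.incl k B) t) ∈
      tensorSquare (SigmaExt.stage k B i) := by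
  induction t using TensorProduct.induction_on with
  | zero => rw [map_zero, iterate_map_zero]; exact zero_mem _
  | add s t hs ht => rw [map_add, iterate_map_add]; exact add_mem hs ht
  | tmul a b =>
    have hj : ∀ x y : SigmaExt k B, dsigma^[j] (x ⊗ₜ[k] y) = dsigma^[j] x ⊗ₜ[k] dsigma^[j] y := by
      clear h
      intro x y
      induction j with
      | zero => rfl
      | succ j ih => simp only [Function.iterate_succ_apply', ih, DifferenceAlgebra.dsigma_tmul]
    rw [Algebra.TensorProduct.map_tmul, hj, SigmaExt.incl_apply, SigmaExt.incl_apply,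
      SigmaExt.iterate_dsigma_gen, SigmaExt.iterate_dsigma_gen]
    exact tmul_mem_tensorSquare (gen_mem_stage h a) (gen_mem_stage h b)

theorem isHopfSubalgebra_stage (i : ℕ) : IsHopfSubalgebra (SigmaExt.stage k B i) := by
  refine isHopfSubalgebra_adjoin ?_ ?_
  · rintro _ ⟨j, hj, b, rfl⟩
    rw [SigmaExt.comul_eq, SigmaExt.comulHom, SigmaExt.lift_gen]
    exact iterate_dsigma_map_incl_mem hj _
  · rintro _ ⟨j, hj, b, rfl⟩
    rw [SigmaExt.antipode_eq, SigmaExt.antipodeHom, SigmaExt.lift_gen]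
    change dsigma^[j] (SigmaExt.gen k B 0 (HopfAlgebra.antipode k b)) ∈ _
    rw [SigmaExt.iterate_dsigma_gen]
    exact gen_mem_stage hj _

theorem isTower_stage [Algebra.FiniteType k B] : IsTower (SigmaExt.stage k B) where
  hopf := isHopfSubalgebra_stage
  fg := by
    have h : SigmaExt.stage k B 0 = (⊤ : Subalgebra k B).map (SigmaExt.incl k B) := by
      refine le_antisymm (Algebra.adjoin_le ?_) ?_
      · rintro _ ⟨j, hj, b, rfl⟩
        obtain rfl := Nat.le_zero.1 hj
        exact ⟨b, trivial, rfl⟩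
      · rintro _ ⟨b, -, rfl⟩
        exact gen_mem_stage le_rfl b
    rw [h]
    exact Algebra.FiniteType.out.map _
  succ i := by
    refine le_antisymm (Algebra.adjoin_le ?_) (sup_le (stage_mono (Nat.le_succ i))
      (sigmaAdjoin_le fun x hx => SigmaExt.dsigma_mem_stage hx))
    rintro _ ⟨j, hj, b, rfl⟩
    cases j with
    | zero => exact (le_sup_left : _ ≤ SigmaExt.stage k B i ⊔ _) (gen_mem_stage (Nat.zero_le i) b)
    | succ j =>
      rw [← SigmaExt.dsigma_gen]
      exact (le_sup_right : _ ≤ SigmaExt.stage k B i ⊔ _)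
        (dsigma_mem_sigmaAdjoin (gen_mem_stage (Nat.le_of_succ_le_succ hj) b))
  exhaust x := by
    obtain ⟨p, rfl⟩ := SigmaExt.mk_surjective x
    induction p using MvPolynomial.induction_on with
    | C c => exact ⟨0, by
        rw [← MvPolynomial.algebraMap_eq, AlgHom.commutes]
        exact Subalgebra.algebraMap_mem _ _⟩
    | add p q hp hq =>
      obtain ⟨i, hi⟩ := hp
      obtain ⟨j, hj⟩ := hq
      exact ⟨max i j, by
        rw [map_add]
        exact add_mem (stage_mono (le_max_left i j) hi) (stage_mono (le_max_right i j) hj)⟩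
    | mul_X p l hp =>
      obtain ⟨i, hi⟩ := hp
      refine ⟨max i l.1, ?_⟩
      rw [map_mul]
      exact mul_mem (stage_mono (le_max_left i l.1) hi) (gen_mem_stage (le_max_right i l.1) l.2)

end Stages

section Growth

variable {k A B : Type*} [Field k] [DifferenceRing k] [CommRing A] [DifferenceRing A]
  [HopfAlgebra k A] [CommRing B] [HopfAlgebra k B] [Algebra.FiniteType k B]

theorem isTower_closure (φ : SigmaClosedEmbedding k A B) : IsTower φ.closure :=
  isTower_stage.map φ.hom φ.surjective

variable [DifferenceHopfAlgebra k A]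

theorem isLeast_growthIndex (φ : SigmaClosedEmbedding k A B) :
    IsLeast {m | φ.StableFrom m} φ.growthIndex := by
  obtain ⟨m, hm⟩ := (isTower_closure φ).exists_sigmaDual_bijective
  have hne : {m | φ.StableFrom m}.Nonempty := ⟨m, fun j hj => hm j (by omega)⟩
  exact ⟨Nat.sInf_mem hne, fun _ h => Nat.sInf_le h⟩

/-- The size of the growth group is the eventual index of the tower of Zariski closures. -/
theorem hopfIndex_closure (φ : SigmaClosedEmbedding k A B) {i : ℕ} (hi : φ.growthIndex ≤ i) :
    hopfIndex (φ.closure i) (Subalgebra.toSubmodule (φ.closure (i + 1))) = φ.growthSize := by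
  have h := (isLeast_growthIndex φ).1
  have key : ∀ j, φ.growthIndex ≤ j → Module.rank k (KernelRing φ.closure j) =
      Module.rank k (KernelRing φ.closure φ.growthIndex) := by
    intro j hj
    induction j, hj using Nat.le_induction with
    | base => rfl
    | succ j hj ih => rw [rank_kernelRing_succ _ (h j (by omega)), ih]
  rw [← (isTower_closure φ).toENat_rank_kernelRing, key (i + 1) (by omega)]
  rfl

/-- The size of the growth group can be computed by any tower. -/
theorem IsTower.eq_growthSize {S : ℕ → Subalgebra k A} (hS : IsTower S) {d : ℕ∞} {m : ℕ}
    (h : ∀ i, m ≤ i → hopfIndex (S i) (Subalgebra.toSubmodule (S (i + 1))) = d)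
    (φ : SigmaClosedEmbedding k A B) : d = φ.growthSize :=
  le_antisymm ((isTower_closure φ).le_of_eventually hS (fun _ => hopfIndex_closure φ) h)
    (hS.le_of_eventually (isTower_closure φ) h (fun _ => hopfIndex_closure φ))

theorem growthSize_eq {B' : Type*} [CommRing B'] [HopfAlgebra k B'] [Algebra.FiniteType k B']
    (φ : SigmaClosedEmbedding k A B) (φ' : SigmaClosedEmbedding k A B') :
    φ.growthSize = φ'.growthSize :=
  (isTower_closure φ).eq_growthSize (fun _ => hopfIndex_closure φ) φ'

end Growth

/-! ### Hopf subalgebras as Hopf algebras, and the existence of embeddings -/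

section HopfStructure

variable {k A : Type*} [Field k] [CommRing A] [HopfAlgebra k A] {C : Subalgebra k A}

theorem tensorMap_injective {k A B A' B' : Type*} [Field k] [CommRing A] [Algebra k A]
    [CommRing B] [Algebra k B] [CommRing A'] [Algebra k A'] [CommRing B'] [Algebra k B']
    {f : A →ₐ[k] A'} {g : B →ₐ[k] B'} (hf : Function.Injective f) (hg : Function.Injective g) :
    Function.Injective (Algebra.TensorProduct.map f g) :=
  TensorProduct.map_injective_of_flat_flat f.toLinearMap g.toLinearMap hf hg

namespace IsHopfSubalgebra

/-- The comultiplication of a Hopf subalgebra. -/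
def comulHom (hC : IsHopfSubalgebra C) : C →ₐ[k] C ⊗[k] C :=
  (AlgEquiv.ofInjective (Algebra.TensorProduct.map C.val C.val)
    (tensorMap_injective Subtype.val_injective Subtype.val_injective)).symm.toAlgHom.comp
    (((Bialgebra.comulAlgHom k A).comp C.val).codRestrict (tensorSquare C)
      fun x => hC.comul_mem x x.2)

theorem map_comulHom (hC : IsHopfSubalgebra C) (x : C) :
    Algebra.TensorProduct.map C.val C.val (hC.comulHom x) = comul (R := k) (x : A) :=
  congrArg Subtype.val ((AlgEquiv.ofInjective (Algebra.TensorProduct.map C.val C.val)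
    (tensorMap_injective Subtype.val_injective Subtype.val_injective)).apply_symm_apply
      ⟨comul (x : A), hC.comul_mem x x.2⟩)

/-- The counit of a subalgebra. -/
def counitHom (C : Subalgebra k A) : C →ₐ[k] k := (Bialgebra.counitAlgHom k A).comp C.val

/-- The antipode of a Hopf subalgebra. -/
def antipodeHom (hC : IsHopfSubalgebra C) : C →ₐ[k] C :=
  ((HopfAlgebra.antipodeAlgHom k A).comp C.val).codRestrict C fun x => hC.antipode_mem x x.2

theorem assoc_comulHom (hC : IsHopfSubalgebra C) (t : C ⊗[k] C) :
    Algebra.TensorProduct.map C.val (Algebra.TensorProduct.map C.val C.val)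
      (Algebra.TensorProduct.assoc k k k C C C
        (Algebra.TensorProduct.map hC.comulHom (.id k C) t)) =
    TensorProduct.assoc k A A A (comul.rTensor A (Algebra.TensorProduct.map C.val C.val t)) := by
  induction t using TensorProduct.induction_on with
  | zero => simp
  | add s t hs ht => simp only [map_add, hs, ht]
  | tmul a b =>
    have h : ∀ s : C ⊗[k] C, Algebra.TensorProduct.map C.val
        (Algebra.TensorProduct.map C.val C.val)
          (Algebra.TensorProduct.assoc k k k C C C (s ⊗ₜ b)) =
        TensorProduct.assoc k A A A (Algebra.TensorProduct.map C.val C.val s ⊗ₜ[k] (b : A)) := by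
      intro s
      induction s using TensorProduct.induction_on with
      | zero => simp
      | add s t hs ht => simp only [TensorProduct.add_tmul, map_add, hs, ht]
      | tmul x y => rfl
    rw [Algebra.TensorProduct.map_tmul, AlgHom.id_apply, h, map_comulHom]
    rfl

theorem map_id_comulHom (hC : IsHopfSubalgebra C) (t : C ⊗[k] C) :
    Algebra.TensorProduct.map C.val (Algebra.TensorProduct.map C.val C.val)
        (Algebra.TensorProduct.map (.id k C) hC.comulHom t) =
      comul.lTensor A (Algebra.TensorProduct.map C.val C.val t) := by
  induction t using TensorProduct.induction_on with
  | zero => simp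
  | add s t hs ht => simp only [map_add, hs, ht]
  | tmul a b =>
    rw [Algebra.TensorProduct.map_tmul, Algebra.TensorProduct.map_tmul, map_comulHom]
    rfl

theorem map_counitHom_left (t : C ⊗[k] C) :
    Algebra.TensorProduct.map (.id k k) C.val
        (Algebra.TensorProduct.map (counitHom C) (.id k C) t) =
      counit.rTensor A (Algebra.TensorProduct.map C.val C.val t) := by
  induction t using TensorProduct.induction_on with
  | zero => simp
  | add s t hs ht => simp only [map_add, hs, ht]
  | tmul a b => rfl

theorem map_counitHom_right (t : C ⊗[k] C) :
    Algebra.TensorProduct.map C.val (.id k k)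
        (Algebra.TensorProduct.map (.id k C) (counitHom C) t) =
      counit.lTensor A (Algebra.TensorProduct.map C.val C.val t) := by
  induction t using TensorProduct.induction_on with
  | zero => simp
  | add s t hs ht => simp only [map_add, hs, ht]
  | tmul a b => rfl

theorem lift_antipodeHom_left (hC : IsHopfSubalgebra C) (t : C ⊗[k] C) :
    C.val (Algebra.TensorProduct.lift hC.antipodeHom (.id k C) (fun _ _ => Commute.all _ _) t) =
      LinearMap.mul' k A ((HopfAlgebra.antipode k).rTensor A
        (Algebra.TensorProduct.map C.val C.val t)) := by
  induction t using TensorProduct.induction_on with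
  | zero => simp
  | add s t hs ht => simp only [map_add, hs, ht]
  | tmul a b => rfl

theorem lift_antipodeHom_right (hC : IsHopfSubalgebra C) (t : C ⊗[k] C) :
    C.val (Algebra.TensorProduct.lift (.id k C) hC.antipodeHom (fun _ _ => Commute.all _ _) t) =
      LinearMap.mul' k A ((HopfAlgebra.antipode k).lTensor A
        (Algebra.TensorProduct.map C.val C.val t)) := by
  induction t using TensorProduct.induction_on with
  | zero => simp
  | add s t hs ht => simp only [map_add, hs, ht]
  | tmul a b => rfl

/-- The bialgebra structure of a Hopf subalgebra. -/
abbrev bialgebra (hC : IsHopfSubalgebra C) : Bialgebra k C :=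
  Bialgebra.ofAlgHom hC.comulHom (counitHom C)
    (by
      ext x
      refine tensorMap_injective (f := C.val) (g := Algebra.TensorProduct.map C.val C.val)
        Subtype.val_injective
        (tensorMap_injective Subtype.val_injective Subtype.val_injective) ?_
      refine (hC.assoc_comulHom _).trans (Eq.trans ?_ (hC.map_id_comulHom _).symm)
      exact (congrArg (fun t => TensorProduct.assoc k A A A (comul.rTensor A t))
        (hC.map_comulHom x)).trans ((Coalgebra.coassoc_apply (R := k) (x : A)).trans
          (congrArg (fun t => comul.lTensor A t) (hC.map_comulHom x)).symm))
    (by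
      ext x
      refine tensorMap_injective (f := .id k k) (g := C.val) Function.injective_id
        Subtype.val_injective ?_
      refine (map_counitHom_left _).trans ?_
      refine (congrArg (fun t => counit.rTensor A t) (hC.map_comulHom x)).trans ?_
      exact Coalgebra.rTensor_counit_comul (R := k) (x : A))
    (by
      ext x
      refine tensorMap_injective (f := C.val) (g := .id k k) Subtype.val_injective
        Function.injective_id ?_
      refine (map_counitHom_right _).trans ?_
      refine (congrArg (fun t => counit.lTensor A t) (hC.map_comulHom x)).trans ?_
      exact Coalgebra.lTensor_counit_comul (R := k) (x : A))

/-- The Hopf algebra structure of a Hopf subalgebra. -/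
abbrev hopfAlgebra (hC : IsHopfSubalgebra C) : HopfAlgebra k C :=
  letI := hC.bialgebra
  HopfAlgebra.ofAlgHom hC.antipodeHom
    (by
      ext x
      refine (hC.lift_antipodeHom_left _).trans ?_
      refine (congrArg (fun t => LinearMap.mul' k A ((HopfAlgebra.antipode k).rTensor A t))
        (hC.map_comulHom x)).trans ?_
      exact HopfAlgebra.mul_antipode_rTensor_comul_apply (R := k) (x : A))
    (by
      ext x
      refine (hC.lift_antipodeHom_right _).trans ?_
      refine (congrArg (fun t => LinearMap.mul' k A ((HopfAlgebra.antipode k).lTensor A t))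
        (hC.map_comulHom x)).trans ?_
      exact HopfAlgebra.mul_antipode_lTensor_comul_apply (R := k) (x : A))

end IsHopfSubalgebra

theorem IsHopfSubalgebra.exists_hopfAlgebra {k A : Type u} [Field k] [CommRing A]
    [HopfAlgebra k A] {C : Subalgebra k A} (hC : IsHopfSubalgebra C) :
    ∃ (B : Type u) (_ : CommRing B) (_ : HopfAlgebra k B) (f : B →ₐc[k] A),
      Function.Injective f ∧ (f : B →ₐ[k] A).range = C := by
  let := hC.hopfAlgebra
  refine ⟨C, inferInstance, inferInstance, BialgHom.ofAlgHom C.val ?_ ?_,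
    Subtype.val_injective, C.range_val⟩
  · ext x
    rfl
  · ext x
    exact hC.map_comulHom x

/-- A `σ`-stable Hopf subalgebra is a difference Hopf algebra. -/
theorem IsHopfSubalgebra.exists_differenceHopfAlgebra {k A : Type u} [Field k] [DifferenceRing k]
    [CommRing A] [DifferenceRing A] [HopfAlgebra k A] [DifferenceHopfAlgebra k A]
    {C : Subalgebra k A} (hC : IsHopfSubalgebra C) (hσ : ∀ x ∈ C, dsigma x ∈ C) :
    ∃ (B : Type u) (_ : CommRing B) (_ : DifferenceRing B) (_ : HopfAlgebra k B)
      (_ : DifferenceHopfAlgebra k B) (f : SigmaHopfHom k B A),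
      Function.Injective f.toBialgHom ∧ (f.toBialgHom : B →ₐ[k] A).range = C := by
  obtain ⟨B, _, _, f, hf, hfC⟩ := hC.exists_hopfAlgebra
  have hex : ∀ b, ∃ c, f c = dsigma (f b) := fun b => by
    have : dsigma (f b) ∈ (f : B →ₐ[k] A).range := by
      rw [hfC]
      exact hσ _ (hfC ▸ ⟨b, rfl⟩)
    exact this
  choose s hs using hex
  let : DifferenceRing B :=
    { sigma :=
        { toFun := s
          map_zero' := hf (by rw [hs, map_zero, map_zero])
          map_one' := hf (by rw [hs, map_one, map_one])
          map_add' := fun a b => hf (by rw [hs, map_add, map_add, map_add, hs, hs])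
          map_mul' := fun a b => hf (by rw [hs, map_mul, map_mul, map_mul, hs, hs]) } }
  have hsig : ∀ b, f (dsigma b) = dsigma (f b) := hs
  have hcomm : ∀ c : k, f (algebraMap k B c) = algebraMap k A c := fun c =>
    AlgHomClass.commutes f c
  let : DifferenceAlgebra k B := ⟨fun c => hf (by
    rw [hsig, hcomm, hcomm, DifferenceAlgebra.sigma_algebraMap])⟩
  have hff : Function.Injective
      (Algebra.TensorProduct.map (f : B →ₐ[k] A) (f : B →ₐ[k] A)) := tensorMap_injective hf hf
  have hcomul : ∀ b, Algebra.TensorProduct.map (f : B →ₐ[k] A) (f : B →ₐ[k] A)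
      (comul (R := k) b) = comul (f b) := fun b => CoalgHomClass.map_comp_comul_apply f b
  have hD : DifferenceHopfAlgebra k B :=
    { sigma_comul := fun b => hff (by
        rw [hcomul, hsig, DifferenceHopfAlgebra.sigma_comul, ← hcomul]
        exact (SigmaExt.map_sigma hsig hsig _).symm)
      sigma_counit := fun b => by
        rw [← CoalgHomClass.counit_comp_apply f, hsig, DifferenceHopfAlgebra.sigma_counit,
          CoalgHomClass.counit_comp_apply f]
      sigma_antipode := fun b => hf (by
        rw [map_antipode, hsig, hsig, DifferenceHopfAlgebra.sigma_antipode, map_antipode]) }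
  exact ⟨B, inferInstance, inferInstance, inferInstance, hD,
    { toBialgHom := f, map_sigma := hsig }, hf, hfC⟩

end HopfStructure

section Existence

variable {k A B : Type*} [Field k] [DifferenceRing k] [CommRing A] [DifferenceRing A]
  [HopfAlgebra k A] [DifferenceHopfAlgebra k A] [CommRing B] [HopfAlgebra k B]

/-- The morphism `G → [σ]_k 𝒢` attached to a morphism from `G` to the algebraic group `𝒢`. -/
def liftHopf (f : B →ₐc[k] A) : SigmaHopfHom k (SigmaExt k B) A where
  toBialgHom := BialgHom.ofAlgHom (SigmaExt.lift (f : B →ₐ[k] A))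
    (by
      refine SigmaExt.algHom_ext (fun x => ?_) (fun x => ?_) (fun b => ?_)
      · change counit (SigmaExt.lift (f : B →ₐ[k] A) (dsigma x)) =
          dsigma (counit (SigmaExt.lift (f : B →ₐ[k] A) x))
        rw [SigmaExt.lift_sigma, DifferenceHopfAlgebra.sigma_counit]
      · exact SigmaExt.counitHom_sigma x
      · change counit (SigmaExt.lift (f : B →ₐ[k] A) (SigmaExt.incl k B b)) =
          SigmaExt.counitHom k B (SigmaExt.incl k B b)
        rw [SigmaExt.counitHom_incl, SigmaExt.incl_apply, SigmaExt.lift_gen]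
        exact CoalgHomClass.counit_comp_apply f b)
    (by
      refine SigmaExt.algHom_ext (fun x => ?_) (fun x => ?_) (fun b => ?_)
      · change Algebra.TensorProduct.map (SigmaExt.lift (f : B →ₐ[k] A))
            (SigmaExt.lift (f : B →ₐ[k] A)) (SigmaExt.comulHom k B (dsigma x)) =
          dsigma (Algebra.TensorProduct.map (SigmaExt.lift (f : B →ₐ[k] A))
            (SigmaExt.lift (f : B →ₐ[k] A)) (SigmaExt.comulHom k B x))
        rw [SigmaExt.comulHom_sigma,
          SigmaExt.map_sigma (SigmaExt.lift_sigma _) (SigmaExt.lift_sigma _)]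
      · change comul (SigmaExt.lift (f : B →ₐ[k] A) (dsigma x)) =
          (dsigma (comul (R := k) (SigmaExt.lift (f : B →ₐ[k] A) x)) : A ⊗[k] A)
        rw [SigmaExt.lift_sigma, DifferenceHopfAlgebra.sigma_comul]
      · change Algebra.TensorProduct.map (SigmaExt.lift (f : B →ₐ[k] A))
            (SigmaExt.lift (f : B →ₐ[k] A)) (SigmaExt.comulHom k B (SigmaExt.incl k B b)) =
          comul (SigmaExt.lift (f : B →ₐ[k] A) (SigmaExt.incl k B b))
        have hl : (SigmaExt.lift (f : B →ₐ[k] A)).comp (SigmaExt.incl k B) = f := by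
          ext b
          exact SigmaExt.lift_gen _ 0 b
        have hb : SigmaExt.lift (f : B →ₐ[k] A) (SigmaExt.incl k B b) = f b :=
          SigmaExt.lift_gen _ 0 b
        rw [SigmaExt.comulHom_incl, hb, ← AlgHom.comp_apply, ← Algebra.TensorProduct.map_comp, hl]
        exact CoalgHomClass.map_comp_comul_apply f b)
  map_sigma := SigmaExt.lift_sigma _

theorem liftHopf_gen (f : B →ₐc[k] A) (n : ℕ) (b : B) :
    (liftHopf f).toBialgHom (SigmaExt.gen k B n b) = dsigma^[n] (f b) := SigmaExt.lift_gen _ n b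

/-- A finitely `σ`-generated difference Hopf algebra is `σ`-generated by a finitely generated Hopf
subalgebra, since Hopf subalgebras are directed unions of finitely generated ones; the inclusion of
that subalgebra induces the embedding. -/
theorem exists_sigmaClosedEmbedding {k A : Type u} [Field k] [DifferenceRing k] [CommRing A]
    [DifferenceRing A] [HopfAlgebra k A] [DifferenceHopfAlgebra k A]
    (h : FinitelySigmaGenerated k A) :
    ∃ (B : Type u) (_ : CommRing B) (_ : HopfAlgebra k B) (_ : Algebra.FiniteType k B),
      Nonempty (SigmaClosedEmbedding k A B) := by
  obtain ⟨s, hs⟩ := h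
  obtain ⟨D, hD, hDfg, -, hsD⟩ := (isHopfSubalgebra_top (k := k) (A := A)).exists_fg
    (fun x : s => (x : A)) (fun _ => trivial)
  obtain ⟨B, _, _, f, hf, rfl⟩ := hD.exists_hopfAlgebra
  have hfin : Algebra.FiniteType k B := by
    have : Algebra.FiniteType k (f : B →ₐ[k] A).range := Subalgebra.fg_iff_finiteType _ |>.1 hDfg
    exact this.equiv (AlgEquiv.ofInjective (f : B →ₐ[k] A) hf).symm
  refine ⟨B, inferInstance, inferInstance, hfin, ⟨⟨liftHopf f, ?_⟩⟩⟩
  have hle : Algebra.adjoin k {x : A | ∃ n : ℕ, ∃ a ∈ s, x = dsigma^[n] a} ≤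
      ((liftHopf f).toBialgHom : SigmaExt k B →ₐ[k] A).range := by
    refine Algebra.adjoin_le ?_
    rintro _ ⟨n, a, ha, rfl⟩
    obtain ⟨b, rfl⟩ := hsD ⟨a, ha⟩
    exact ⟨SigmaExt.gen k B n b, liftHopf_gen f n b⟩
  intro x
  exact hle (hs ▸ trivial : x ∈ _)

end Existence

section Degree

variable {k A : Type u} [Field k] [DifferenceRing k] [CommRing A] [DifferenceRing A]
  [HopfAlgebra k A] [DifferenceHopfAlgebra k A]

theorem exists_isGrowthSize (h : FinitelySigmaGenerated k A) : ∃ d, IsGrowthSize k A d := by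
  obtain ⟨B, _, _, _, ⟨φ⟩⟩ := exists_sigmaClosedEmbedding h
  exact ⟨φ.growthSize, B, inferInstance, inferInstance, inferInstance, φ, rfl⟩

theorem exists_isTower (h : FinitelySigmaGenerated k A) :
    ∃ S : ℕ → Subalgebra k A, IsTower S := by
  obtain ⟨B, _, _, _, ⟨φ⟩⟩ := exists_sigmaClosedEmbedding h
  exact ⟨φ.closure, isTower_closure φ⟩

theorem isGrowthSize_limitDegree (h : FinitelySigmaGenerated k A) :
    IsGrowthSize k A (limitDegree k A) := Classical.epsilon_spec (exists_isGrowthSize h)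

/-- The limit degree is the eventual index of any tower. -/
theorem IsTower.eq_limitDegree {S : ℕ → Subalgebra k A} (hS : IsTower S)
    (hA : FinitelySigmaGenerated k A) {d : ℕ∞} {m : ℕ}
    (h : ∀ i, m ≤ i → hopfIndex (S i) (Subalgebra.toSubmodule (S (i + 1))) = d) :
    d = limitDegree k A := by
  obtain ⟨B, _, _, _, φ, hφ⟩ := isGrowthSize_limitDegree hA
  rw [← hφ]
  exact hS.eq_growthSize h φ

end Degree

/-! ### Normal subgroups of difference algebraic groups -/

section Kills

variable {k A N C : Type u} [Field k] [CommRing A] [DifferenceRing A] [HopfAlgebra k A]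
  [CommRing N] [DifferenceRing N] [HopfAlgebra k N] [CommRing C] [DifferenceRing C]
  [HopfAlgebra k C]

theorem mem_leftInvariants_of_killsSubgroup {ρ : SigmaHopfHom k A N} {θ : SigmaHopfHom k C A}
    (h : KillsSubgroup ρ θ) (c : C) : θ.toBialgHom c ∈ leftInvariants ρ.toBialgHom := by
  rw [mem_leftInvariants_iff]
  intro R _ _ ν y
  have h1 : comapPoint θ.toBialgHom (comapPoint ρ.toBialgHom ν) = 1 := by
    apply WithConv.ofConv_injective
    ext c
    refine (congrArg ν.ofConv (h c)).trans ?_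
    exact ν.ofConv.commutes _
  rw [← comapPoint_apply, map_mul, h1, one_mul, comapPoint_apply]

theorem killsSubgroup_of_mem_leftInvariants {ρ : SigmaHopfHom k A N} {θ : SigmaHopfHom k C A}
    (h : ∀ c, θ.toBialgHom c ∈ leftInvariants ρ.toBialgHom) : KillsSubgroup ρ θ := fun c => by
  rw [map_eq_of_mem_leftInvariants (h c), CoalgHomClass.counit_comp_apply]

end Kills

section Normal

variable {k A N : Type u} [Field k] [DifferenceRing k] [CommRing A] [DifferenceRing A]
  [HopfAlgebra k A] [DifferenceHopfAlgebra k A] [CommRing N] [DifferenceRing N] [HopfAlgebra k N]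
  [DifferenceHopfAlgebra k N]

/-- A normal `σ`-closed subgroup is normal as a subgroup scheme: it suffices to conjugate the
universal point of `N` by the universal point of `G`, over the difference algebra `A ⊗ N`. -/
theorem isNormalHom_of_isNormalSubgroup {ρ : SigmaHopfHom k A N} (hρ : IsNormalSubgroup ρ) :
    IsNormalHom ρ.toBialgHom := by
  intro R _ _ g ν
  let g₀ : SigmaAlgHom k A (A ⊗[k] N) :=
    { tensorLeft k A N with
      map_sigma := fun a => by
        change dsigma a ⊗ₜ[k] (1 : N) = dsigma (a ⊗ₜ[k] (1 : N))
        rw [DifferenceAlgebra.dsigma_tmul, map_one] }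
  let n₀ : SigmaAlgHom k N (A ⊗[k] N) :=
    { tensorRight k A N with
      map_sigma := fun a => by
        change (1 : A) ⊗ₜ[k] dsigma a = dsigma ((1 : A) ⊗ₜ[k] a)
        rw [DifferenceAlgebra.dsigma_tmul, map_one] }
  obtain ⟨n', h⟩ := hρ.2 (A ⊗[k] N) g₀ n₀
  have h' : toConv (tensorLeft k A N) * comapPoint ρ.toBialgHom (toConv (tensorRight k A N)) *
      (toConv (tensorLeft k A N))⁻¹ = comapPoint ρ.toBialgHom (toConv n'.toAlgHom) := h
  have h2 := congrArg (mapPoint (tensorLift g.ofConv ν.ofConv)) h'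
  rw [map_mul, map_mul, map_inv, mapPoint_comapPoint, mapPoint_comapPoint] at h2
  have hg : mapPoint (tensorLift g.ofConv ν.ofConv) (toConv (tensorLeft k A N)) = g :=
    congrArg toConv (tensorLift_left _ _)
  have hν : mapPoint (tensorLift g.ofConv ν.ofConv) (toConv (tensorRight k A N)) = ν :=
    congrArg toConv (tensorLift_right _ _)
  rw [hg, hν] at h2
  exact ⟨_, h2⟩

theorem dsigma_mem_leftInvariants (ρ : SigmaHopfHom k A N) {x : A}
    (hx : x ∈ leftInvariants ρ.toBialgHom) : dsigma x ∈ leftInvariants ρ.toBialgHom := by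
  rw [mem_leftInvariants] at hx ⊢
  change Algebra.TensorProduct.map (ρ.toBialgHom : A →ₐ[k] N) (AlgHom.id k A)
    (comul (dsigma x)) = _
  rw [DifferenceHopfAlgebra.sigma_comul, SigmaExt.map_sigma ρ.map_sigma (fun _ => rfl)]
  refine (congrArg dsigma hx).trans ?_
  rw [DifferenceAlgebra.dsigma_tmul, map_one]

end Normal

/-! ### Generation of the invariants by their first stages -/

section Generation

variable {k A : Type*} [Field k] [DifferenceRing k] [CommRing A] [DifferenceRing A]

/-- The map `^σA = k ⊗_{σ,k} A → A`, `c ⊗ a ↦ c σ(a)`. -/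
def twistMul (k A : Type*) [Field k] [DifferenceRing k] [CommRing A] [DifferenceRing A]
    [Algebra k A] [DifferenceAlgebra k A] : SigmaTwist k ⊗[k] A →+* A :=
  (Algebra.TensorProduct.lift (R := k) (S := k) (A := SigmaTwist k) (C := SigmaTwist A)
    { toFun := algebraMap k A
      map_one' := map_one (algebraMap k A)
      map_mul' := map_mul (algebraMap k A)
      map_zero' := map_zero (algebraMap k A)
      map_add' := map_add (algebraMap k A)
      commutes' := fun _ => rfl }
    { toFun := (dsigma : A →+* A)
      map_one' := map_one (dsigma : A →+* A)
      map_mul' := map_mul (dsigma : A →+* A)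
      map_zero' := map_zero (dsigma : A →+* A)
      map_add' := map_add (dsigma : A →+* A)
      commutes' := DifferenceAlgebra.sigma_algebraMap (k := k) (A := A) }
    (fun _ _ => Commute.all _ _)).toRingHom

theorem twistMul_tmul [Algebra k A] [DifferenceAlgebra k A] (c : k) (a : A) :
    twistMul k A (toTwist k c ⊗ₜ a) = c • dsigma a := by
  rw [Algebra.smul_def]
  exact Algebra.TensorProduct.lift_tmul (R := k) (S := k) (A := SigmaTwist k) (B := A)
    (C := SigmaTwist A) _ _ _ _ a

variable [HopfAlgebra k A] [DifferenceHopfAlgebra k A]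

theorem dsigma_mem_augSpan {C : Subalgebra k A} {x : A} (hx : x ∈ augSpan C) :
    dsigma x ∈ augSpan (sigmaAdjoin C) := by
  rw [augSpan] at hx
  induction hx using Submodule.mul_induction_on' with
  | mem_mul_mem a _ c hc =>
    rw [map_mul]
    have h0 : counit (R := k) c = 0 := hc.2
    refine mul_mem_augSpan _ (augPart_le_augSpan _ ⟨dsigma_mem_sigmaAdjoin hc.1, ?_⟩)
    change counit (R := k) (dsigma c) = 0
    rw [DifferenceHopfAlgebra.sigma_counit, h0, map_zero]
  | add a _ b _ ha hb => rw [map_add]; exact add_mem ha hb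

/-- Modulo `(S i)⁺`, every element of `S (i + 1)` comes from `^σ(S i)`. -/
theorem IsTower.exists_sub_twistMul_mem {S : ℕ → Subalgebra k A} (hS : IsTower S) {i : ℕ} {x : A}
    (hx : x ∈ S (i + 1)) : ∃ t : SigmaTwist k ⊗[k] S i,
      x - twistMul k A (LinearMap.lTensor (SigmaTwist k) (S i).val.toLinearMap t) ∈
        augSpan (S i) := by
  have h : x ∈ Subalgebra.toSubmodule (S i) * Submodule.span k (dsigma '' (S i : Set A)) := by
    rw [← toSubmodule_sigmaAdjoin, Subalgebra.mul_toSubmodule, ← hS.succ]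
    exact hx
  induction h using Submodule.mul_induction_on' with
  | mem_mul_mem s hs y hy =>
    have hy' : ∃ t : SigmaTwist k ⊗[k] S i,
        y = twistMul k A (LinearMap.lTensor (SigmaTwist k) (S i).val.toLinearMap t) := by
      clear hx
      induction hy using Submodule.span_induction with
      | mem y hy =>
        obtain ⟨z, hz, rfl⟩ := hy
        refine ⟨toTwist k 1 ⊗ₜ ⟨z, hz⟩, ?_⟩
        rw [LinearMap.lTensor_tmul, twistMul_tmul, one_smul]
        rfl
      | zero => exact ⟨0, by rw [map_zero, map_zero]⟩
      | add a b _ _ ha hb =>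
        obtain ⟨t, rfl⟩ := ha
        obtain ⟨t', rfl⟩ := hb
        exact ⟨t + t', by rw [map_add, map_add]⟩
      | smul c a _ ha =>
        obtain ⟨t, rfl⟩ := ha
        refine ⟨toTwist k c ⊗ₜ[k] 1 * t, ?_⟩
        have hmul : ∀ t t' : SigmaTwist k ⊗[k] S i,
            LinearMap.lTensor (SigmaTwist k) (S i).val.toLinearMap (t * t') =
              LinearMap.lTensor (SigmaTwist k) (S i).val.toLinearMap t *
                LinearMap.lTensor (SigmaTwist k) (S i).val.toLinearMap t' :=
          map_mul (Algebra.TensorProduct.map (AlgHom.id k (SigmaTwist k)) (S i).val)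
        rw [hmul, map_mul, LinearMap.lTensor_tmul, twistMul_tmul]
        change _ = c • dsigma (1 : A) * _
        rw [map_one, smul_one_mul]
    obtain ⟨t, rfl⟩ := hy'
    obtain ⟨c, hc⟩ : ∃ c, c = counit (R := k) s := ⟨_, rfl⟩
    refine ⟨toTwist k c ⊗ₜ[k] 1 * t, ?_⟩
    have hmul : LinearMap.lTensor (SigmaTwist k) (S i).val.toLinearMap (toTwist k c ⊗ₜ[k] 1 * t) =
        LinearMap.lTensor (SigmaTwist k) (S i).val.toLinearMap (toTwist k c ⊗ₜ[k] 1) *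
          LinearMap.lTensor (SigmaTwist k) (S i).val.toLinearMap t :=
      map_mul (Algebra.TensorProduct.map (AlgHom.id k (SigmaTwist k)) (S i).val) _ _
    have h1 : twistMul k A (LinearMap.lTensor (SigmaTwist k) (S i).val.toLinearMap
        (toTwist k c ⊗ₜ[k] 1)) = algebraMap k A c := by
      rw [LinearMap.lTensor_tmul, twistMul_tmul]
      change c • dsigma (1 : A) = _
      rw [map_one, Algebra.algebraMap_eq_smul_one]
    rw [hmul, map_mul, h1, hc, ← sub_mul, mul_comm]
    exact mul_mem_augSpan _ (augPart_le_augSpan _ (sub_counit_mem_augPart hs))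
  | add a ha b hb iha ihb =>
    have hle : Subalgebra.toSubmodule (S i) * Submodule.span k (dsigma '' (S i : Set A)) ≤
        Subalgebra.toSubmodule (S (i + 1)) := by
      rw [← toSubmodule_sigmaAdjoin, Subalgebra.mul_toSubmodule, ← hS.succ]
    obtain ⟨t, ht⟩ := iha (hle ha)
    obtain ⟨t', ht'⟩ := ihb (hle hb)
    refine ⟨t + t', ?_⟩
    rw [map_add, map_add, add_sub_add_comm]
    exact add_mem ht ht'

end Generation

section Invariants

variable {k A N : Type u} [Field k] [DifferenceRing k] [CommRing A] [DifferenceRing A]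
  [HopfAlgebra k A] [DifferenceHopfAlgebra k A] [CommRing N] [DifferenceRing N] [HopfAlgebra k N]
  [DifferenceHopfAlgebra k N]

/-- Once the morphisms `^σ(k[𝒩_i]) → k[𝒩_{i+1}]` for the closures of `N` are injective, an element
of `^σ(S i)` whose image in `k[𝒩_{i+1}]` vanishes has all its coefficients in the kernel
of `S i → k[𝒩_i]`. -/
theorem exists_twist_of_map_mem {S : ℕ → Subalgebra k A} {ρ : SigmaHopfHom k A N}
    (hT : IsTower fun i => (S i).map (ρ.toBialgHom : A →ₐ[k] N)) {j : ℕ}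
    (hinj : Function.Injective (kernelDual hT.sigma_mem (j + 1)))
    {t : SigmaTwist k ⊗[k] S (j + 1)}
    (ht : ρ.toBialgHom (twistMul k A
      (LinearMap.lTensor (SigmaTwist k) (S (j + 1)).val.toLinearMap t)) ∈
        augSpan ((S (j + 1)).map (ρ.toBialgHom : A →ₐ[k] N))) :
    ∃ (n : ℕ) (e : Fin n → k) (y : Fin n → A), (∀ β, y β ∈ S (j + 1)) ∧
      (∀ β, ρ.toBialgHom (y β) ∈ augSpan ((S j).map (ρ.toBialgHom : A →ₐ[k] N))) ∧
      twistMul k A (LinearMap.lTensor (SigmaTwist k) (S (j + 1)).val.toLinearMap t) =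
        ∑ β, e β • dsigma (y β) := by
  set T := fun i => (S i).map (ρ.toBialgHom : A →ₐ[k] N) with hTdef
  let q : S (j + 1) →ₐ[k] KernelRing T (j + 1) := (KernelRing.mk T (j + 1)).comp
    (((ρ.toBialgHom : A →ₐ[k] N).comp (S (j + 1)).val).codRestrict (T (j + 1))
      fun x => ⟨x, x.2, rfl⟩)
  have hq : ∀ x, q x = KernelRing.mk T (j + 1) ⟨ρ.toBialgHom (x : A), x, x.2, rfl⟩ := fun _ => rfl
  let P : SigmaTwist k ⊗[k] S (j + 1) → N := fun t => ρ.toBialgHom (twistMul k A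
    (LinearMap.lTensor (SigmaTwist k) (S (j + 1)).val.toLinearMap t))
  have key : ∀ t : SigmaTwist k ⊗[k] S (j + 1), ∃ h : P t ∈ T (j + 2),
      kernelDual hT.sigma_mem (j + 1) (LinearMap.lTensor (SigmaTwist k) q.toLinearMap t) =
        KernelRing.mk T (j + 2) ⟨_, h⟩ := by
    intro t
    induction t using TensorProduct.induction_on with
    | zero =>
      have h0 : P 0 = 0 := by
        change ρ.toBialgHom (twistMul k A (LinearMap.lTensor (SigmaTwist k) _ 0)) = 0
        rw [map_zero, map_zero, map_zero]
      refine ⟨h0 ▸ zero_mem _, ?_⟩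
      rw [map_zero, map_zero]
      refine (map_zero (KernelRing.mk T (j + 2))).symm.trans (congrArg _ (Subtype.ext h0.symm))
    | add s t hs ht =>
      obtain ⟨h1, h2⟩ := hs
      obtain ⟨g1, g2⟩ := ht
      have h0 : P (s + t) = P s + P t := by
        change ρ.toBialgHom (twistMul k A (LinearMap.lTensor (SigmaTwist k) _ (s + t))) = _
        rw [map_add, map_add, map_add]
      refine ⟨h0 ▸ add_mem h1 g1, ?_⟩
      rw [map_add, map_add, h2, g2]
      exact (map_add (KernelRing.mk T (j + 2)) _ _).symm.trans
        (congrArg _ (Subtype.ext h0.symm))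
    | tmul c x =>
      obtain ⟨c, rfl⟩ := exists_toTwist c
      have h0 : P (toTwist k c ⊗ₜ x) = c • dsigma (ρ.toBialgHom (x : A)) := by
        change ρ.toBialgHom (twistMul k A (LinearMap.lTensor (SigmaTwist k) _ _)) = _
        rw [LinearMap.lTensor_tmul, twistMul_tmul, map_smul]
        exact congrArg (c • ·) (ρ.map_sigma x)
      have h1 : dsigma (ρ.toBialgHom (x : A)) ∈ T (j + 2) :=
        hT.sigma_mem (j + 1) _ ⟨x, x.2, rfl⟩
      refine ⟨h0 ▸ Subalgebra.smul_mem _ h1 c, ?_⟩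
      rw [LinearMap.lTensor_tmul, kernelDual_tmul]
      change c • KernelRing.sigmaMap hT.sigma_mem (j + 1) (q x) = _
      rw [hq, KernelRing.sigmaMap_mk]
      exact (map_smul (KernelRing.mk T (j + 2)) c _).symm.trans (congrArg _ (Subtype.ext h0.symm))
  have hzero : LinearMap.lTensor (SigmaTwist k) q.toLinearMap t = 0 := by
    refine (injective_iff_map_eq_zero _).1 hinj _ ?_
    obtain ⟨h1, h2⟩ := key t
    rw [h2]
    exact (hT.mk_eq_zero_iff _).2 ht
  obtain ⟨n, e, e', he⟩ := exists_sum_sliceLeft (fun _ : Unit => t)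
  choose c hc using fun β => exists_toTwist (k := k) (e β)
  refine ⟨n, c, fun β => (sliceLeft (e' β) t : S (j + 1)), fun β => Subtype.property _,
    fun β => ?_, ?_⟩
  · have h1 : q (sliceLeft (e' β) t) = 0 := by
      have := congrArg (sliceLeft (e' β)) hzero
      rwa [sliceLeft_lTensor, map_zero] at this
    rw [hq] at h1
    exact (hT.mk_eq_zero_iff _).1 h1
  · conv_lhs => rw [he ()]
    rw [map_sum, map_sum]
    refine Finset.sum_congr rfl fun β _ => ?_
    rw [LinearMap.lTensor_tmul, ← hc, twistMul_tmul]
    rfl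

/-- The invariants of `N` in the stages of a tower are eventually generated by the preceding ones
and their image under `σ`. -/
theorem IsNormalHom.leftInvariants_inf_succ {ρ : SigmaHopfHom k A N}
    (hρ : IsNormalHom ρ.toBialgHom) {S : ℕ → Subalgebra k A} (hS : IsTower S)
    (hT : IsTower fun i => (S i).map (ρ.toBialgHom : A →ₐ[k] N)) {j : ℕ}
    (hinj : Function.Injective (kernelDual hT.sigma_mem (j + 1))) :
    leftInvariants ρ.toBialgHom ⊓ S (j + 2) = (leftInvariants ρ.toBialgHom ⊓ S (j + 1)) ⊔
      sigmaAdjoin (leftInvariants ρ.toBialgHom ⊓ S (j + 1)) := by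
  set K := leftInvariants ρ.toBialgHom with hKdef
  have hK : IsHopfSubalgebra K := hρ.isHopfSubalgebra
  set D := K ⊓ S (j + 1) ⊔ sigmaAdjoin (K ⊓ S (j + 1)) with hD
  have hKi : IsHopfSubalgebra (K ⊓ S (j + 1)) := hK.inf (hS.hopf _)
  have hDH : IsHopfSubalgebra D := hKi.sup hKi.sigmaAdjoin
  have hKs : IsHopfSubalgebra (K ⊓ S (j + 2)) := hK.inf (hS.hopf _)
  have hDle : D ≤ K ⊓ S (j + 2) :=
    sup_le (inf_le_inf_left K (hS.monotone (Nat.le_succ _)))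
      (sigmaAdjoin_le fun x hx => ⟨dsigma_mem_leftInvariants ρ hx.1, hS.sigma_mem _ x hx.2⟩)
  refine le_antisymm (hDH.le_of_augPart_le hKs fun x hx => ?_) hDle
  obtain ⟨⟨hxK, hxS⟩, hx0⟩ := hx
  have hx0' : counit (R := k) x = 0 := hx0
  obtain ⟨t, ht⟩ := hS.exists_sub_twistMul_mem hxS
  set w := twistMul k A (LinearMap.lTensor (SigmaTwist k) (S (j + 1)).val.toLinearMap t) with hw
  have hρx : ρ.toBialgHom x = 0 := by rw [map_eq_of_mem_leftInvariants hxK, hx0', map_zero]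
  have hρw : ρ.toBialgHom w ∈ augSpan ((S (j + 1)).map (ρ.toBialgHom : A →ₐ[k] N)) := by
    have := map_mem_augSpan ρ.toBialgHom ht
    rw [map_sub, hρx, zero_sub] at this
    exact (Submodule.neg_mem_iff _).1 this
  obtain ⟨n, e, y, hyS, hyρ, hwy⟩ := exists_twist_of_map_mem hT hinj hρw
  have hxD : x ∈ augSpan (S (j + 1) ⊔ D) := by
    rw [← sub_add_cancel x w]
    refine add_mem (augSpan_mono le_sup_left ht) ?_
    rw [hw, hwy]
    refine sum_mem fun β _ => Submodule.smul_mem _ _ ?_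
    have h1 := (hρ.map_mem_augSpan_iff (hS.hopf j) (hS.hopf (j + 1))
      (hS.monotone (Nat.le_succ j)) (hyS β)).1 (hyρ β)
    have h2 := dsigma_mem_augSpan h1
    rw [sigmaAdjoin_sup] at h2
    refine augSpan_mono (sup_le_sup ?_ le_sup_right) h2
    rw [hS.succ j]
    exact le_sup_right
  have h3 := ((hS.hopf (j + 1)).sup hDH).mem_augSpan_inf hKs ⟨hxK, hxS⟩ hxD
  refine augSpan_mono ?_ h3
  refine (hS.hopf (j + 1)).le_of_le_sup hDH (((hS.hopf (j + 1)).sup hDH).inf hKs)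
    (le_inf le_sup_right hDle) inf_le_left ?_
  exact le_trans (le_inf (inf_le_right.trans (inf_le_right.trans inf_le_left)) inf_le_left)
    le_sup_left

end Invariants

/-! ### The coordinate ring of a quotient -/

section Transfer

variable {k A B : Type u} [Field k] [CommRing A] [DifferenceRing A] [HopfAlgebra k A]
  [CommRing B] [DifferenceRing B] [HopfAlgebra k B]

theorem dsigma_comm (f : SigmaHopfHom k B A) (b : B) :
    f.toBialgHom (dsigma b) = dsigma (f.toBialgHom b) := f.map_sigma b

theorem iterate_dsigma_comm (f : SigmaHopfHom k B A) (n : ℕ) (b : B) :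
    f.toBialgHom (dsigma^[n] b) = dsigma^[n] (f.toBialgHom b) := by
  induction n with
  | zero => rfl
  | succ n ih => rw [Function.iterate_succ_apply', dsigma_comm, ih, Function.iterate_succ_apply']

theorem map_adjoin_iterate (f : SigmaHopfHom k B A) (s : Set B) :
    (Algebra.adjoin k {x : B | ∃ n : ℕ, ∃ a ∈ s, x = dsigma^[n] a}).map
        (f.toBialgHom : B →ₐ[k] A) =
      Algebra.adjoin k {x : A | ∃ n : ℕ, ∃ a ∈ f.toBialgHom '' s, x = dsigma^[n] a} := by
  rw [AlgHom.map_adjoin]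
  congr 1
  ext x
  constructor
  · rintro ⟨_, ⟨n, a, ha, rfl⟩, rfl⟩
    exact ⟨n, _, ⟨a, ha, rfl⟩, iterate_dsigma_comm f n a⟩
  · rintro ⟨n, _, ⟨a, ha, rfl⟩, rfl⟩
    exact ⟨_, ⟨n, a, ha, rfl⟩, iterate_dsigma_comm f n a⟩

theorem finitelySigmaGenerated_of_surjective {f : SigmaHopfHom k B A}
    (hf : Function.Surjective f.toBialgHom) (h : FinitelySigmaGenerated k B) :
    FinitelySigmaGenerated k A := by
  classical
  obtain ⟨s, hs⟩ := h
  refine ⟨s.image f.toBialgHom, ?_⟩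
  have := map_adjoin_iterate f (s : Set B)
  rw [show Algebra.adjoin k {x : B | ∃ n : ℕ, ∃ a ∈ (s : Set B), x = dsigma^[n] a} = ⊤ from hs,
    Algebra.map_top, (AlgHom.range_eq_top _).2 hf, ← Finset.coe_image] at this
  exact this.symm

theorem finitelySigmaGenerated_of_range_eq {f : SigmaHopfHom k B A}
    (hf : Function.Injective f.toBialgHom) (t : Finset A)
    (h : (f.toBialgHom : B →ₐ[k] A).range =
      Algebra.adjoin k {x : A | ∃ n : ℕ, ∃ a ∈ t, x = dsigma^[n] a}) :
    FinitelySigmaGenerated k B := by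
  classical
  have ht : ∀ a : t, ∃ b, f.toBialgHom b = a := fun a => by
    have : (a : A) ∈ (f.toBialgHom : B →ₐ[k] A).range := by
      rw [h]
      exact Algebra.subset_adjoin ⟨0, a, a.2, rfl⟩
    exact this
  choose g hg using ht
  refine ⟨Finset.univ.image g, ?_⟩
  have hg' : f.toBialgHom '' (Finset.univ.image g : Finset B) = (t : Set A) := by
    ext x
    simp only [Finset.coe_image, Finset.coe_univ, Set.image_univ]
    constructor
    · rintro ⟨_, ⟨a, rfl⟩, rfl⟩
      rw [hg]
      exact a.2
    · intro hx
      exact ⟨_, ⟨⟨x, hx⟩, rfl⟩, hg ⟨x, hx⟩⟩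
  have := map_adjoin_iterate f (Finset.univ.image g : Set B)
  rw [hg'] at this
  refine Subalgebra.map_injective (f := (f.toBialgHom : B →ₐ[k] A)) hf ?_
  rw [Algebra.map_top, h]
  exact this

/-- A morphism into `A` whose image lies in a Hopf subalgebra factors through it. -/
theorem exists_factorization {Q : Type u} [CommRing Q] [DifferenceRing Q] [HopfAlgebra k Q]
    {f : SigmaHopfHom k B A} (hf : Function.Injective f.toBialgHom) (π : SigmaHopfHom k Q A)
    (h : ∀ x, π.toBialgHom x ∈ (f.toBialgHom : B →ₐ[k] A).range) :
    ∃ π' : SigmaHopfHom k Q B, ∀ x, f.toBialgHom (π'.toBialgHom x) = π.toBialgHom x := by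
  let p : Q →ₐ[k] B := (AlgEquiv.ofInjective (f.toBialgHom : B →ₐ[k] A) hf).symm.toAlgHom.comp
    ((π.toBialgHom : Q →ₐ[k] A).codRestrict _ h)
  have hp : ∀ x, f.toBialgHom (p x) = π.toBialgHom x := fun x =>
    congrArg Subtype.val ((AlgEquiv.ofInjective (f.toBialgHom : B →ₐ[k] A) hf).apply_symm_apply
      ⟨π.toBialgHom x, h x⟩)
  have hpc : (f.toBialgHom : B →ₐ[k] A).comp p = (π.toBialgHom : Q →ₐ[k] A) :=
    AlgHom.ext hp
  refine ⟨⟨BialgHom.ofAlgHom p ?_ ?_, fun x => hf ?_⟩, hp⟩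
  · ext x
    change counit (p x) = counit x
    rw [← CoalgHomClass.counit_comp_apply f.toBialgHom, hp, CoalgHomClass.counit_comp_apply]
  · ext x
    refine tensorMap_injective (f := (f.toBialgHom : B →ₐ[k] A))
      (g := (f.toBialgHom : B →ₐ[k] A)) hf hf ?_
    change Algebra.TensorProduct.map (f.toBialgHom : B →ₐ[k] A) (f.toBialgHom : B →ₐ[k] A)
      (Algebra.TensorProduct.map p p (comul x)) =
        Algebra.TensorProduct.map (f.toBialgHom : B →ₐ[k] A) (f.toBialgHom : B →ₐ[k] A)
          (comul (p x))
    rw [← AlgHom.comp_apply, ← Algebra.TensorProduct.map_comp, hpc]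
    refine (CoalgHomClass.map_comp_comul_apply π.toBialgHom x).trans ?_
    rw [← hp]
    exact (CoalgHomClass.map_comp_comul_apply f.toBialgHom (p x)).symm
  · change f.toBialgHom (p (dsigma x)) = f.toBialgHom (dsigma (p x))
    rw [hp, dsigma_comm, dsigma_comm, hp]

end Transfer

section Quotient

variable {k A : Type u} [Field k] [DifferenceRing k] [CommRing A] [DifferenceRing A]
  [HopfAlgebra k A] [DifferenceHopfAlgebra k A]

/-- Every element of a `σ`-stable Hopf subalgebra lies in a finitely `σ`-generated one. -/
theorem IsHopfSubalgebra.exists_finitelySigmaGenerated {K : Subalgebra k A}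
    (hK : IsHopfSubalgebra K) (hσ : ∀ x ∈ K, dsigma x ∈ K) {x : A} (hx : x ∈ K) :
    ∃ t : Finset A,
      IsHopfSubalgebra (Algebra.adjoin k {x : A | ∃ n : ℕ, ∃ a ∈ t, x = dsigma^[n] a}) ∧
      Algebra.adjoin k {x : A | ∃ n : ℕ, ∃ a ∈ t, x = dsigma^[n] a} ≤ K ∧
      x ∈ Algebra.adjoin k {x : A | ∃ n : ℕ, ∃ a ∈ t, x = dsigma^[n] a} := by
  obtain ⟨C, hC, ⟨t, rfl⟩, hCK, hxC⟩ := hK.exists_fg (fun _ : Unit => x) (fun _ => hx)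
  have hW : ∀ n : ℕ, IsHopfSubalgebra (Algebra.adjoin k (dsigma^[n] '' (t : Set A))) := by
    intro n
    induction n with
    | zero => simpa using hC
    | succ n ih =>
      rw [Function.iterate_succ', Set.image_comp, ← sigmaAdjoin_adjoin]
      exact ih.sigmaAdjoin
  have heq : Algebra.adjoin k {x : A | ∃ n : ℕ, ∃ a ∈ t, x = dsigma^[n] a} =
      ⨆ n : ℕ, Algebra.adjoin k (dsigma^[n] '' (t : Set A)) := by
    rw [← Algebra.adjoin_iUnion]
    congr 1
    ext x
    simp only [Set.mem_iUnion, Set.mem_image, Set.mem_ofPred_eq, Finset.mem_coe, eq_comm]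
  refine ⟨t, heq ▸ isHopfSubalgebra_iSup hW, Algebra.adjoin_le ?_, ?_⟩
  · rintro _ ⟨n, a, ha, rfl⟩
    have haK : a ∈ K := hCK (Algebra.subset_adjoin ha)
    induction n with
    | zero => exact haK
    | succ n ih =>
      rw [Function.iterate_succ_apply']
      exact hσ _ ih
  · refine Algebra.adjoin_mono (fun a ha => ?_) (hxC ())
    exact ⟨0, a, ha, rfl⟩

theorem dsigma_mem_adjoin_iterate (t : Finset A) :
    ∀ x ∈ Algebra.adjoin k {x : A | ∃ n : ℕ, ∃ a ∈ t, x = dsigma^[n] a},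
      dsigma x ∈ Algebra.adjoin k {x : A | ∃ n : ℕ, ∃ a ∈ t, x = dsigma^[n] a} := by
  intro x hx
  have h := dsigma_mem_sigmaAdjoin hx
  rw [sigmaAdjoin_adjoin] at h
  refine Algebra.adjoin_mono ?_ h
  rintro _ ⟨_, ⟨n, a, ha, rfl⟩, rfl⟩
  exact ⟨n + 1, a, ha, (Function.iterate_succ_apply' _ _ _).symm⟩

variable {N Q : Type u} [CommRing N] [DifferenceRing N] [HopfAlgebra k N]
  [CommRing Q] [DifferenceRing Q] [HopfAlgebra k Q]

/-- The image of `k{G/N}` in `k{G}` consists of the invariants of `N`. -/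
theorem range_eq_leftInvariants [DifferenceHopfAlgebra k N] {ρ : SigmaHopfHom k A N}
    {π : SigmaHopfHom k Q A}
    (hρ : IsNormalHom ρ.toBialgHom) (hπ : IsQuotientMod ρ π) :
    (π.toBialgHom : Q →ₐ[k] A).range = leftInvariants ρ.toBialgHom := by
  refine le_antisymm ?_ fun x hx => ?_
  · rintro _ ⟨c, rfl⟩
    exact mem_leftInvariants_of_killsSubgroup hπ.1 c
  · obtain ⟨t, hC, hCK, hxC⟩ := hρ.isHopfSubalgebra.exists_finitelySigmaGenerated
      (fun _ => dsigma_mem_leftInvariants ρ) hx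
    obtain ⟨B, _, _, _, _, f, hf, hfC⟩ :=
      hC.exists_differenceHopfAlgebra (dsigma_mem_adjoin_iterate t)
    have hkill : KillsSubgroup ρ f := killsSubgroup_of_mem_leftInvariants fun c =>
      hCK (hfC ▸ ⟨c, rfl⟩)
    obtain ⟨θ', hθ, -⟩ := hπ.2 B (finitelySigmaGenerated_of_range_eq hf t hfC) f hkill
    rw [← hfC] at hxC
    obtain ⟨b, rfl⟩ := hxC
    exact ⟨θ'.toBialgHom b, hθ b⟩

/-- The uniqueness in the universal property makes `k{G/N} → k{G}` injective: the embedding of the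
image of `k{G/N}` factors through `k{G/N}`, and this factorization is inverse to the corestriction
of `k{G/N} → k{G}`. -/
theorem injective_of_isQuotientMod [DifferenceHopfAlgebra k N] [DifferenceHopfAlgebra k Q]
    {ρ : SigmaHopfHom k A N} {π : SigmaHopfHom k Q A}
    (hρ : IsNormalHom ρ.toBialgHom) (hπ : IsQuotientMod ρ π) (hQ : FinitelySigmaGenerated k Q) :
    Function.Injective π.toBialgHom := by
  classical
  obtain ⟨B, _, _, _, _, f, hf, hfK⟩ :=
    hρ.isHopfSubalgebra.exists_differenceHopfAlgebra (fun _ => dsigma_mem_leftInvariants ρ)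
  obtain ⟨π', hπ'⟩ := exists_factorization hf π fun x => by
    rw [hfK]
    exact mem_leftInvariants_of_killsSubgroup hπ.1 x
  have hB : FinitelySigmaGenerated k B := by
    refine finitelySigmaGenerated_of_surjective (f := π') (fun b => ?_) hQ
    have : f.toBialgHom b ∈ (π.toBialgHom : Q →ₐ[k] A).range := by
      rw [range_eq_leftInvariants hρ hπ, ← hfK]
      exact ⟨b, rfl⟩
    obtain ⟨x, hx⟩ := this
    exact ⟨x, hf ((hπ' x).trans hx)⟩
  have hkill : KillsSubgroup ρ f := killsSubgroup_of_mem_leftInvariants fun c =>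
    hfK ▸ ⟨c, rfl⟩
  obtain ⟨θ', hθ, -⟩ := hπ.2 B hB f hkill
  obtain ⟨_, -, huniq⟩ := hπ.2 Q hQ π hπ.1
  let u : SigmaHopfHom k Q Q :=
    { toBialgHom := θ'.toBialgHom.comp π'.toBialgHom
      map_sigma := fun x =>
        (congrArg θ'.toBialgHom (dsigma_comm π' x)).trans (dsigma_comm θ' (π'.toBialgHom x)) }
  let v : SigmaHopfHom k Q Q := { toBialgHom := BialgHom.id k Q, map_sigma := fun _ => rfl }
  have huv : u = v := (huniq u fun c => (hθ (π'.toBialgHom c)).trans (hπ' c)).trans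
    (huniq v fun _ => rfl).symm
  have hleft : ∀ x, θ'.toBialgHom (π'.toBialgHom x) = x := fun x =>
    congrArg (fun w : SigmaHopfHom k Q Q => w.toBialgHom x) huv
  intro x y hxy
  rw [← hleft x, ← hleft y]
  congr 1
  apply hf
  rw [hπ', hπ', hxy]

theorem map_comap_eq_range_inf {k A B : Type*} [CommRing k] [CommRing A] [Algebra k A]
    [CommRing B] [Algebra k B] (f : A →ₐ[k] B) (C : Subalgebra k B) :
    (C.comap f).map f = f.range ⊓ C := by
  ext x
  constructor
  · rintro ⟨y, hy, rfl⟩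
    exact ⟨⟨y, rfl⟩, hy⟩
  · rintro ⟨⟨y, rfl⟩, hx⟩
    exact ⟨y, hx, rfl⟩

/-- The invariants of `N` in the stages of a tower on `k{G}` give a tower on `k{G/N}`. -/
theorem IsTower.comap {ρ : SigmaHopfHom k A N} {π : SigmaHopfHom k Q A}
    (hπ : Function.Injective π.toBialgHom)
    (hr : (π.toBialgHom : Q →ₐ[k] A).range = leftInvariants ρ.toBialgHom)
    (hK : IsHopfSubalgebra (leftInvariants ρ.toBialgHom)) {S : ℕ → Subalgebra k A}
    (hS : IsTower S) {m : ℕ}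
    (h : ∀ i, m ≤ i → leftInvariants ρ.toBialgHom ⊓ S (i + 1) =
      (leftInvariants ρ.toBialgHom ⊓ S i) ⊔ sigmaAdjoin (leftInvariants ρ.toBialgHom ⊓ S i)) :
    IsTower fun i => (S (m + i)).comap (π.toBialgHom : Q →ₐ[k] A) := by
  have hmap : ∀ i, ((S i).comap (π.toBialgHom : Q →ₐ[k] A)).map (π.toBialgHom : Q →ₐ[k] A) =
      leftInvariants ρ.toBialgHom ⊓ S i := fun i => by
    rw [← hr, map_comap_eq_range_inf]
  have hS0 : ∀ i, (S i).FG := fun i => by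
    induction i with
    | zero => exact hS.fg
    | succ i ih =>
      obtain ⟨t, ht⟩ := ih
      rw [hS.succ, ← ht, sigmaAdjoin_adjoin]
      refine Subalgebra.FG.sup ⟨t, rfl⟩ ?_
      exact Subalgebra.fg_def.2 ⟨_, t.finite_toSet.image _, rfl⟩
  exact
    { hopf := fun i => (hS.hopf _).comap π.toBialgHom hπ
      fg := by
        refine Subalgebra.fg_of_fg_map _ (π.toBialgHom : Q →ₐ[k] A) hπ ?_
        rw [hmap]
        exact (hK.inf (hS.hopf _)).fg_of_le (hS0 (m + 0)) inf_le_right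
      succ := fun i => by
        refine Subalgebra.map_injective (f := (π.toBialgHom : Q →ₐ[k] A)) hπ ?_
        rw [Algebra.map_sup, map_sigmaAdjoin, hmap, hmap]
        exact h (m + i) (Nat.le_add_right m i)
      exhaust := fun x => by
        obtain ⟨i, hi⟩ := hS.exhaust (π.toBialgHom x)
        exact ⟨i, hS.monotone (Nat.le_add_left i m) hi⟩ }

end Quotient

section Multiplicativity

variable {k A N Q : Type u} [Field k] [DifferenceRing k]
  [CommRing A] [DifferenceRing A] [HopfAlgebra k A] [DifferenceHopfAlgebra k A]
  [CommRing N] [DifferenceRing N] [HopfAlgebra k N] [DifferenceHopfAlgebra k N]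
  [CommRing Q] [DifferenceRing Q] [HopfAlgebra k Q] [DifferenceHopfAlgebra k Q]

/-- A tower on `k{G}` induces towers on `k{N}`, by restriction, and on `k{G/N}`, by taking
invariants. The limit degrees are the indices of the three towers at a large stage, where
`IsNormalHom.hopfIndex_eq_mul` compares them. -/
theorem limitDegree_eq_mul (hA : FinitelySigmaGenerated k A) (hQ : FinitelySigmaGenerated k Q)
    {ρ : SigmaHopfHom k A N} {π : SigmaHopfHom k Q A} (hρ : IsNormalSubgroup ρ)
    (hπ : IsQuotientMod ρ π) : limitDegree k A = limitDegree k Q * limitDegree k N := by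
  have hn := isNormalHom_of_isNormalSubgroup hρ
  have hK := hn.isHopfSubalgebra
  have hinj := injective_of_isQuotientMod hn hπ hQ
  have hr := range_eq_leftInvariants hn hπ
  have hN : FinitelySigmaGenerated k N := finitelySigmaGenerated_of_surjective hρ.1 hA
  obtain ⟨S, hS⟩ := exists_isTower hA
  have hT := hS.map ρ hρ.1
  obtain ⟨m, hm⟩ := hT.exists_sigmaDual_bijective
  have hU := hS.comap hinj hr hK (m := m + 1) fun i hi => by
    obtain ⟨j, rfl⟩ : ∃ j, i = j + 1 := ⟨i - 1, by omega⟩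
    exact hn.leftInvariants_inf_succ hS hT (hm (j + 1) (by omega)).1
  obtain ⟨a, dA, ha⟩ := hS.exists_hopfIndex_eq
  obtain ⟨b, dN, hb⟩ := hT.exists_hopfIndex_eq
  obtain ⟨c, dQ, hc⟩ := hU.exists_hopfIndex_eq
  rw [← hS.eq_limitDegree hA ha, ← hT.eq_limitDegree hN hb, ← hU.eq_limitDegree hQ hc]
  -- the stages `m + 1 + n` and `m + 1 + n + 1` lie in the stable range of all three towers
  set n := max a (max b c) with hnn
  have h1 := hn.hopfIndex_eq_mul (hS.hopf (m + 1 + n)) (hS.hopf (m + 1 + n + 1))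
    (hS.monotone (Nat.le_succ _))
  have h2 := hc n (by omega)
  have hmap : ∀ i, ((S i).comap (π.toBialgHom : Q →ₐ[k] A)).map (π.toBialgHom : Q →ₐ[k] A) =
      leftInvariants ρ.toBialgHom ⊓ S i := fun i => by
    rw [← hr, map_comap_eq_range_inf]
  rw [← hopfIndex_map hinj (hU.hopf n) (hU.hopf (n + 1)), hmap, hmap] at h2
  rw [ha _ (by omega), hb (m + 1 + n) (by omega)] at h1
  rw [h1, ← h2]
  rfl

end Multiplicativity

end LimitDegree

theorem mainTheorem10 (k : Type u) [Field k] [DifferenceRing k] :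
    -- the limit degree is well defined
    (∀ (A : Type u) [CommRing A] [DifferenceRing A] [HopfAlgebra k A]
      [DifferenceHopfAlgebra k A], FinitelySigmaGenerated k A →
      (∃ d, IsGrowthSize k A d) ∧
      (∀ (B : Type u) [CommRing B] [HopfAlgebra k B] [Algebra.FiniteType k B]
        (φ : SigmaClosedEmbedding k A B), IsLeast {m | φ.StableFrom m} φ.growthIndex) ∧
      (∀ (B B' : Type u) [CommRing B] [HopfAlgebra k B] [Algebra.FiniteType k B]
        [CommRing B'] [HopfAlgebra k B'] [Algebra.FiniteType k B']
        (φ : SigmaClosedEmbedding k A B) (φ' : SigmaClosedEmbedding k A B'),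
        φ.growthSize = φ'.growthSize) ∧
      (∀ (B : Type u) [CommRing B] [HopfAlgebra k B] [Algebra.FiniteType k B]
        (φ : SigmaClosedEmbedding k A B), φ.growthSize = limitDegree k A)) ∧
    -- the limit degree is multiplicative
    (∀ (A N Q : Type u)
      [CommRing A] [DifferenceRing A] [HopfAlgebra k A] [DifferenceHopfAlgebra k A]
      [CommRing N] [DifferenceRing N] [HopfAlgebra k N] [DifferenceHopfAlgebra k N]
      [CommRing Q] [DifferenceRing Q] [HopfAlgebra k Q] [DifferenceHopfAlgebra k Q],
      FinitelySigmaGenerated k A → FinitelySigmaGenerated k Q →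
      ∀ (ρ : SigmaHopfHom k A N) (π : SigmaHopfHom k Q A),
      IsNormalSubgroup ρ → IsQuotientMod ρ π →
      limitDegree k A = limitDegree k Q * limitDegree k N) := by
  refine ⟨fun A _ _ _ _ hA => ⟨LimitDegree.exists_isGrowthSize hA,
    fun B _ _ _ φ => LimitDegree.isLeast_growthIndex φ,
    fun B B' _ _ _ _ _ _ φ φ' => LimitDegree.growthSize_eq φ φ',
    fun B _ _ _ φ => ?_⟩, ?_⟩
  · exact (LimitDegree.isTower_closure φ).eq_limitDegree hA
      (fun _ => LimitDegree.hopfIndex_closure φ)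
  · intro A N Q _ _ _ _ _ _ _ _ _ _ _ _ hA hQ ρ π hρ hπ
    exact LimitDegree.limitDegree_eq_mul hA hQ hρ hπ

end
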